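/- All graphs are finite and simple. For graphs $G$ and $H$, with $H$ on $k$ vertices, write $G\longrightarrow H$ if for every coloring of the vertices of $G$ with exactly $k$ colors (all $k$ colors being used) there is an induced subgraph of $G$ isomorphic to $H$ whose vertices have pairwise distinct colors. Let $f(H)=\max\{|V(G)| : G\longrightarrow H\}$ if this maximum exists, and $f(H)=\infty$ otherwise. Theorem. Let $H$ be a graph on $k$ vertices. If $H$ or its complement is (1) a complete graph, (2) a star, or (3) the graph $P_3+K_1$, that is, the disjoint union of a path on three vertices and an isolated vertex, then $f(H)=\infty$. Otherwise $f(H)\le k+2$ if $k$ is even, and $f(H)\le k+1$ if $k$ is odd. -/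

import Mathlib

/-- `Arrows G H`: for every colouring of the vertices of `G` with exactly `|V(H)|` colours (all of
them used), some induced copy of `H` in `G` is rainbow, i.e. its vertices have pairwise distinct
colours. -/
def Arrows {W V : Type*} [Fintype V] (G : SimpleGraph W) (H : SimpleGraph V) : Prop :=
  ∀ c : W → Fin (Fintype.card V), Function.Surjective c →
    ∃ φ : H ↪g G, Function.Injective (fun v => c (φ v))

/-- The orders of the finite graphs that arrow `H`. -/
def arrowOrders {V : Type*} [Fintype V] (H : SimpleGraph V) : Set ℕ :=
  {n | ∃ G : SimpleGraph (Fin n), Arrows G H}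

open Classical in
/-- `f(H)`: the largest order of a graph that arrows `H` if there is one, and `∞` otherwise.
The set of orders is never empty (`card_mem_arrowOrders`), so where it is bounded its supremum in
`ℕ` is its maximum. -/
noncomputable def antiRamsey {V : Type*} [Fintype V] (H : SimpleGraph V) : ℕ∞ :=
  if BddAbove (arrowOrders H) then ((sSup (arrowOrders H) : ℕ) : ℕ∞) else ⊤

/-- `H` is a star: one vertex is adjacent to all others and there are no further edges. -/
def IsStar {V : Type*} (H : SimpleGraph V) : Prop :=
  ∃ r : V, H = SimpleGraph.starGraph r

/-- `H` is isomorphic to `P₃ + K₁`, the disjoint union of two adjacent edges and an isolated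
vertex. -/
def IsPathThreeAddPoint {V : Type*} (H : SimpleGraph V) : Prop :=
  Nonempty (H ≃g (SimpleGraph.pathGraph 3 ⊕g (⊥ : SimpleGraph (Fin 1))))

/-- `H` is complete, a star, or `P₃ + K₁`. -/
def IsExceptional {V : Type*} (H : SimpleGraph V) : Prop :=
  H = ⊤ ∨ IsStar H ∨ IsPathThreeAddPoint H

theorem card_mem_arrowOrders {V : Type*} [Fintype V] (H : SimpleGraph V) :
    Fintype.card V ∈ arrowOrders H := by
  let e := Fintype.equivFin V
  refine ⟨H.map e.toEmbedding, fun c hc => ⟨(SimpleGraph.Iso.map e H).toEmbedding, ?_⟩⟩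
  exact (Finite.injective_iff_surjective.mpr hc).comp e.injective

/-! Upper bound. The vertex sets of the induced copies of `H` in an arrowing graph `G` form a
`RainbowFamily`. Private colours on a set `S`, with the remaining vertices lumped into one or two
classes, show that every `(k-1)`-set extends to a member (`exists_insert`), and that every
`(k-2)`-set extends by one vertex from each side of any split of the rest (`exists_insert_insert`).
Members have equal edge counts and equal degree sequences, so exchanging vertices yields equations
and inequalities between degrees. Let `G` have `k + m` vertices with `m ≥ 2`; the claim to prove is
that `m = 2` and `k` is even (`ProperFamily.eq_two_and_even`).

Suppose first that members have neither isolated nor dominating vertices. A vertex of `G` of too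
small degree would have `k - 1` non-neighbours, and exchanges around it lead to a contradiction
(`DetachedVertex.false`). Applied to `G` and to its complement, this puts all degrees of `G` between
`a + m` and `b`, where `a` and `b` are the extreme degrees of a member (`BalancedFamily`). Then `G`
is regular, and an edge count in complements of members forces `m = 2`. If `k` were odd, `G` or its
complement would be a Moore graph of diameter two and even degree, which the Hoffman-Singleton
eigenvalue argument excludes.

Otherwise, up to complementation, members have an isolated vertex. Two isolated vertices force the
other vertices to induce a perfect matching, which is treated directly. If there is exactly one,
some member `B ∪ {u}` has `u` isolated in it but not in `G`. Every `(k-1)`-set without isolated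
vertices is then a copy of `B` (`exists_iso_base`). For a neighbour `a` of `u` this leaves two
possibilities: some `a` has exactly one neighbour in `B`, and `B` is an edge plus a three-vertex
path (`TailVertex`); or no `a` has any, and `B` is a matching plus a path or triangle on three
vertices. In both, `k` is even and a third extra vertex is impossible.

Infinite values. Complete graphs arrow complete graphs and stars arrow stars, at every order. For
`P₃ + K₁` the graphs `sevenRows N` work: representatives of the four colours lie in four rows, any
four rows induce the same graph on 28 vertices, and a verified exhaustive search handles that graph.
Passing to complements preserves arrowing. -/

/-! ### Degrees within vertex sets, and rainbow families -/

open scoped Classical in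
/-- The adjacency indicator of `G`, as an integer. -/
noncomputable def adjInd {W : Type*} (G : SimpleGraph W) (x y : W) : ℤ :=
  if G.Adj x y then 1 else 0

/-- The number of neighbours of `x` in `T`, as an integer. -/
noncomputable def degIn {W : Type*} (G : SimpleGraph W) (T : Finset W) (x : W) : ℤ :=
  ∑ w ∈ T, adjInd G x w

/-- The sum of the degrees of the graph induced on `T`. -/
noncomputable def degSum {W : Type*} (G : SimpleGraph W) (T : Finset W) : ℤ :=
  ∑ x ∈ T, degIn G T x

/-- A family of `k`-sets inducing pairwise isomorphic subgraphs of `G` such that every surjective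
colouring with `k` colours is injective on a member. -/
structure RainbowFamily {W : Type*} (G : SimpleGraph W) (k : ℕ) (F : Set (Finset W)) : Prop where
  card : ∀ T ∈ F, T.card = k
  iso : ∀ T ∈ F, ∀ T' ∈ F, ∃ f : W → W, Set.BijOn f T T' ∧
    ∀ x ∈ T, ∀ y ∈ T, (G.Adj (f x) (f y) ↔ G.Adj x y)
  rainbow : ∀ c : W → Fin k, Function.Surjective c → ∃ T ∈ F, Set.InjOn c T

section Indicator

open scoped Classical

variable {W : Type*} {G : SimpleGraph W}

theorem adjInd_comm (x y : W) : adjInd G x y = adjInd G y x := by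
  simp [adjInd, G.adj_comm]

@[simp] theorem adjInd_self (x : W) : adjInd G x x = 0 := by simp [adjInd]

theorem adjInd_nonneg (x y : W) : 0 ≤ adjInd G x y := by
  unfold adjInd; split_ifs <;> simp

theorem adjInd_le_one (x y : W) : adjInd G x y ≤ 1 := by
  unfold adjInd; split_ifs <;> simp

theorem adjInd_eq_one {x y : W} : adjInd G x y = 1 ↔ G.Adj x y := by
  unfold adjInd; split_ifs <;> simp_all

theorem adjInd_eq_zero {x y : W} : adjInd G x y = 0 ↔ ¬ G.Adj x y := by
  unfold adjInd; split_ifs <;> simp_all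

theorem adjInd_zero_or_one (x y : W) : adjInd G x y = 0 ∨ adjInd G x y = 1 := by
  unfold adjInd; split_ifs <;> simp

theorem adjInd_compl {x y : W} (h : x ≠ y) : adjInd Gᶜ x y = 1 - adjInd G x y := by
  unfold adjInd
  by_cases hxy : G.Adj x y <;> simp [hxy, h]

theorem degIn_eq_card (T : Finset W) (x : W) :
    degIn G T x = ((T.filter (G.Adj x)).card : ℤ) := by
  simp [degIn, adjInd]

theorem degIn_nonneg (T : Finset W) (x : W) : 0 ≤ degIn G T x :=
  Finset.sum_nonneg fun _ _ => adjInd_nonneg _ _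

@[simp] theorem degIn_empty (x : W) : degIn G ∅ x = 0 := by simp [degIn]

theorem degIn_insert {T : Finset W} {v : W} (hv : v ∉ T) (x : W) :
    degIn G (insert v T) x = adjInd G x v + degIn G T x := by
  simp [degIn, Finset.sum_insert hv]

theorem degIn_erase {T : Finset W} {v : W} (hv : v ∈ T) (x : W) :
    degIn G (T.erase v) x = degIn G T x - adjInd G x v := by
  have := Finset.add_sum_erase T (adjInd G x) hv
  simp only [degIn]; linarith

theorem degIn_union {S T : Finset W} (h : Disjoint S T) (x : W) :
    degIn G (S ∪ T) x = degIn G S x + degIn G T x := by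
  simp [degIn, Finset.sum_union h]

theorem degIn_sdiff {S T : Finset W} (h : S ⊆ T) (x : W) :
    degIn G (T \ S) x = degIn G T x - degIn G S x := by
  have := Finset.sum_sdiff (f := adjInd G x) h
  simp only [degIn]; linarith

theorem degIn_mono {S T : Finset W} (h : S ⊆ T) (x : W) : degIn G S x ≤ degIn G T x :=
  Finset.sum_le_sum_of_subset_of_nonneg h fun _ _ _ => adjInd_nonneg _ _

theorem degIn_le_card (T : Finset W) (x : W) : degIn G T x ≤ T.card := by
  rw [degIn_eq_card]; exact_mod_cast Finset.card_filter_le _ _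

theorem degIn_le_card_sub_one {T : Finset W} {x : W} (hx : x ∈ T) :
    degIn G T x ≤ T.card - 1 := by
  have h1 := degIn_erase (G := G) hx x
  have h2 := degIn_le_card (G := G) (T.erase x) x
  have h3 := Finset.card_erase_add_one hx
  simp at h1
  push_cast [← h3]; linarith

theorem degIn_eq_zero {T : Finset W} {x : W} :
    degIn G T x = 0 ↔ ∀ y ∈ T, ¬ G.Adj x y := by
  rw [degIn_eq_card]; simp [Finset.filter_eq_empty_iff]

theorem degIn_pos {T : Finset W} {x : W} : 0 < degIn G T x ↔ ∃ y ∈ T, G.Adj x y := by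
  rw [degIn_eq_card]; simp [Finset.card_pos, Finset.Nonempty]

theorem degIn_eq_card_iff {T : Finset W} {x : W} :
    degIn G T x = T.card ↔ ∀ y ∈ T, G.Adj x y := by
  rw [degIn_eq_card, Nat.cast_inj, Finset.card_filter_eq_iff]

theorem adjInd_le_degIn {T : Finset W} {x y : W} (hy : y ∈ T) : adjInd G x y ≤ degIn G T x :=
  Finset.single_le_sum (f := adjInd G x) (fun _ _ => adjInd_nonneg _ _) hy

/-- In a set where `x` has exactly one neighbour, that neighbour is unique. -/
theorem eq_of_degIn_le_one {T : Finset W} {x y z : W} (h : degIn G T x ≤ 1) (hy : y ∈ T)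
    (hz : z ∈ T) (hxy : G.Adj x y) (hxz : G.Adj x z) : y = z := by
  rw [degIn_eq_card] at h
  exact Finset.card_le_one.1 (by exact_mod_cast h) y (by simp [*]) z (by simp [*])

theorem degIn_compl (T : Finset W) {x : W} (hx : x ∉ T) :
    degIn Gᶜ T x = T.card - degIn G T x := by
  unfold degIn
  rw [Finset.sum_congr rfl fun w hw => adjInd_compl (G := G) (x := x) (y := w)
    (by rintro rfl; exact hx hw)]
  simp

theorem degIn_compl_of_mem (T : Finset W) {x : W} (hx : x ∈ T) :
    degIn Gᶜ T x = T.card - 1 - degIn G T x := by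
  have h := degIn_compl (G := G) (T.erase x) (Finset.notMem_erase x T)
  rw [degIn_erase hx, degIn_erase hx] at h
  have h3 := Finset.card_erase_add_one hx
  simp at h
  rw [h, ← h3]; push_cast; ring

theorem degSum_insert {T : Finset W} {v : W} (hv : v ∉ T) :
    degSum G (insert v T) = degSum G T + 2 * degIn G T v := by
  unfold degSum
  rw [Finset.sum_insert hv, degIn_insert hv,
    Finset.sum_congr rfl fun x _ => degIn_insert hv x, Finset.sum_add_distrib]
  have : ∑ x ∈ T, adjInd G x v = degIn G T v :=
    Finset.sum_congr rfl fun x _ => adjInd_comm x v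
  simp [this]; ring

theorem degSum_erase {T : Finset W} {v : W} (hv : v ∈ T) :
    degSum G (T.erase v) = degSum G T - 2 * degIn G T v := by
  have h := degSum_insert (G := G) (Finset.notMem_erase v T)
  rw [Finset.insert_erase hv, degIn_erase hv] at h
  simp at h; linarith

theorem even_degSum (T : Finset W) : Even (degSum G T) := by
  induction T using Finset.induction_on with
  | empty => simp [degSum]
  | insert v T hv ih => rw [degSum_insert hv]; exact ih.add (even_two_mul _)

end Indicator

/-! ### Extending sets to members, and exchange inequalities -/

namespace RainbowFamily

open scoped Classical

variable {W : Type*} {G : SimpleGraph W} {k : ℕ} {F : Set (Finset W)}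

theorem compl (h : RainbowFamily G k F) : RainbowFamily Gᶜ k F where
  card := h.card
  iso T hT T' hT' := by
    obtain ⟨f, hf, hadj⟩ := h.iso T hT T' hT'
    refine ⟨f, hf, fun x hx y hy => ?_⟩
    rw [SimpleGraph.compl_adj, SimpleGraph.compl_adj, hadj x hx y hy, Ne, hf.injOn.eq_iff hx hy]
  rainbow := h.rainbow

theorem exists_iso (h : RainbowFamily G k F) {T T' : Finset W} (hT : T ∈ F) (hT' : T' ∈ F) :
    ∃ f : W → W, Set.BijOn f T T' ∧ (∀ x ∈ T, ∀ y ∈ T, (G.Adj (f x) (f y) ↔ G.Adj x y)) ∧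
      ∀ x ∈ T, degIn G T' (f x) = degIn G T x := by
  obtain ⟨f, hf, hadj⟩ := h.iso T hT T' hT'
  refine ⟨f, hf, hadj, fun x hx => ?_⟩
  exact (Finset.sum_bij (fun x _ => f x) (fun x hx => hf.mapsTo hx)
    (fun x hx y hy e => hf.injOn hx hy e)
    (fun y hy => by obtain ⟨x, hx, rfl⟩ := hf.surjOn hy; exact ⟨x, hx, rfl⟩)
    (fun y hy => by simp [adjInd, hadj x hx y hy])).symm

/-- Isomorphism invariance of sums over the degree sequence. -/
theorem sum_eq (h : RainbowFamily G k F) {T T' : Finset W} (hT : T ∈ F) (hT' : T' ∈ F)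
    (φ : ℤ → ℤ) : ∑ x ∈ T, φ (degIn G T x) = ∑ x ∈ T', φ (degIn G T' x) := by
  obtain ⟨f, hf, -, hdeg⟩ := h.exists_iso hT hT'
  exact Finset.sum_bij (fun x _ => f x) (fun x hx => hf.mapsTo hx)
    (fun x hx y hy e => hf.injOn hx hy e)
    (fun y hy => by obtain ⟨x, hx, rfl⟩ := hf.surjOn hy; exact ⟨x, hx, rfl⟩)
    (fun x hx => by rw [hdeg x hx])

theorem degSum_eq (h : RainbowFamily G k F) {T T' : Finset W} (hT : T ∈ F) (hT' : T' ∈ F) :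
    degSum G T = degSum G T' := h.sum_eq hT hT' id

theorem card_filter_deg (h : RainbowFamily G k F) {T T' : Finset W} (hT : T ∈ F) (hT' : T' ∈ F)
    (P : ℤ → Prop) [DecidablePred P] :
    (T.filter fun x => P (degIn G T x)).card = (T'.filter fun x => P (degIn G T' x)).card := by
  have := h.sum_eq hT hT' fun d => if P d then 1 else 0
  simpa using this

theorem exists_deg (h : RainbowFamily G k F) {T T' : Finset W} (hT : T ∈ F) (hT' : T' ∈ F)
    {x : W} (hx : x ∈ T) : ∃ y ∈ T', degIn G T' y = degIn G T x := by
  obtain ⟨f, hf, -, hdeg⟩ := h.exists_iso hT hT'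
  exact ⟨f x, hf.mapsTo hx, hdeg x hx⟩

/-- Give the vertices of `S` private colours and colour the others by `c`. -/
theorem exists_superset (h : RainbowFamily G k F) {r : ℕ} (S : Finset W) (hS : S.card + r = k)
    (c : W → Fin r) (hc : ∀ i, ∃ w, w ∉ S ∧ c w = i) :
    ∃ T ∈ F, S ⊆ T ∧ Set.InjOn c (T \ S : Finset W) := by
  have hcard : Fintype.card (S ⊕ Fin r) = k := by simp [hS]
  let e : (S ⊕ Fin r) ≃ Fin k := Fintype.equivFinOfCardEq hcard
  let c' : W → S ⊕ Fin r := fun w => if hw : w ∈ S then Sum.inl ⟨w, hw⟩ else Sum.inr (c w)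
  have hsurj : Function.Surjective c' := by
    rintro (⟨w, hw⟩ | i)
    · exact ⟨w, by simp [c', hw]⟩
    · obtain ⟨w, hw, rfl⟩ := hc i
      exact ⟨w, by simp [c', hw]⟩
  obtain ⟨T, hT, hinj⟩ := h.rainbow (e ∘ c') (e.surjective.comp hsurj)
  have hinj' : Set.InjOn c' T := fun x hx y hy hxy => hinj hx hy (by simp [hxy])
  refine ⟨T, hT, fun s hs => ?_, fun x hx y hy hxy => ?_⟩
  -- A rainbow `k`-set uses each of the `k` colours, in particular every private one, so it contains
  -- all of `S`.
  · have : T.image c' = Finset.univ := by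
      apply Finset.eq_univ_of_card
      rw [Finset.card_image_of_injOn hinj', h.card T hT, hcard]
    have hmem : (Sum.inl ⟨s, hs⟩ : S ⊕ Fin r) ∈ T.image c' := by simp [this]
    obtain ⟨t, ht, hts⟩ := Finset.mem_image.1 hmem
    by_cases htS : t ∈ S
    · simp only [c', htS, dif_pos, Sum.inl.injEq, Subtype.mk.injEq] at hts
      rwa [← hts]
    · simp [c', htS] at hts
  · simp only [Finset.coe_sdiff, Set.mem_sdiff, Finset.mem_coe] at hx hy
    exact hinj' hx.1 hy.1 (by simp [c', hx.2, hy.2, hxy])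

/-- Here all vertices outside `S` share the single remaining colour, so a rainbow member contains
just one of them. -/
theorem exists_insert [Fintype W] (h : RainbowFamily G k F) (S : Finset W) (hS : S.card + 1 = k)
    (hk : k ≤ Fintype.card W) : ∃ v, v ∉ S ∧ insert v S ∈ F := by
  obtain ⟨w, hw⟩ : ∃ w, w ∉ S := by
    by_contra! hall
    have : S = Finset.univ := Finset.eq_univ_iff_forall.2 hall
    rw [this, Finset.card_univ] at hS; omega
  obtain ⟨T, hT, hST, -⟩ := h.exists_superset S hS (fun _ => 0)
    (fun i => ⟨w, hw, (Subsingleton.elim _ _)⟩)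
  have h1 := h.card T hT
  have h2 : (T \ S).card = 1 := by rw [Finset.card_sdiff_of_subset hST]; omega
  obtain ⟨v, hv⟩ := Finset.card_eq_one.1 h2
  have hv' : v ∈ T \ S := by simp [hv]
  refine ⟨v, (Finset.mem_sdiff.1 hv').2, ?_⟩
  have : insert v S = T := by
    rw [← Finset.sdiff_union_of_subset hST, hv]; rfl
  rwa [this]

/-- The colour classes outside `S` are `A` and `B`. This freedom in splitting the rest is what gives
control over the degree of a vertex of `S` in the resulting member. -/
theorem exists_insert_insert (h : RainbowFamily G k F) (S A B : Finset W) (hS : S.card + 2 = k)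
    (hAB : Disjoint A B) (hcompl : ∀ x, x ∉ S ↔ x ∈ A ∨ x ∈ B) (hA : A.Nonempty)
    (hB : B.Nonempty) : ∃ a ∈ A, ∃ b ∈ B, insert a (insert b S) ∈ F := by
  obtain ⟨T, hT, hST, hinj⟩ := h.exists_superset S hS (fun w => if w ∈ A then 0 else 1)
    (fun i => by
      fin_cases i
      · obtain ⟨a, ha⟩ := hA
        exact ⟨a, (hcompl a).2 (.inl ha), by simp [ha]⟩
      · obtain ⟨b, hb⟩ := hB
        exact ⟨b, (hcompl b).2 (.inr hb), by simp [Finset.disjoint_right.1 hAB hb]⟩)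
  have h1 := h.card T hT
  have h2 : (T \ S).card = 2 := by rw [Finset.card_sdiff_of_subset hST]; omega
  obtain ⟨a, b, hab, hTS⟩ := Finset.card_eq_two.1 h2
  have ha : a ∈ T \ S := by simp [hTS]
  have hb : b ∈ T \ S := by simp [hTS]
  have hT' : insert a (insert b S) = T := by
    rw [← Finset.sdiff_union_of_subset hST, hTS]; ext; simp
  have hne : ¬ ((if a ∈ A then (0 : Fin 2) else 1) = if b ∈ A then 0 else 1) :=
    fun e => hab (hinj ha hb e)
  have ha' := (hcompl a).1 (Finset.mem_sdiff.1 ha).2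
  have hb' := (hcompl b).1 (Finset.mem_sdiff.1 hb).2
  by_cases haA : a ∈ A <;> by_cases hbA : b ∈ A <;> simp [haA, hbA] at hne
  · exact ⟨a, haA, b, hb'.resolve_left hbA, hT' ▸ hT⟩
  · refine ⟨b, hbA, a, ha'.resolve_left haA, ?_⟩
    rw [Finset.insert_comm, hT']; exact hT

variable [Fintype W]

theorem nonempty (h : RainbowFamily G k F) (hk : k ≤ Fintype.card W) (hk0 : 0 < k) :
    ∃ T, T ∈ F := by
  obtain ⟨S, -, hS⟩ := Finset.exists_subset_card_eq (s := (Finset.univ : Finset W)) (n := k - 1)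
    (by rw [Finset.card_univ]; omega)
  obtain ⟨v, -, hv⟩ := h.exists_insert S (by omega) hk
  exact ⟨_, hv⟩

/-- A `(k-1)`-set has as many edges as a member minus a vertex. -/
theorem exists_degSum (h : RainbowFamily G k F) (hk : k ≤ Fintype.card W) {T : Finset W}
    (hT : T ∈ F) {S : Finset W} (hS : S.card + 1 = k) :
    ∃ x ∈ T, degSum G S = degSum G T - 2 * degIn G T x := by
  obtain ⟨v, hv, hvS⟩ := h.exists_insert S hS hk
  obtain ⟨x, hx, hxd⟩ := h.exists_deg hvS hT (Finset.mem_insert_self v S)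
  refine ⟨x, hx, ?_⟩
  rw [hxd, h.degSum_eq hT hvS, degSum_insert hv, degIn_insert hv]; simp

/-- Apply `exists_degSum` to the `(k-1)`-set `T - p - s + y`, whose edge count is known explicitly;
the deficit must be a degree of `T`. -/
theorem exists_swap (h : RainbowFamily G k F) (hk : k ≤ Fintype.card W) {T : Finset W}
    (hT : T ∈ F) {p s y : W} (hp : p ∈ T) (hs : s ∈ T) (hps : p ≠ s) (hy : y ∉ T) :
    ∃ x ∈ T, degIn G T x = degIn G T p + degIn G T s - adjInd G p s -
      (degIn G T y - adjInd G y p - adjInd G y s) := by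
  have hs' : s ∈ T.erase p := Finset.mem_erase.2 ⟨hps.symm, hs⟩
  have hy' : y ∉ (T.erase p).erase s := by simp [hy]
  have hc := h.card T hT
  have h1 := Finset.card_erase_add_one hp
  have h2 := Finset.card_erase_add_one hs'
  obtain ⟨x, hx, he⟩ := h.exists_degSum hk hT (S := insert y ((T.erase p).erase s))
    (by rw [Finset.card_insert_of_notMem hy']; omega)
  refine ⟨x, hx, ?_⟩
  rw [degSum_insert hy', degSum_erase hs', degSum_erase hp, degIn_erase hs', degIn_erase hp,
    degIn_erase hp, adjInd_comm s p] at he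
  linarith

/-- Exchange inequality at a vertex of minimum degree. -/
theorem swap_le_of_min (h : RainbowFamily G k F) (hk : k ≤ Fintype.card W) {T : Finset W}
    (hT : T ∈ F) {p s y : W} (hp : p ∈ T) (hmin : ∀ x ∈ T, degIn G T p ≤ degIn G T x)
    (hs : s ∈ T) (hps : p ≠ s) (hy : y ∉ T) :
    degIn G T y - adjInd G y p - adjInd G y s ≤ degIn G T s - adjInd G p s := by
  obtain ⟨x, hx, he⟩ := h.exists_swap hk hT hp hs hps hy
  linarith [hmin x hx]

/-- Exchange inequality at a vertex of maximum degree. -/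
theorem le_swap_of_max (h : RainbowFamily G k F) (hk : k ≤ Fintype.card W) {T : Finset W}
    (hT : T ∈ F) {p s y : W} (hp : p ∈ T) (hmax : ∀ x ∈ T, degIn G T x ≤ degIn G T p)
    (hs : s ∈ T) (hps : p ≠ s) (hy : y ∉ T) :
    degIn G T s - adjInd G p s ≤ degIn G T y - adjInd G y p - adjInd G y s := by
  obtain ⟨x, hx, he⟩ := h.exists_swap hk hT hp hs hps hy
  linarith [hmax x hx]

/-- A vertex of degree `d` occurs in members with every conceivable degree `t`. -/
theorem exists_mem_degIn_eq (h : RainbowFamily G k F) {m : ℕ} (hn : Fintype.card W = k + m)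
    {v : W} {t d : ℕ} (hd : degIn G Finset.univ v = d) (ht : 1 ≤ t) (htd : t ≤ d)
    (hdm : d ≤ t + m) (htk : t + 2 ≤ k) : ∃ T ∈ F, v ∈ T ∧ degIn G T v = t := by
  set N := Finset.univ.filter (G.Adj v) with hN
  have hNd : N.card = d := by rw [degIn_eq_card] at hd; exact_mod_cast hd
  set N' := Finset.univ.filter fun w => w ≠ v ∧ ¬ G.Adj v w with hN'
  have hdisj : Disjoint N N' := by
    rw [Finset.disjoint_left]; intro w; simp [hN, hN']; tauto
  have hvN : v ∉ N := by simp [hN]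
  have hvN' : v ∉ N' := by simp [hN']
  have huniv : insert v (N ∪ N') = Finset.univ := by
    ext w; simp [hN, hN']; tauto
  have hcard : N'.card + d + 1 = k + m := by
    rw [← hn, ← Finset.card_univ, ← huniv, Finset.card_insert_of_notMem (by simp [hvN, hvN']),
      Finset.card_union_of_disjoint hdisj]; omega
  -- Exactly one vertex of `A` and one of `B` enter the member, so `v` loses `d - t` neighbours and
  -- `m + t - d` non-neighbours. The extra `1` in each size accounts for the vertex that returns.
  obtain ⟨A, hAN, hA⟩ := Finset.exists_subset_card_eq (s := N) (n := d - t + 1) (by omega)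
  obtain ⟨B, hBN, hB⟩ := Finset.exists_subset_card_eq (s := N') (n := m + t - d + 1) (by omega)
  have hAB : Disjoint A B := Finset.disjoint_of_subset_left hAN
    (Finset.disjoint_of_subset_right hBN hdisj)
  set S := Finset.univ \ (A ∪ B) with hSdef
  have hScard : S.card + 2 = k := by
    rw [hSdef, Finset.card_sdiff_of_subset (Finset.subset_univ _), Finset.card_univ, hn,
      Finset.card_union_of_disjoint hAB]; omega
  obtain ⟨a, ha, b, hb, hT⟩ := h.exists_insert_insert S A B hScard hAB
    (by intro x; simp [hSdef]; tauto) (Finset.card_pos.1 (by omega)) (Finset.card_pos.1 (by omega))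
  have hbS : b ∉ S := by simp [hSdef, hb]
  have haS : a ∉ insert b S := by
    have : a ≠ b := by rintro rfl; exact Finset.disjoint_left.1 hAB ha hb
    simp [hSdef, ha, this]
  have hvS : v ∈ S := by
    simp only [hSdef, Finset.mem_sdiff, Finset.mem_univ, Finset.mem_union, true_and]
    rintro (hv | hv)
    · exact hvN (hAN hv)
    · exact hvN' (hBN hv)
  refine ⟨_, hT, by simp [hvS], ?_⟩
  rw [degIn_insert haS, degIn_insert hbS, hSdef, degIn_sdiff (Finset.subset_univ _),
    degIn_union hAB, hd]
  have h1 : adjInd G v a = 1 := adjInd_eq_one.2 (by simpa [hN] using hAN ha)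
  have h2 : adjInd G v b = 0 := adjInd_eq_zero.2 (by have := hBN hb; simp [hN'] at this; exact this.2)
  have h3 : degIn G A v = A.card := degIn_eq_card_iff.2 fun w hw => by simpa [hN] using hAN hw
  have h4 : degIn G B v = 0 := degIn_eq_zero.2 fun w hw => by
    have := hBN hw; simp [hN'] at this; exact this.2
  rw [h1, h2, h3, h4, hA]; push_cast [Nat.cast_sub htd]; ring

/-- If no vertex of a member dominates all but at most one of the others, then the degrees in `G`
are bounded by those in the members. -/
theorem degIn_univ_le (h : RainbowFamily G k F) (hk : k ≤ Fintype.card W) {D : ℕ}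
    (hD : ∀ T ∈ F, ∀ x ∈ T, degIn G T x ≤ D) (hDk : D + 3 ≤ k) (v : W) :
    degIn G Finset.univ v ≤ D := by
  by_contra! hlt
  rw [degIn_eq_card] at hlt
  obtain ⟨N, hN, hNc⟩ := Finset.exists_subset_card_eq
    (s := Finset.univ.filter (G.Adj v)) (n := D + 1) (by exact_mod_cast hlt)
  have hvN : v ∉ N := fun hv => by simpa using hN hv
  -- `v` and `D + 1` of its neighbours fit into a `(k-1)`-set, and the member extending that set
  -- gives `v` a degree above `D`.
  obtain ⟨S, hNS, -, hS⟩ := Finset.exists_subsuperset_card_eq (s := insert v N) (n := k - 1)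
    (Finset.subset_univ _) (by rw [Finset.card_insert_of_notMem hvN]; omega)
    (by rw [Finset.card_univ]; omega)
  obtain ⟨w, hw, hT⟩ := h.exists_insert S (by omega) hk
  have hvS : v ∈ S := hNS (Finset.mem_insert_self _ _)
  have h1 := hD _ hT v (Finset.mem_insert_of_mem hvS)
  have h2 : degIn G N v ≤ degIn G (insert w S) v := degIn_mono
    ((Finset.subset_insert _ _).trans (hNS.trans (Finset.subset_insert _ _))) v
  have h3 : degIn G N v = N.card := degIn_eq_card_iff.2 fun w hw => by simpa using hN hw
  rw [h3, hNc] at h2; push_cast at h2; linarith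

end RainbowFamily

/-! ### Balanced families: regularity, and exactly two extra vertices -/

open scoped Classical in
/-- A rainbow family whose ambient graph has all its degrees between `a + m` and `b`, where `a` and
`b` are the extreme degrees in the members. -/
structure BalancedFamily {W : Type*} [Fintype W] (G : SimpleGraph W) (k m : ℕ)
    (F : Set (Finset W)) (a b : ℤ) : Prop extends RainbowFamily G k F where
  card_univ : Fintype.card W = k + m
  two_le : 2 ≤ m
  pos : 1 ≤ a
  add_two_le : b + 2 ≤ k
  bounds : ∀ T ∈ F, ∀ x ∈ T, a ≤ degIn G T x ∧ degIn G T x ≤ b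
  exists_min : ∀ T ∈ F, ∃ x ∈ T, degIn G T x = a
  exists_max : ∀ T ∈ F, ∃ x ∈ T, degIn G T x = b
  bounds_univ : ∀ v, a + m ≤ degIn G Finset.univ v ∧ degIn G Finset.univ v ≤ b

/-- A member with a unique vertex of minimum degree, whose complement contains an isolated vertex
of maximum degree and also a vertex of minimum degree. -/
structure IsolatingMember {W : Type*} [Fintype W] [DecidableEq W] (G : SimpleGraph W) (m : ℕ)
    (a b : ℤ) (T : Finset W) : Prop where
  unique_min : ∃ p ∈ T, degIn G T p = a ∧ ∀ q ∈ T, degIn G T q = a → q = p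
  exists_isolated : ∃ z, z ∉ T ∧ degIn G Tᶜ z = 0 ∧ degIn G Finset.univ z = b
  exists_low : ∃ z, z ∉ T ∧ degIn G Finset.univ z = a + m

section

open scoped Classical

variable {W : Type*} [Fintype W] {G : SimpleGraph W} {k m : ℕ} {F : Set (Finset W)} {a b : ℤ}

theorem degIn_add_degIn_compl (T : Finset W) (v : W) :
    degIn G T v + degIn G Tᶜ v = degIn G Finset.univ v := by
  rw [← degIn_union disjoint_compl_right, Finset.union_compl]

theorem card_compl_member (h : RainbowFamily G k F) (hn : Fintype.card W = k + m) {T : Finset W}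
    (hT : T ∈ F) : Tᶜ.card = m := by
  rw [Finset.card_compl, h.card T hT, hn]; omega

/-- Among any `m + 1` vertices some `m` form the complement of a member. -/
theorem RainbowFamily.exists_erase_compl (h : RainbowFamily G k F) (hn : Fintype.card W = k + m)
    (hk : 0 < k) {A : Finset W} (hA : A.card = m + 1) : ∃ x ∈ A, (A.erase x)ᶜ ∈ F := by
  obtain ⟨v, hv, hT⟩ := h.exists_insert Aᶜ (by rw [Finset.card_compl]; omega) (by omega)
  refine ⟨v, by simpa using hv, ?_⟩
  convert hT using 1
  ext; simp

namespace BalancedFamily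

/-- Complementation reverses the degree bounds, so each statement about minimum degrees has a dual
about maximum degrees. -/
theorem compl (h : BalancedFamily G k m F a b) :
    BalancedFamily Gᶜ k m F (k - 1 - b) (k - 1 - a) where
  toRainbowFamily := h.toRainbowFamily.compl
  card_univ := h.card_univ
  two_le := h.two_le
  pos := by linarith [h.add_two_le]
  add_two_le := by linarith [h.pos]
  bounds T hT x hx := by
    rw [degIn_compl_of_mem T hx, h.card T hT]
    have := h.bounds T hT x hx
    constructor <;> linarith
  exists_min T hT := by
    obtain ⟨x, hx, hd⟩ := h.exists_max T hT
    exact ⟨x, hx, by rw [degIn_compl_of_mem T hx, h.card T hT, hd]⟩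
  exists_max T hT := by
    obtain ⟨x, hx, hd⟩ := h.exists_min T hT
    exact ⟨x, hx, by rw [degIn_compl_of_mem T hx, h.card T hT, hd]⟩
  bounds_univ v := by
    rw [degIn_compl_of_mem _ (Finset.mem_univ v), Finset.card_univ, h.card_univ]
    have := h.bounds_univ v
    push_cast
    constructor <;> linarith

theorem pos_k (h : BalancedFamily G k m F a b) (v : W) : 0 < k := by
  have := h.bounds_univ v
  have := h.pos
  have := h.add_two_le
  omega

theorem mem_nonempty (h : BalancedFamily G k m F a b) : ∃ T, T ∈ F := by
  have h1 := h.card_univ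
  have h2 := h.two_le
  obtain ⟨v⟩ : Nonempty W := Fintype.card_pos_iff.1 (by omega)
  exact h.nonempty (by omega) (h.pos_k v)

theorem lt (h : BalancedFamily G k m F a b) : a + m ≤ b := by
  obtain ⟨T, hT⟩ := h.mem_nonempty
  obtain ⟨x, -, -⟩ := h.exists_min T hT
  linarith [h.bounds_univ x]

/-- The degree inside the member already exhausts the bound `b` on the degree in `G`. -/
theorem degIn_compl_of_max (h : BalancedFamily G k m F a b) {T : Finset W} {x : W}
    (hd : degIn G T x = b) : degIn G Tᶜ x = 0 ∧ degIn G Finset.univ x = b := by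
  have h1 := degIn_add_degIn_compl (G := G) T x
  have h2 := degIn_nonneg (G := G) Tᶜ x
  have h3 := h.bounds_univ x
  constructor <;> linarith

/-- Degree at least `a + m` in `G` and only `a` inside the member leave no choice but adjacency to
all `m` outer vertices. -/
theorem degIn_compl_of_min (h : BalancedFamily G k m F a b) {T : Finset W} (hT : T ∈ F) {x : W}
    (hd : degIn G T x = a) : degIn G Tᶜ x = m ∧ degIn G Finset.univ x = a + m := by
  have h1 := degIn_add_degIn_compl (G := G) T x
  have h2 := degIn_le_card (G := G) Tᶜ x
  rw [card_compl_member h.toRainbowFamily h.card_univ hT] at h2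
  have h3 := h.bounds_univ x
  constructor <;> linarith

/-- A vertex of minimum degree in a member has degree `a + m` in `G`, so `exists_mem_degIn_eq` finds
a member in which it has degree `a + 1`; isomorphism carries this to `T`. -/
theorem exists_succ_min (h : BalancedFamily G k m F a b) {T : Finset W} (hT : T ∈ F) :
    ∃ y ∈ T, degIn G T y = a + 1 := by
  obtain ⟨p, hp, hd⟩ := h.exists_min T hT
  have hpos := h.pos
  have hlt := h.lt
  have h2 := h.two_le
  have hb := h.add_two_le
  obtain ⟨T', hT', hpT', hd'⟩ := h.exists_mem_degIn_eq h.card_univ (v := p) (t := (a + 1).toNat)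
    (d := (a + m).toNat) (by rw [(h.degIn_compl_of_min hT hd).2]; omega) (by omega) (by omega)
    (by omega) (by omega)
  obtain ⟨y, hy, hyd⟩ := h.exists_deg hT' hT hpT'
  exact ⟨y, hy, by omega⟩

/-- Split the vertices outside `T - x - y` into `{x, y}` and the complement of `T`: the member
obtained keeps one of `x`, `y` and replaces the other by an outer vertex. -/
theorem exists_swap_or (h : BalancedFamily G k m F a b) {T : Finset W} (hT : T ∈ F) {x y : W}
    (hx : x ∈ T) (hy : y ∈ T) (hxy : x ≠ y) :
    (∃ z, z ∉ T ∧ insert z (T.erase x) ∈ F) ∨ ∃ z, z ∉ T ∧ insert z (T.erase y) ∈ F := by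
  have hy' : y ∈ T.erase x := Finset.mem_erase.2 ⟨hxy.symm, hy⟩
  have hc := h.card T hT
  have h1 := Finset.card_erase_add_one hx
  have h2 := Finset.card_erase_add_one hy'
  have hM := card_compl_member h.toRainbowFamily h.card_univ hT
  have hm := h.two_le
  obtain ⟨c, hcm, z, hz, hF⟩ := h.exists_insert_insert ((T.erase x).erase y) {x, y} Tᶜ (by omega)
    (by rw [Finset.disjoint_left]; simp; exact ⟨hx, hy⟩) (by intro w; simp; tauto) (by simp)
    (Finset.card_pos.1 (by omega))
  have hzT : z ∉ T := by simpa using hz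
  simp only [Finset.mem_insert, Finset.mem_singleton] at hcm
  rcases hcm with rfl | rfl
  · right
    refine ⟨z, hzT, ?_⟩
    convert hF using 1
    ext w; by_cases hw : w = c <;> simp [hw, hx, hxy]
  · left
    refine ⟨z, hzT, ?_⟩
    convert hF using 1
    ext w; by_cases hw : w = c <;> simp [hw, hy, hxy.symm]

theorem degIn_swap (h : BalancedFamily G k m F a b) {T : Finset W} (hT : T ∈ F) {y z : W}
    (hy : y ∈ T) (hz : z ∉ T) (hF : insert z (T.erase y) ∈ F) :
    degIn G T z - adjInd G z y = degIn G T y := by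
  have h1 := h.degSum_eq hT hF
  rw [degSum_insert (by simp [hz]), degSum_erase hy, degIn_erase hy] at h1
  linarith

theorem compl_swap {T : Finset W} {y z : W} (hy : y ∈ T) (hz : z ∉ T) :
    (insert z (T.erase y))ᶜ = insert y (Tᶜ.erase z) := by
  ext w; simp
  by_cases h1 : w = z
  · subst h1; simp; rintro rfl; exact hz hy
  · by_cases h2 : w = y
    · subst h2; simp [h1]
    · simp [h1, h2]

/-- The replacement `z` inherits degree `b` in the new member, hence has no neighbours outside it;
all old outer vertices other than `z` are still outside. -/
theorem swap_max (h : BalancedFamily G k m F a b) {T : Finset W} (hT : T ∈ F) {x z : W}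
    (hx : x ∈ T) (hd : degIn G T x = b) (hz : z ∉ T) (hF : insert z (T.erase x) ∈ F) :
    degIn G Tᶜ z = 0 ∧ degIn G Finset.univ z = b := by
  have h1 := h.degIn_swap hT hx hz hF
  have h2 := h.degIn_compl_of_max (T := insert z (T.erase x)) (x := z) (by
    rw [degIn_insert (by simp [hz]), degIn_erase hx]; simp; linarith)
  refine ⟨?_, h2.2⟩
  rw [compl_swap hx hz] at h2
  have h3 : degIn G (Tᶜ.erase z) z ≤ 0 :=
    h2.1 ▸ degIn_mono (Finset.subset_insert _ _) z
  rw [degIn_erase (by simpa using hz)] at h3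
  simp at h3
  exact le_antisymm h3 (degIn_nonneg _ _)

theorem swap_min (h : BalancedFamily G k m F a b) {T : Finset W} (hT : T ∈ F) {x z : W}
    (hx : x ∈ T) (hd : degIn G T x = a) (hz : z ∉ T) (hF : insert z (T.erase x) ∈ F) :
    degIn G Tᶜ z = m - 1 := by
  have h1 := h.compl.swap_max (m := m) hT hx
    (by rw [degIn_compl_of_mem T hx, hd, h.card T hT]) hz hF
  have h2 := h1.1
  rw [degIn_compl_of_mem _ (by simpa using hz),
    card_compl_member h.toRainbowFamily h.card_univ hT] at h2
  linarith

/-- If `p` cannot be exchanged, `exists_swap_or` lets every other vertex be exchanged. Exchanging a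
vertex of degree `b` yields an outer vertex `z₀` isolated among the outer ones, so the other outer
vertices have at most `m - 2` outer neighbours. A second vertex of degree `a` would be exchanged for
one with `m - 1`, by `swap_min`. Exchanging a vertex of degree `a + 1` yields the low outer vertex.
-/
theorem isolatingMember_of_no_swap (h : BalancedFamily G k m F a b) {T : Finset W} (hT : T ∈ F)
    {p : W} (hp : p ∈ T) (hd : degIn G T p = a)
    (hno : ∀ z, z ∉ T → insert z (T.erase p) ∉ F) : IsolatingMember G m a b T := by
  have hm := h.two_le
  have hlt := h.lt
  have hM := card_compl_member h.toRainbowFamily h.card_univ hT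
  have hsw : ∀ y ∈ T, y ≠ p → ∃ z, z ∉ T ∧ insert z (T.erase y) ∈ F := fun y hy hyp =>
    (h.exists_swap_or hT hy hp hyp).resolve_right fun ⟨z, hz, hF⟩ => hno z hz hF
  obtain ⟨x, hx, hxd⟩ := h.exists_max T hT
  obtain ⟨z₀, hz₀, hF₀⟩ := hsw x hx (by rintro rfl; omega)
  obtain ⟨hz₀M, hz₀d⟩ := h.swap_max hT hx hxd hz₀ hF₀
  have hle : ∀ z, z ∉ T → z ≠ z₀ → degIn G Tᶜ z ≤ m - 2 := fun z hz hne => by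
    have h1 : z ∈ Tᶜ.erase z₀ := by simp [hne, hz]
    have h2 := degIn_le_card_sub_one (G := G) h1
    have h3 := Finset.card_erase_add_one (s := Tᶜ) (a := z₀) (by simpa using hz₀)
    rw [degIn_erase (by simpa using hz₀), adjInd_eq_zero.2] at h2
    · have : ((Tᶜ.erase z₀).card : ℤ) = m - 1 := by omega
      linarith
    · intro hadj
      exact degIn_eq_zero.1 hz₀M z (by simpa using hz) hadj.symm
  refine ⟨⟨p, hp, hd, fun q hq hqd => ?_⟩, ⟨z₀, hz₀, hz₀M, hz₀d⟩, ?_⟩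
  · by_contra hqp
    obtain ⟨z, hz, hF⟩ := hsw q hq hqp
    have h1 := h.swap_min hT hq hqd hz hF
    by_cases hzz : z = z₀
    · rw [hzz, hz₀M] at h1; omega
    · have := hle z hz hzz; omega
  · obtain ⟨y, hy, hyd⟩ := h.exists_succ_min hT
    obtain ⟨z, hz, hF⟩ := hsw y hy (by rintro rfl; omega)
    have h1 := h.degIn_swap hT hy hz hF
    have h2 := degIn_add_degIn_compl (G := G) T z
    have h3 := (h.bounds_univ z).1
    have h4 := adjInd_le_one (G := G) z y
    refine ⟨z, hz, ?_⟩
    by_cases hzz : z = z₀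
    · subst hzz; omega
    · have := hle z hz hzz; omega

/-- If a vertex of minimum degree and one of maximum degree were both exchangeable, the complement
would contain both an isolated vertex and one adjacent to all the others, impossible for `m ≥ 2`. -/
theorem isolatingMember_or (h : BalancedFamily G k m F a b) {T : Finset W} (hT : T ∈ F) :
    IsolatingMember G m a b T ∨ IsolatingMember Gᶜ m (k - 1 - b) (k - 1 - a) T := by
  obtain ⟨p, hp, hpd⟩ := h.exists_min T hT
  obtain ⟨x, hx, hxd⟩ := h.exists_max T hT
  have hm := h.two_le
  by_cases h1 : ∀ z, z ∉ T → insert z (T.erase p) ∉ F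
  · exact .inl (h.isolatingMember_of_no_swap hT hp hpd h1)
  · right
    refine h.compl.isolatingMember_of_no_swap hT hx
      (by rw [degIn_compl_of_mem T hx, hxd, h.card T hT]) fun z₀ hz₀ hF₀ => ?_
    push Not at h1
    obtain ⟨z₁, hz₁, hF₁⟩ := h1
    have h2 := (h.swap_max hT hx hxd hz₀ hF₀).1
    have h3 := h.swap_min hT hp hpd hz₁ hF₁
    have hM := card_compl_member h.toRainbowFamily h.card_univ hT
    by_cases hzz : z₀ = z₁
    · subst hzz; omega
    · have h4 := degIn_le_card_sub_one (G := G) (T := Tᶜ.erase z₀) (x := z₁)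
        (by simp [Ne.symm hzz, hz₁])
      have h5 := Finset.card_erase_add_one (s := Tᶜ) (a := z₀) (by simpa using hz₀)
      rw [degIn_erase (by simpa using hz₀), adjInd_eq_zero.2] at h4
      · omega
      · intro hadj
        exact degIn_eq_zero.1 h2 z₁ (by simpa using hz₁) hadj.symm

theorem exists_high_and_low (h : BalancedFamily G k m F a b) {T : Finset W} (hT : T ∈ F) :
    (∃ z, z ∉ T ∧ degIn G Finset.univ z = b) ∧ ∃ z, z ∉ T ∧ degIn G Finset.univ z = a + m := by
  have hcu := h.card_univ
  rcases h.isolatingMember_or hT with h1 | h1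
  · obtain ⟨z, hz, -, hd⟩ := h1.exists_isolated
    exact ⟨⟨z, hz, hd⟩, h1.exists_low⟩
  · obtain ⟨z, hz, -, hd⟩ := h1.exists_isolated
    obtain ⟨z', hz', hd'⟩ := h1.exists_low
    rw [degIn_compl_of_mem _ (Finset.mem_univ _), Finset.card_univ] at hd hd'
    exact ⟨⟨z', hz', by omega⟩, ⟨z, hz, by omega⟩⟩

/-- Every complement of a member contains a vertex of degree `b` and one of degree `a + m`, while
any `m + 1` vertices contain such a complement. Hence at most `m` vertices have degree different
from `b`, and at most `m` have degree different from `a + m`. If `b ≠ a + m` these two sets cover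
`G`, so `k + m ≤ 2m`, contrary to `k > m`. -/
theorem regular (h : BalancedFamily G k m F a b) : b = a + m := by
  by_contra hne
  have hlt := h.lt
  have hpos := h.pos
  have hb := h.add_two_le
  have hcu := h.card_univ
  have key : ∀ c : ℤ, (∀ T ∈ F, ∃ z, z ∉ T ∧ degIn G Finset.univ z = c) →
      (Finset.univ.filter fun z => degIn G Finset.univ z ≠ c).card ≤ m := by
    intro c hc
    by_contra! hcard
    obtain ⟨A, hA, hAc⟩ := Finset.exists_subset_card_eq (Nat.succ_le_of_lt hcard)
    obtain ⟨x, hx, hF⟩ := h.exists_erase_compl hcu (by omega) hAc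
    obtain ⟨z, hz, hzd⟩ := hc _ hF
    have : z ∈ A := by simp at hz; exact hz.2
    simpa [hzd] using hA this
  have h1 := key b fun T hT => (h.exists_high_and_low hT).1
  have h2 := key (a + m) fun T hT => (h.exists_high_and_low hT).2
  have h3 : (Finset.univ : Finset W) ⊆ (Finset.univ.filter fun z => degIn G Finset.univ z ≠ b) ∪
      Finset.univ.filter fun z => degIn G Finset.univ z ≠ a + m := by
    intro z _; simp; by_contra! hcon; exact hne (hcon.1 ▸ hcon.2)
  have h4 := (Finset.card_le_card h3).trans (Finset.card_union_le _ _)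
  rw [Finset.card_univ] at h4
  omega

theorem degIn_univ_eq (h : BalancedFamily G k m F a b) (v : W) : degIn G Finset.univ v = b := by
  have h1 := h.regular
  have h2 := h.bounds_univ v
  omega

/-- In a regular graph the edge count of a set determines that of its complement. -/
theorem degSum_compl_eq (h : BalancedFamily G k m F a b) {T T' : Finset W} (hT : T ∈ F)
    (hT' : T' ∈ F) : degSum G Tᶜ = degSum G T'ᶜ := by
  have key : ∀ T ∈ F, degSum G Tᶜ = m * b - k * b + degSum G T := by
    intro T hT
    have hreg : ∀ S : Finset W, ∑ x ∈ S, degIn G Finset.univ x = S.card * b := fun S => by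
      rw [Finset.sum_congr rfl fun x _ => h.degIn_univ_eq x]; simp
    have e1 : ∑ x ∈ T, degIn G Tᶜ x = ∑ x ∈ Tᶜ, degIn G T x := by
      unfold degIn; rw [Finset.sum_comm]
      exact Finset.sum_congr rfl fun _ _ => Finset.sum_congr rfl fun _ _ => adjInd_comm _ _
    have e2 := hreg T
    have e3 := hreg Tᶜ
    simp only [← degIn_add_degIn_compl (G := G) T, Finset.sum_add_distrib] at e2 e3
    rw [h.card T hT] at e2
    rw [card_compl_member h.toRainbowFamily h.card_univ hT] at e3
    unfold degSum; linarith
  rw [key T hT, key T' hT', h.degSum_eq hT hT']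

/-- With `m ≥ 3` there is no member with an isolated vertex in its complement. -/
theorem not_isolatingMember (h : BalancedFamily G k m F a b) (hm : 3 ≤ m) {T : Finset W}
    (hT : T ∈ F) : ¬ IsolatingMember G m a b T := by
  intro hI
  have hM := card_compl_member h.toRainbowFamily h.card_univ hT
  obtain ⟨p, hp, hpd, -⟩ := hI.unique_min
  obtain ⟨z₀, hz₀, hz₀M, -⟩ := hI.exists_isolated
  obtain ⟨y, hy, hyd⟩ := h.exists_succ_min hT
  have hpy : p ≠ y := by rintro rfl; omega
  have hpM := (h.degIn_compl_of_min hT hpd).1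
  have hpadj : ∀ w, w ∉ T → G.Adj p w := fun w hw =>
    degIn_eq_card_iff.1 (by rw [hpM, hM]) w (by simpa using hw)
  have hyM : degIn G Tᶜ y = m - 1 := by
    have h1 := degIn_add_degIn_compl (G := G) T y
    have h2 := h.degIn_univ_eq y
    have h3 := h.regular
    omega
  set X := Tᶜ.filter (G.Adj y) with hX
  have hXc : X.card + 1 = m := by
    rw [degIn_eq_card, ← hX] at hyM; omega
  have hXT : X ⊆ Tᶜ := Finset.filter_subset _ _
  obtain ⟨w, hw⟩ := Finset.card_eq_one.1 (show (Tᶜ \ X).card = 1 by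
    rw [Finset.card_sdiff_of_subset hXT]; omega)
  have hwX : w ∉ X := by
    have : w ∈ Tᶜ \ X := by simp [hw]
    exact (Finset.mem_sdiff.1 this).2
  have hTX : Tᶜ = insert w X := by
    rw [← Finset.sdiff_union_of_subset hXT, hw]; rfl
  have hXT' : ∀ x ∈ X, x ∉ T := fun x hx => by simpa using hXT hx
  have hpX : p ∉ X := fun hx => hXT' p hx hp
  have hyX : y ∉ X := fun hx => hXT' y hx hy
  have hyadj : ∀ x ∈ X, G.Adj y x := fun x hx => (Finset.mem_filter.1 hx).2
  have hz₀X : ∀ x ∈ insert w X, ¬ G.Adj z₀ x := fun x hx =>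
    degIn_eq_zero.1 hz₀M x (hTX ▸ hx)
  have hz₀mem : z₀ ∈ insert w X := by rw [← hTX]; simpa using hz₀
  have hMsum : degSum G Tᶜ = degSum G X + 2 * degIn G X w := by rw [hTX, degSum_insert hwX]
  have hdw : degIn G X w ≤ m - 2 := by
    rcases Finset.mem_insert.1 hz₀mem with h1 | h1
    · subst h1
      rw [degIn_eq_zero.2 fun x hx => hz₀X x (Finset.mem_insert_of_mem hx)]; omega
    · have h2 := degIn_le_card (G := G) (X.erase z₀) w
      have h3 := Finset.card_erase_add_one h1
      rw [degIn_erase h1, adjInd_eq_zero.2 fun e => hz₀X w (by simp) e.symm] at h2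
      omega
  -- Some `m` of these `m + 1` vertices form the complement of a member, which must span as many
  -- edges as `X + w`. But `p` and `y` are joined to all of `X`, whereas `w` misses a vertex of `X`
  -- because of `z₀`; in each of the three cases the count is too large.
  have hA : (insert p (insert y X)).card = m + 1 := by
    rw [Finset.card_insert_of_notMem (by simp [hpy, hpX]), Finset.card_insert_of_notMem hyX]; omega
  obtain ⟨c, hc, hF⟩ := h.exists_erase_compl h.card_univ (h.pos_k p) hA
  have hsum := h.degSum_compl_eq hT hF
  rw [compl_compl, hMsum, degSum_erase hc, degSum_insert (by simp [hpy, hpX]), degSum_insert hyX,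
    degIn_insert hyX] at hsum
  have hpX' : degIn G X p = m - 1 := by
    rw [degIn_eq_card_iff.2 fun x hx => hpadj x (hXT' x hx)]; omega
  have hyX' : degIn G X y = m - 1 := by
    rw [degIn_eq_card_iff.2 hyadj]; omega
  have hpyle := adjInd_nonneg (G := G) p y
  simp only [Finset.mem_insert] at hc
  rcases hc with rfl | rfl | hcX
  · rw [degIn_insert (by simp [hpy, hpX]), degIn_insert hyX] at hsum
    simp at hsum; omega
  · rw [degIn_insert (by simp [hpy, hpX]), degIn_insert hyX, adjInd_comm c p] at hsum
    simp at hsum; omega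
  · rw [degIn_insert (by simp [hpy, hpX]), degIn_insert hyX,
      adjInd_eq_one.2 (hyadj c hcX).symm, adjInd_eq_one.2 (hpadj c (hXT' c hcX)).symm] at hsum
    have hcd : degIn G X c ≤ m - 2 := by
      have := degIn_le_card_sub_one (G := G) hcX; omega
    rcases Finset.mem_insert.1 hz₀mem with h1 | h1
    · have : degIn G X w = 0 :=
        degIn_eq_zero.2 fun x hx => h1 ▸ hz₀X x (Finset.mem_insert_of_mem hx)
      omega
    · by_cases hcz : c = z₀
      · have : degIn G X c = 0 :=
          degIn_eq_zero.2 fun x hx => hcz ▸ hz₀X x (Finset.mem_insert_of_mem hx)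
        omega
      · have h2 := degIn_le_card_sub_one (G := G) (T := X.erase z₀) (x := c) (by simp [hcz, hcX])
        have h3 := Finset.card_erase_add_one h1
        rw [degIn_erase h1, adjInd_eq_zero.2 fun e =>
          hz₀X c (Finset.mem_insert_of_mem hcX) e.symm] at h2
        omega

theorem eq_two (h : BalancedFamily G k m F a b) : m = 2 := by
  by_contra hm
  have h2 := h.two_le
  obtain ⟨T, hT⟩ := h.mem_nonempty
  rcases h.isolatingMember_or hT with h1 | h1
  · exact h.not_isolatingMember (by omega) hT h1
  · exact h.compl.not_isolatingMember (by omega) hT h1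

end BalancedFamily

end

/-! ### Moore graphs of diameter two -/

section

open scoped Classical

/-- A Moore graph of diameter two and even degree has degree at most `2`. -/
theorem SimpleGraph.IsSRGWith.degree_lt_of_even {W : Type*} [Fintype W] {G : SimpleGraph W}
    {d : ℕ} (h : G.IsSRGWith (d * d + 1) d 0 1) (hd : Even d) : d < 4 := by
  by_contra! h4
  set A : Matrix W W ℝ := G.adjMatrix ℝ with hA
  set J : Matrix W W ℝ := Matrix.of fun _ _ => 1 with hJ
  have hn : (Fintype.card W : ℝ) = d * d + 1 := by exact_mod_cast congrArg (Nat.cast (R := ℝ)) h.card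
  have hcompl : Gᶜ.adjMatrix ℝ = J - 1 - A := by
    ext v w
    by_cases hvw : v = w
    · subst hvw; simp [hJ, hA]
    · by_cases hadj : G.Adj v w <;> simp [hJ, hA, hvw, hadj]
  have hA2 : A * A = ((d : ℝ) - 1) • (1 : Matrix W W ℝ) + J - A := by
    have := h.matrix_eq (α := ℝ)
    rw [hcompl, ← hA, sq] at this
    rw [this, ← Nat.cast_smul_eq_nsmul ℝ]
    module
  have hAJ : A * J = (d : ℝ) • J := by
    ext v w; simp [hA, hJ, SimpleGraph.adjMatrix_mul_apply, h.regular.degree_eq v]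
  have hJA : J * A = (d : ℝ) • J := by
    ext v w; simp [hA, hJ, SimpleGraph.mul_adjMatrix_apply, h.regular.degree_eq w]
  have hJJ : J * J = ((d : ℝ) * d + 1) • J := by
    ext v w; simp [hJ, Matrix.mul_apply, hn]
  have hd4 : (4 : ℝ) ≤ d := by exact_mod_cast h4
  have hpos : (0 : ℝ) < 4 * d - 3 := by linarith
  -- On the complement of the constants the eigenvalues of `A` are `(-1 ± 1/r)/2`, the roots of `θ²
  -- + θ = d - 1`.
  obtain ⟨r, hr⟩ : ∃ r : ℝ, r ^ 2 * (4 * d - 3) = 1 :=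
    ⟨(Real.sqrt (4 * d - 3))⁻¹, by rw [inv_pow, Real.sq_sqrt hpos.le, inv_mul_cancel₀ hpos.ne']⟩
  -- `g` is chosen so that `Q` below kills the constant vector; thus `Q` is the projection onto the
  -- eigenspace of the larger root, and its trace is a natural number.
  obtain ⟨g, hg⟩ : ∃ g : ℝ, 2 * ((d : ℝ) * d + 1) * g = -(1 + (2 * d + 1) * r) :=
    ⟨-(1 + (2 * d + 1) * r) / (2 * ((d : ℝ) * d + 1)), by field_simp⟩
  set Q : Matrix W W ℝ := ((1 + r) / 2) • (1 : Matrix W W ℝ) + r • A + g • J with hQ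
  have hQQ : Q * Q = Q := by
    have e : Q * Q = (((1 + r) / 2) ^ 2 + r ^ 2 * (d - 1)) • (1 : Matrix W W ℝ) +
        ((1 + r) * r - r ^ 2) • A +
        (r ^ 2 + (1 + r) * g + 2 * r * g * d + g ^ 2 * ((d : ℝ) * d + 1)) • J := by
      simp only [hQ, add_mul, mul_add, smul_mul_smul_comm, one_mul, mul_one, hA2, hAJ, hJA, hJJ]
      module
    rw [e, hQ]
    congr 2
    · congr 1; linear_combination hr / 4
    · congr 1; ring
    · have h5 : (2 * ((d : ℝ) * d + 1)) * (r ^ 2 + (1 + r) * g + 2 * r * g * d +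
          g ^ 2 * ((d : ℝ) * d + 1) - g) = 0 := by
        linear_combination (-(1/2 : ℝ)) * hr + (1 + r + 2 * r * d + g * (d * d + 1) - 1 - (1 + (2 * d + 1) * r)/2) * hg
      have h6 := (mul_eq_zero.1 h5).resolve_left (by positivity)
      linarith
  have hid : IsIdempotentElem (Matrix.toLin' Q) := by
    unfold IsIdempotentElem
    rw [Module.End.mul_eq_comp, ← Matrix.toLin'_mul, hQQ]
  obtain ⟨N, hN⟩ : ∃ N : ℕ, Q.trace = N :=
    ⟨_, by rw [← Matrix.trace_toLin'_eq]; exact (LinearMap.IsIdempotentElem.isProj_range _ hid).trace⟩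
  have htr : Q.trace = (1 + r) / 2 * ((d : ℝ) * d + 1) + g * ((d : ℝ) * d + 1) := by
    rw [hQ, Matrix.trace_add, Matrix.trace_add, Matrix.trace_smul, Matrix.trace_smul,
      Matrix.trace_smul, Matrix.trace_one, hA, SimpleGraph.trace_adjMatrix, hn]
    simp [hJ, Matrix.trace, hn]
  have hz : r * ((d : ℝ) * d - 2 * d) = 2 * N - d * d := by
    rw [← hN, htr]; linear_combination -hg
  have hsq : ((d : ℝ) * d - 2 * d) ^ 2 = (2 * N - d * d) ^ 2 * (4 * d - 3) := by
    rw [← hz]; linear_combination -((d : ℝ) * d - 2 * d) ^ 2 * hr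
  have hsqZ : ((d : ℤ) * d - 2 * d) ^ 2 = (2 * N - d * d) ^ 2 * (4 * d - 3) := by
    exact_mod_cast hsq
  -- Integrality of the trace makes `4d - 3` a perfect square; for even `d` it is `5` modulo `8`,
  -- which is not a square.
  obtain ⟨q, hq⟩ := (Int.pow_dvd_pow_iff two_ne_zero).1 (Dvd.intro _ hsqZ.symm)
  have hne : (2 * N - d * d : ℤ) ≠ 0 := by
    intro h0
    rw [h0, zero_mul] at hq
    have : (d : ℤ) * (d - 2) = 0 := by linarith
    rcases mul_eq_zero.1 this with h | h <;> omega
  rw [hq, mul_pow] at hsqZ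
  have hq2 := mul_left_cancel₀ (pow_ne_zero 2 hne) hsqZ
  obtain ⟨e, rfl⟩ := hd
  have h8 : (q : ZMod 8) ^ 2 = 5 := by
    have h9 := congrArg (Int.cast (R := ZMod 8)) hq2
    push_cast at h9
    rw [h9]
    have : (8 : ZMod 8) = 0 := by decide
    linear_combination (e - 1 : ZMod 8) * this
  revert h8
  generalize (q : ZMod 8) = x
  revert x
  decide

end

/-! ### Balanced families have even order -/

section

open scoped Classical

namespace BalancedFamily

variable {W : Type*} [Fintype W] {G : SimpleGraph W} {k m : ℕ} {F : Set (Finset W)} {a b : ℤ}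

/-- Call a pair good if its complement is a member. Good pairs are nonadjacent and have a common
neighbour, every three vertices contain a good pair, and so does every `K₂,₂` of cross pairs between
two disjoint pairs. Hence `G` has no triangle and no 4-cycle, and nonadjacent vertices have exactly
one common neighbour. So `G` is strongly regular with `d² + 1 = k + 2` vertices; `k` odd makes `d`
even, hence below `4`, and this contradicts `b + 2 ≤ k`. -/
theorem false_of_forall_isolatingMember (h : BalancedFamily G k m F a b) (hk : Odd k) (hm : m = 2)
    (hI : ∀ T ∈ F, IsolatingMember G m a b T) : False := by
  subst hm
  have hreg := h.regular
  have hpos := h.pos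
  have hcu := h.card_univ
  push_cast at hreg
  -- pairs complementary to a member
  have hgood : ∀ x y, x ≠ y → ({x, y} : Finset W)ᶜ ∈ F →
      ¬ G.Adj x y ∧ ∃ c, G.Adj x c ∧ G.Adj y c := by
    intro x y hxy hF
    have hI' := hI _ hF
    obtain ⟨z, hz, hz0, -⟩ := hI'.exists_isolated
    obtain ⟨p, -, hpd, -⟩ := hI'.unique_min
    have h1 := (h.degIn_compl_of_min hF hpd).1
    rw [compl_compl] at hz0 h1
    have h2 := degIn_eq_card_iff.1 (h1.trans (by rw [Finset.card_pair hxy]))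
    refine ⟨?_, p, (h2 x (by simp)).symm, (h2 y (by simp)).symm⟩
    rw [degIn_eq_zero] at hz0
    simp only [Finset.mem_compl, Finset.mem_insert, Finset.mem_singleton, not_not] at hz
    rcases hz with rfl | rfl
    · exact hz0 y (by simp)
    · exact fun e => hz0 x (by simp) e.symm
  have hbad : ∀ x y, G.Adj x y → ({x, y} : Finset W)ᶜ ∉ F := fun x y hxy hF =>
    (hgood x y hxy.ne hF).1 hxy
  have htriple : ∀ x y z, x ≠ y → x ≠ z → y ≠ z → ({x, y} : Finset W)ᶜ ∉ F →
      ({x, z} : Finset W)ᶜ ∉ F → ({y, z} : Finset W)ᶜ ∈ F := by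
    intro x y z hxy hxz hyz h1 h2
    obtain ⟨c, hc, hF⟩ := h.exists_erase_compl hcu (h.pos_k x) (A := {x, y, z})
      (by rw [Finset.card_eq_three]; exact ⟨x, y, z, hxy, hxz, hyz, rfl⟩)
    simp only [Finset.mem_insert, Finset.mem_singleton] at hc
    rcases hc with rfl | rfl | rfl
    · convert hF using 2; ext w; simp; rintro (rfl | rfl) <;> simp [hxy.symm, hxz.symm]
    · refine absurd ?_ h2
      convert hF using 2; ext w; simp; constructor
      · rintro (rfl | rfl) <;> simp [hxy, hyz.symm]
      · tauto
    · refine absurd ?_ h1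
      convert hF using 2; ext w; simp; constructor
      · rintro (rfl | rfl) <;> simp [hxz, hyz]
      · tauto
  have hquad : ∀ x x' y y', x ≠ x' → y ≠ y' → x ≠ y → x ≠ y' → x' ≠ y → x' ≠ y' →
      ({x, y} : Finset W)ᶜ ∉ F → ({x, y'} : Finset W)ᶜ ∉ F → ({x', y} : Finset W)ᶜ ∉ F →
      ({x', y'} : Finset W)ᶜ ∈ F := by
    intro x x' y y' hx hy h1 h2 h3 h4 b1 b2 b3
    have hcard : ({x, x', y, y'} : Finset W).card = 4 :=
      Finset.card_eq_succ.2 ⟨x, {x', y, y'}, by simp [hx, h1, h2], rfl,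
        Finset.card_eq_three.2 ⟨x', y, y', h3, h4, hy, rfl⟩⟩
    have hle := Finset.card_le_univ ({x, x', y, y'} : Finset W)
    obtain ⟨c, hc, d, hd, hF⟩ := h.exists_insert_insert ({x, x', y, y'} : Finset W)ᶜ {x, x'} {y, y'}
      (by rw [Finset.card_compl]; omega)
      (by rw [Finset.disjoint_left]; simp; exact ⟨⟨h1, h2⟩, h3, h4⟩) (by intro w; simp; tauto)
      (by simp) (by simp)
    have key : ∀ {c c' d d' : W}, c ≠ c' → d ≠ d' → c ≠ d → c ≠ d' → c' ≠ d → c' ≠ d' →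
        insert c (insert d ({c, c', d, d'} : Finset W)ᶜ) = ({c', d'} : Finset W)ᶜ := by
      intro c c' d d' h1 h2 h3 h4 h5 h6
      ext w
      simp only [Finset.mem_insert, Finset.mem_compl, Finset.mem_singleton]
      by_cases e1 : w = c
      · subst e1; simp [h1, h4]
      · by_cases e2 : w = d
        · subst e2; simp [h2, h5.symm]
        · simp [e1, e2]
    simp only [Finset.mem_insert, Finset.mem_singleton] at hc hd
    have s1 : ({x, x', y, y'} : Finset W) = {x', x, y, y'} := Finset.insert_comm _ _ _
    rcases hc with rfl | rfl <;> rcases hd with rfl | rfl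
    · rwa [key hx hy h1 h2 h3 h4] at hF
    · rw [Finset.pair_comm y d, key hx hy.symm h2 h1 h4 h3] at hF; exact absurd hF b3
    · rw [s1, key hx.symm hy h3 h4 h1 h2] at hF; exact absurd hF b2
    · rw [s1, Finset.pair_comm y d, key hx.symm hy.symm h4 h3 h2 h1] at hF; exact absurd hF b1
  -- Two common neighbours would make all four cross pairs edges, hence none of them good.
  have hcommon : ∀ v w, v ≠ w → (G.commonNeighbors v w).Subsingleton := by
    intro v w hvw c hc c' hc'
    by_contra hcc
    rw [SimpleGraph.mem_commonNeighbors] at hc hc'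
    exact hbad w c' hc'.2 (hquad v w c c' hvw hcc hc.1.ne hc'.1.ne hc.2.ne hc'.2.ne
      (hbad _ _ hc.1) (hbad _ _ hc'.1) (hbad _ _ hc.2))
  have hsrg : ∃ d : ℕ, (d : ℤ) = b ∧ G.IsSRGWith (k + 2) d 0 1 := by
    refine ⟨b.toNat, by omega, hcu, fun v => ?_, fun v w hvw => ?_, fun v w hvw hnadj => ?_⟩
    · have := h.degIn_univ_eq v
      rw [degIn_eq_card] at this
      have h1 : (G.degree v : ℤ) = b := by
        rw [← this, ← SimpleGraph.card_neighborFinset_eq_degree,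
          SimpleGraph.neighborFinset_eq_filter]
      omega
    · rw [Fintype.card_eq_zero_iff, Set.isEmpty_coe_sort, Set.eq_empty_iff_forall_notMem]
      intro c hc
      rw [SimpleGraph.mem_commonNeighbors] at hc
      exact hbad w c hc.2 (htriple v w c hvw.ne hc.1.ne hc.2.ne (hbad _ _ hvw) (hbad _ _ hc.1))
    · suffices hne : ∃ c, c ∈ G.commonNeighbors v w by
        obtain ⟨c, hc⟩ := hne
        rw [Fintype.card_eq_one_iff]
        exact ⟨⟨c, hc⟩, fun y => Subtype.ext (hcommon v w hvw y.2 hc)⟩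
      by_contra! hno
      have hvwF : ({v, w} : Finset W)ᶜ ∉ F := fun hF => by
        obtain ⟨-, c, hc⟩ := hgood v w hvw hF
        exact hno c hc
      -- Suppose `v`, `w` are nonadjacent without a common neighbour, so not a good pair. If `v`,
      -- `w₁` is good, with common neighbour `c`, then `hquad` fails on `{v, w₁}` against `{w, c}`;
      -- otherwise `htriple` makes the edge `w w₁` good.
      obtain ⟨w₁, -, hw₁⟩ := degIn_pos.1 (show 0 < degIn G Finset.univ w by
        rw [h.degIn_univ_eq]; omega)
      have hvw₁ : v ≠ w₁ := by rintro rfl; exact hnadj hw₁.symm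
      by_cases hF : ({v, w₁} : Finset W)ᶜ ∈ F
      · obtain ⟨-, c, hvc, hwc⟩ := hgood v w₁ hvw₁ hF
        have hcw : w ≠ c := by rintro rfl; exact hnadj hvc
        exact hbad w₁ c hwc (hquad v w₁ w c hvw₁ hcw hvw hvc.ne hw₁.ne' hwc.ne hvwF
          (hbad _ _ hvc) (hbad _ _ hw₁.symm))
      · exact hbad w w₁ hw₁ (htriple v w w₁ hvw hvw₁ hw₁.ne hvwF hF)
  obtain ⟨d, hdb, hsrg⟩ := hsrg
  have hpar := hsrg.param_eq G (by omega)
  have hbk := h.add_two_le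
  have hkd : k + 2 = d * d + 1 := by
    obtain ⟨e, rfl⟩ : ∃ e, d = e + 1 := ⟨d - 1, by omega⟩
    simp at hpar
    have h1 : 0 < (e + 1) * e := Nat.mul_pos (by omega) (by omega)
    have h2 : (e + 1) * e + e = k := by omega
    nlinarith
  have hdeven : Even d := by
    by_contra hodd
    rw [Nat.not_even_iff_odd] at hodd
    have := hodd.mul hodd
    have := this.add_one
    rw [← hkd] at this
    have := hk.add_even even_two
    exact (Nat.not_even_iff_odd.2 this) ‹_›
  have := hsrg
  rw [hkd] at this
  have := this.degree_lt_of_even hdeven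
  obtain ⟨e, rfl⟩ := hdeven
  omega

/-- For `m = 2` the complement of a member is a nonedge in one type of isolating member and an edge
in the other. By `degSum_compl_eq` only one type occurs in a given family, and the previous lemma
applies to `G` or to its complement. -/
theorem even (h : BalancedFamily G k m F a b) : Even k := by
  by_contra hk
  rw [Nat.not_even_iff_odd] at hk
  have hm := h.eq_two
  obtain ⟨T₀, hT₀⟩ := h.mem_nonempty
  have hexcl : ∀ T ∈ F, ∀ T' ∈ F, IsolatingMember G m a b T →
      ¬ IsolatingMember Gᶜ m (k - 1 - b) (k - 1 - a) T' := by
    intro T hT T' hT' h1 h2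
    have hM := card_compl_member h.toRainbowFamily h.card_univ hT
    have hM' := card_compl_member h.toRainbowFamily h.card_univ hT'
    have he := h.degSum_compl_eq hT hT'
    obtain ⟨z, hz, hz0, -⟩ := h1.exists_isolated
    obtain ⟨z', hz', hz0', -⟩ := h2.exists_isolated
    rw [degIn_compl_of_mem _ (by simpa using hz'), hM'] at hz0'
    have key : ∀ {z : W} {S : Finset W}, z ∈ S → S.card = 2 → degSum G S = 2 * degIn G S z := by
      intro z S hzS hS
      have h3 := degSum_erase (G := G) hzS
      obtain ⟨x, hx⟩ := Finset.card_eq_one.1 (show (S.erase z).card = 1 by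
        rw [Finset.card_erase_of_mem hzS]; omega)
      rw [hx] at h3
      simp [degSum, degIn] at h3 ⊢
      linarith
    rw [key (z := z) (by simpa using hz) (by omega), key (z := z') (by simpa using hz') (by omega)]
      at he
    omega
  rcases h.isolatingMember_or hT₀ with h1 | h1
  · exact h.false_of_forall_isolatingMember hk hm fun T hT =>
      (h.isolatingMember_or hT).resolve_right (hexcl _ hT₀ _ hT h1)
  · exact h.compl.false_of_forall_isolatingMember hk hm fun T hT =>
      (h.isolatingMember_or hT).resolve_left fun h2 => hexcl _ hT _ hT₀ h2 h1

end BalancedFamily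

end

/-! ### Families of non-exceptional sets -/

/-- `G` restricted to `T` is complete, a star or a path on three vertices plus an isolated one. -/
def ExceptionalOn {W : Type*} [DecidableEq W] (G : SimpleGraph W) (T : Finset W) : Prop :=
  (∀ x ∈ T, ∀ y ∈ T, x ≠ y → G.Adj x y) ∨
  (∃ r ∈ T, ∀ x ∈ T, ∀ y ∈ T, G.Adj x y ↔ x ≠ y ∧ (x = r ∨ y = r)) ∨
  ∃ a b c d, T = {a, b, c, d} ∧ a ≠ b ∧ a ≠ c ∧ a ≠ d ∧ b ≠ c ∧ b ≠ d ∧ c ≠ d ∧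
    G.Adj a b ∧ G.Adj b c ∧ ¬ G.Adj a c ∧ ¬ G.Adj a d ∧ ¬ G.Adj b d ∧ ¬ G.Adj c d

open scoped Classical in
/-- A rainbow family of non-exceptional sets in a graph with at least two extra vertices. -/
structure ProperFamily {W : Type*} [Fintype W] (G : SimpleGraph W) (k m : ℕ)
    (F : Set (Finset W)) : Prop extends RainbowFamily G k F where
  card_univ : Fintype.card W = k + m
  two_le : 2 ≤ m
  four_le : 4 ≤ k
  not_exceptional : ∀ T ∈ F, ¬ ExceptionalOn G T
  not_exceptional_compl : ∀ T ∈ F, ¬ ExceptionalOn Gᶜ T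

section

open scoped Classical

variable {W : Type*} [Fintype W] {G : SimpleGraph W} {k m : ℕ} {F : Set (Finset W)}

namespace ProperFamily

theorem compl (h : ProperFamily G k m F) : ProperFamily Gᶜ k m F where
  toRainbowFamily := h.toRainbowFamily.compl
  card_univ := h.card_univ
  two_le := h.two_le
  four_le := h.four_le
  not_exceptional := h.not_exceptional_compl
  not_exceptional_compl := by rw [compl_compl]; exact h.not_exceptional

theorem le_card (h : ProperFamily G k m F) : k ≤ Fintype.card W := by
  rw [h.card_univ]; omega

theorem mem_nonempty (h : ProperFamily G k m F) : ∃ T, T ∈ F :=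
  h.nonempty h.le_card (by have := h.four_le; omega)

theorem not_star (h : ProperFamily G k m F) {T : Finset W} (hT : T ∈ F) {r : W} (hr : r ∈ T)
    (hadj : ∀ x ∈ T, x ≠ r → G.Adj r x)
    (hnadj : ∀ x ∈ T, ∀ y ∈ T, x ≠ r → y ≠ r → ¬ G.Adj x y) : False := by
  refine h.not_exceptional T hT (.inr (.inl ⟨r, hr, fun x hx y hy => ⟨fun e => ⟨e.ne, ?_⟩, ?_⟩⟩))
  · by_contra! hc
    exact hnadj x hx y hy hc.1 hc.2 e
  · rintro ⟨hxy, rfl | rfl⟩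
    · exact hadj y hy hxy.symm
    · exact (hadj x hx hxy).symm

theorem exists_adj (h : ProperFamily G k m F) {T : Finset W} (hT : T ∈ F) :
    ∃ x ∈ T, ∃ y ∈ T, G.Adj x y := by
  by_contra! hc
  exact h.not_exceptional_compl T hT (.inl fun x hx y hy hxy => by simp [hxy, hc x hx y hy])

end ProperFamily

/-! ### A vertex with many non-neighbours leads to a contradiction -/

/-- A vertex `u` with no neighbours in a `(k-1)`-set `B`, and a member `B ∪ {v}`, for a family whose
members have no isolated and no dominating vertices. -/
structure DetachedVertex (G : SimpleGraph W) (k m : ℕ) (F : Set (Finset W)) (B : Finset W)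
    (u v : W) : Prop extends ProperFamily G k m F where
  bounds : ∀ T ∈ F, ∀ x ∈ T, 1 ≤ degIn G T x ∧ degIn G T x ≤ k - 2
  card_base : B.card + 1 = k
  notMem : u ∉ B
  not_adj : ∀ s ∈ B, ¬ G.Adj u s
  notMem_ext : v ∉ B
  mem_ext : insert v B ∈ F

/-- The neighbour `a` of `u` completes `B - y + u` to a member. -/
structure IsSupport (G : SimpleGraph W) (F : Set (Finset W)) (B : Finset W) (u y a : W) :
    Prop where
  notMem : a ∉ B
  adj : G.Adj u a
  mem : insert a (insert u (B.erase y)) ∈ F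

namespace DetachedVertex

variable {B : Finset W} {u v y a s : W}

/-- Extend `B - y + u` to a member: `u` has no neighbour in `B` and cannot be isolated, so the new
vertex is adjacent to it. Thus `u` is a leaf there. -/
theorem exists_support (h : DetachedVertex G k m F B u v) (hy : y ∈ B) :
    ∃ a, IsSupport G F B u y a := by
  have hu : u ∉ B.erase y := fun e => h.notMem (Finset.mem_of_mem_erase e)
  obtain ⟨a, ha, hF⟩ := h.exists_insert (insert u (B.erase y)) (by
    rw [Finset.card_insert_of_notMem hu, Finset.card_erase_add_one hy]; exact h.card_base) h.le_card
  have h1 := (h.bounds _ hF u (by simp)).1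
  have hadj : G.Adj u a := by
    rw [degIn_insert ha, degIn_insert hu, degIn_erase hy, adjInd_self,
      adjInd_eq_zero.2 (h.not_adj y hy), degIn_eq_zero.2 h.not_adj] at h1
    by_contra hc
    rw [adjInd_eq_zero.2 hc] at h1; omega
  exact ⟨a, fun haB => h.not_adj a haB hadj, hadj, hF⟩

theorem degIn_base (h : DetachedVertex G k m F B u v) : degIn G B u = 0 :=
  degIn_eq_zero.2 h.not_adj

theorem degIn_ext (h : DetachedVertex G k m F B u v) (x : W) :
    degIn G (insert v B) x = adjInd G x v + degIn G B x := degIn_insert h.notMem_ext x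

theorem degIn_ext_self (h : DetachedVertex G k m F B u v) :
    degIn G (insert v B) v = degIn G B v := by rw [h.degIn_ext]; simp

theorem one_le (h : DetachedVertex G k m F B u v) : 1 ≤ degIn G B v := by
  have := (h.bounds _ h.mem_ext v (by simp)).1
  rwa [h.degIn_ext_self] at this

theorem degIn_member (h : DetachedVertex G k m F B u v) (hy : y ∈ B)
    (ha : IsSupport G F B u y a) (x : W) :
    degIn G (insert a (insert u (B.erase y))) x =
      adjInd G x a + (adjInd G x u + (degIn G B x - adjInd G x y)) := by
  have h1 : u ∉ B.erase y := fun e => h.notMem (Finset.mem_of_mem_erase e)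
  rw [degIn_insert, degIn_insert h1, degIn_erase hy]
  simp only [Finset.mem_insert, Finset.mem_erase, not_or]
  exact ⟨ha.adj.ne', fun e => ha.notMem e.2⟩

theorem degIn_member_leaf (h : DetachedVertex G k m F B u v) (hy : y ∈ B)
    (ha : IsSupport G F B u y a) : degIn G (insert a (insert u (B.erase y))) u = 1 := by
  rw [h.degIn_member hy ha, adjInd_eq_one.2 ha.adj, h.degIn_base, adjInd_self,
    adjInd_eq_zero.2 (h.not_adj y hy)]; rfl

theorem degIn_member_base (h : DetachedVertex G k m F B u v) (hy : y ∈ B)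
    (ha : IsSupport G F B u y a) (hs : s ∈ B) :
    degIn G (insert a (insert u (B.erase y))) s =
      adjInd G s a + degIn G B s - adjInd G s y := by
  rw [h.degIn_member hy ha, adjInd_eq_zero.2 fun e => h.not_adj s hs e.symm]; ring

/-- The number of neighbours of the support in the base is determined by the edge count. -/
theorem degIn_support (h : DetachedVertex G k m F B u v) (hy : y ∈ B)
    (ha : IsSupport G F B u y a) :
    degIn G B a - adjInd G a y = degIn G B v - 1 + degIn G B y := by
  have h1 : u ∉ B.erase y := fun e => h.notMem (Finset.mem_of_mem_erase e)
  have h2 : a ∉ insert u (B.erase y) := by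
    simp only [Finset.mem_insert, Finset.mem_erase, not_or]
    exact ⟨ha.adj.ne', fun e => ha.notMem e.2⟩
  have h3 := h.degSum_eq ha.mem h.mem_ext
  rw [degSum_insert h2, degSum_insert h1, degSum_erase hy, degSum_insert h.notMem_ext,
    degIn_insert h1, degIn_erase hy, degIn_erase hy, h.degIn_base,
    adjInd_eq_zero.2 (h.not_adj y hy), adjInd_eq_one.2 ha.adj.symm] at h3
  linarith

theorem degIn_member_support (h : DetachedVertex G k m F B u v) (hy : y ∈ B)
    (ha : IsSupport G F B u y a) :
    degIn G (insert a (insert u (B.erase y))) a = degIn G B v + degIn G B y := by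
  rw [h.degIn_member hy ha, adjInd_self, adjInd_eq_one.2 ha.adj.symm]
  linarith [h.degIn_support hy ha]

/-- As every degree in a member is positive, the `(k-1)`-set `B - s + a` has fewer edges than a
member; `degIn_support` removes `a` and `v` from the count. In particular degrees in `B` differ by
at most one. -/
theorem exchange (h : DetachedVertex G k m F B u v) (hy : y ∈ B)
    (ha : IsSupport G F B u y a) (hs : s ∈ B) :
    degIn G B y + adjInd G a y ≤ degIn G B s + adjInd G a s := by
  have h1 : a ∉ B.erase s := fun e => ha.notMem (Finset.mem_of_mem_erase e)
  obtain ⟨x, hx, hd⟩ := h.exists_degSum h.le_card h.mem_ext (S := insert a (B.erase s)) (by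
    rw [Finset.card_insert_of_notMem h1, Finset.card_erase_add_one hs]; exact h.card_base)
  have h2 := (h.bounds _ h.mem_ext x hx).1
  rw [degSum_insert h1, degSum_erase hs, degSum_insert h.notMem_ext, degIn_erase hs] at hd
  linarith [h.degIn_support hy ha]

theorem base_nonempty (h : DetachedVertex G k m F B u v) : ∃ y, y ∈ B :=
  Finset.card_pos.1 (by have := h.card_base; have := h.four_le; omega)

theorem mem_member {W : Type*} {B : Finset W} {u y a s : W} (hy : s ∈ B) (hsy : s ≠ y) : s ∈ insert a (insert u (B.erase y)) := by
  simp [hy, hsy]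

/-- The members do not have a unique vertex of degree one. -/
theorem false_of_unique_leaf (h : DetachedVertex G k m F B u v)
    (huniq : ∀ T ∈ F, ∀ x ∈ T, ∀ y ∈ T, degIn G T x = 1 → degIn G T y = 1 → x = y) : False := by
  have hk := h.four_le
  have hBc := h.card_base
  have hleaf : ∀ y ∈ B, ∀ a, IsSupport G F B u y a → ∀ s ∈ B, s ≠ y →
      degIn G (insert a (insert u (B.erase y))) s ≠ 1 := by
    intro y hy a ha s hs hsy hd
    have := huniq _ ha.mem s (mem_member hs hsy) u (by simp) hd (h.degIn_member_leaf hy ha)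
    exact h.notMem (this ▸ hs)
  -- the degree of the neighbour of the leaf is the same in all members
  have hsupp' : ∀ T ∈ F, ∀ x ∈ T, ∀ z ∈ T, degIn G T x = 1 → G.Adj x z → ∀ T' ∈ F, ∀ x' ∈ T',
      ∀ z' ∈ T', degIn G T' x' = 1 → G.Adj x' z' → degIn G T z = degIn G T' z' := by
    intro T hT x hx z hz hd hadj T' hT' x' hx' z' hz' hd' hadj'
    obtain ⟨f, hf, hfadj, hdeg⟩ := h.exists_iso hT hT'
    have h1 : f x = x' := huniq T' hT' _ (hf.mapsTo hx) _ hx' (by rw [hdeg x hx, hd]) hd'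
    have h2 : f z = z' := eq_of_degIn_le_one hd'.le (hf.mapsTo hz) hz'
      (h1 ▸ (hfadj x hx z hz).2 hadj) hadj'
    rw [← hdeg z hz, h2]
  obtain ⟨y₀, hy₀⟩ := h.base_nonempty
  obtain ⟨a₀, ha₀⟩ := h.exists_support hy₀
  -- The unique leaf's neighbour has the same degree in all members, and for the member of `y` this
  -- degree is `degIn G B v + degIn G B y`. So the base is regular.
  obtain ⟨ρ, hρ⟩ : ∃ ρ, ∀ y ∈ B, degIn G B y = ρ := by
    refine ⟨degIn G B y₀, fun y hy => ?_⟩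
    obtain ⟨a, ha⟩ := h.exists_support hy
    have := hsupp' _ ha.mem u (by simp) a (by simp) (h.degIn_member_leaf hy ha) ha.adj _ ha₀.mem u
      (by simp) a₀ (by simp) (h.degIn_member_leaf hy₀ ha₀) ha₀.adj
    rw [h.degIn_member_support hy ha, h.degIn_member_support hy₀ ha₀] at this
    linarith
  have hρ0 : 0 ≤ ρ := hρ y₀ hy₀ ▸ degIn_nonneg _ _
  have hother : ∃ s ∈ B, s ≠ y₀ := by
    obtain ⟨s, hs⟩ := Finset.card_pos.1 (show 0 < (B.erase y₀).card by
      rw [Finset.card_erase_of_mem hy₀]; omega)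
    exact ⟨s, Finset.mem_of_mem_erase hs, Finset.ne_of_mem_erase hs⟩
  obtain ⟨s, hs, hsy⟩ := hother
  have hv1 := h.one_le
  have hd2 : ∀ y ∈ B, ∀ a, IsSupport G F B u y a → ∀ s ∈ B, s ≠ y →
      2 ≤ adjInd G s a + ρ - adjInd G s y := by
    intro y hy a ha s hs hsy
    have h1 := (h.bounds _ ha.mem s (mem_member hs hsy)).1
    have h2 := hleaf y hy a ha s hs hsy
    rw [h.degIn_member_base hy ha hs, hρ s hs] at h1 h2
    omega
  have hρ2 : 2 ≤ ρ := by
    by_contra! hlt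
    have h1 := hd2 y₀ hy₀ a₀ ha₀ s hs hsy
    have h2 := adjInd_le_one (G := G) s a₀
    have h3 := adjInd_nonneg (G := G) s y₀
    have hρ1 : ρ = 1 := by omega
    obtain ⟨w, hw, hadj⟩ := degIn_pos.1 (show 0 < degIn G B y₀ by rw [hρ _ hy₀]; omega)
    have h4 := hd2 y₀ hy₀ a₀ ha₀ w hw hadj.ne'
    rw [adjInd_eq_one.2 hadj.symm] at h4
    linarith [adjInd_le_one (G := G) w a₀]
  have hv : degIn G B v = 1 := by
    obtain ⟨x, hx, hd⟩ := h.exists_deg ha₀.mem h.mem_ext (x := u) (by simp)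
    rw [h.degIn_member_leaf hy₀ ha₀] at hd
    rcases Finset.mem_insert.1 hx with rfl | hxB
    · rwa [h.degIn_ext_self] at hd
    · rw [h.degIn_ext, hρ x hxB] at hd
      linarith [adjInd_nonneg (G := G) x v]
  have haB : ∀ y ∈ B, ∀ a, IsSupport G F B u y a → ¬ G.Adj a y ∧ degIn G B a = ρ := by
    intro y hy a ha
    have h1 := h.degIn_support hy ha
    rw [hv, hρ y hy] at h1
    have h3 : ¬ G.Adj a y := by
      intro hadj
      have h2 : degIn G B a = B.card := degIn_eq_card_iff.2 fun s hs => by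
        have := h.exchange hy ha hs
        rw [hρ y hy, hρ s hs, adjInd_eq_one.2 hadj] at this
        exact adjInd_eq_one.1 (le_antisymm (adjInd_le_one _ _) (by linarith))
      have h4 := (h.bounds _ ha.mem a (by simp)).2
      rw [h.degIn_member_support hy ha, hv, hρ y hy] at h4
      rw [adjInd_eq_one.2 hadj] at h1
      omega
    refine ⟨h3, ?_⟩
    rw [adjInd_eq_zero.2 h3] at h1; linarith
  have hE : degSum G (insert v B) = degSum G B + 2 := by
    rw [degSum_insert h.notMem_ext, hv]; ring
  -- Replacing a neighbour `w` of `a₀` by `a₀` gives one edge fewer than `B`, two fewer than a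
  -- member. So `B + v` has a vertex of degree two, and it is not the leaf `v`.
  have hρeq : ρ = 2 := by
    obtain ⟨w, hw, hadj⟩ := degIn_pos.1 (show 0 < degIn G B a₀ by rw [(haB _ hy₀ _ ha₀).2]; omega)
    have h1 : a₀ ∉ B.erase w := fun e => ha₀.notMem (Finset.mem_of_mem_erase e)
    obtain ⟨x, hx, hd⟩ := h.exists_degSum h.le_card h.mem_ext (S := insert a₀ (B.erase w)) (by
      rw [Finset.card_insert_of_notMem h1, Finset.card_erase_add_one hw]; exact h.card_base)
    rw [hE, degSum_insert h1, degSum_erase hw, degIn_erase hw, hρ w hw, (haB _ hy₀ _ ha₀).2,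
      adjInd_eq_one.2 hadj] at hd
    rcases Finset.mem_insert.1 hx with rfl | hxB
    · rw [h.degIn_ext_self, hv] at hd; omega
    · rw [h.degIn_ext, hρ x hxB] at hd
      have := adjInd_nonneg (G := G) x v
      omega
  subst hρeq
  -- degrees in the members are one 1, one 3, the others 2, with the 1 and the 3 adjacent
  have hthree : ∀ T ∈ F, (∀ x ∈ T, degIn G T x ≤ 3) ∧
      ∀ x ∈ T, ∀ y ∈ T, degIn G T x = 3 → degIn G T y = 3 → x = y := by
    intro T hT
    have hext : ∀ x ∈ insert v B, degIn G (insert v B) x ≤ 3 ∧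
        (degIn G (insert v B) x = 3 → G.Adj v x ∧ x ∈ B) := by
      intro x hx
      rcases Finset.mem_insert.1 hx with rfl | hxB
      · rw [h.degIn_ext_self, hv]; omega
      · rw [h.degIn_ext, hρ x hxB]
        have h1 := adjInd_le_one (G := G) x v
        refine ⟨by linarith, fun e => ⟨(adjInd_eq_one.1 (by linarith)).symm, hxB⟩⟩
    constructor
    · intro x hx
      obtain ⟨z, hz, hzd⟩ := h.exists_deg hT h.mem_ext hx
      rw [← hzd]; exact (hext z hz).1
    · intro x hx y hy hxd hyd
      have h1 := h.card_filter_deg h.mem_ext hT (· = 3)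
      have h2 : ((insert v B).filter fun x => degIn G (insert v B) x = 3).card ≤ 1 := by
        rw [Finset.card_le_one]
        intro x hx y hy
        rw [Finset.mem_filter] at hx hy
        exact eq_of_degIn_le_one hv.le ((hext x hx.1).2 hx.2).2 ((hext y hy.1).2 hy.2).2
          ((hext x hx.1).2 hx.2).1 ((hext y hy.1).2 hy.2).1
      rw [h1, Finset.card_le_one] at h2
      exact h2 x (by simp [hx, hxd]) y (by simp [hy, hyd])
  obtain ⟨hna, had⟩ := haB _ hy₀ _ ha₀
  have ha3 : degIn G (insert a₀ (insert u (B.erase y₀))) a₀ = 3 := by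
    rw [h.degIn_member_support hy₀ ha₀, hv, hρ _ hy₀]; rfl
  -- Since `a₀` is the only vertex of degree three and `u` the only leaf, all other vertices keep
  -- degree two when `y₀` is replaced; so `a₀` and `y₀` have the same neighbours in `B`.
  have hN : ∀ s ∈ B, adjInd G a₀ s = adjInd G y₀ s := by
    intro s hs
    by_cases hsy : s = y₀
    · subst hsy; rw [adjInd_eq_zero.2 hna]; simp
    · have hsT := mem_member (a := a₀) (u := u) hs hsy
      have h1 := (hthree _ ha₀.mem).1 s hsT
      have h2 : degIn G (insert a₀ (insert u (B.erase y₀))) s ≠ 3 := fun e =>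
        ha₀.notMem ((hthree _ ha₀.mem).2 s hsT a₀ (by simp) e ha3 ▸ hs)
      have h3 := hd2 _ hy₀ _ ha₀ s hs hsy
      rw [h.degIn_member_base hy₀ ha₀ hs, hρ s hs] at h1 h2
      rw [adjInd_comm a₀, adjInd_comm y₀]
      omega
  -- `B - w + a₀` has as many edges as `B`, so its extension attaches a leaf to the vertex of degree
  -- three. Hence `B - w + a₀` is again 2-regular, and `w` has the same neighbours as `a₀`, that is,
  -- as `y₀`.
  have hB : ∀ w ∈ B, w ≠ y₀ → ¬ G.Adj y₀ w → ∀ s ∈ B, adjInd G w s = adjInd G y₀ s := by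
    intro w hw hwy hadj s hs
    by_cases hsw : s = w
    · subst hsw; rw [adjInd_eq_zero.2 hadj]; simp
    have hna' : adjInd G a₀ w = 0 := by rw [hN w hw, adjInd_eq_zero.2 hadj]
    have h1 : a₀ ∉ B.erase w := fun e => ha₀.notMem (Finset.mem_of_mem_erase e)
    obtain ⟨v', hv', hF⟩ := h.exists_insert (insert a₀ (B.erase w)) (by
      rw [Finset.card_insert_of_notMem h1, Finset.card_erase_add_one hw]; exact h.card_base)
      h.le_card
    have h2 := h.degSum_eq hF h.mem_ext
    rw [hE, degSum_insert hv', degSum_insert h1, degSum_erase hw, degIn_erase hw, hρ w hw, had,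
      hna'] at h2
    have hv'd : degIn G (insert a₀ (B.erase w)) v' = 1 := by linarith
    have hv'd' : degIn G (insert v' (insert a₀ (B.erase w))) v' = 1 := by
      rw [degIn_insert hv', hv'd]; simp
    obtain ⟨z, hz, hvz⟩ := degIn_pos.1 (show 0 < degIn G (insert a₀ (B.erase w)) v' by omega)
    have hz3 := hsupp' _ hF v' (by simp) z (by simp [hz]) hv'd' hvz _ ha₀.mem u (by simp) a₀
      (by simp) (h.degIn_member_leaf hy₀ ha₀) ha₀.adj
    rw [ha3] at hz3
    have hs' : s ∈ insert a₀ (B.erase w) := by simp [hs, hsw]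
    have hsv : s ≠ v' := by rintro rfl; exact hv' hs'
    have hsT : s ∈ insert v' (insert a₀ (B.erase w)) := by simp [hs, hsw]
    have hsd : degIn G (insert a₀ (B.erase w)) s = 2 := by
      have e1 := degIn_insert (G := G) hv' s
      by_cases hsz : s = z
      · subst hsz
        rw [hz3, adjInd_eq_one.2 hvz.symm] at e1; linarith
      · have h3 := (hthree _ hF).1 s hsT
        have h4 : degIn G (insert v' (insert a₀ (B.erase w))) s ≠ 3 := fun e =>
          hsz ((hthree _ hF).2 s hsT z (by simp [hz]) e hz3)
        have h5 := (h.bounds _ hF s hsT).1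
        have h6 : degIn G (insert v' (insert a₀ (B.erase w))) s ≠ 1 := fun e =>
          hsv (huniq _ hF s hsT v' (by simp) e hv'd')
        rw [adjInd_eq_zero.2 fun e => hsz (eq_of_degIn_le_one hv'd.le hs' hz e.symm hvz)] at e1
        omega
    rw [degIn_insert h1, degIn_erase hw, hρ s hs, adjInd_comm s a₀, hN s hs, adjInd_comm s w]
      at hsd
    linarith
  obtain ⟨y₁, hy₁, hadj₁⟩ := degIn_pos.1 (show 0 < degIn G B y₀ by rw [hρ _ hy₀]; omega)
  have hcount : (B.filter fun w => ¬ G.Adj y₀ w).card ≤ 2 := by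
    have h1 : ((B.filter (G.Adj y₁)).card : ℤ) = 2 := by rw [← degIn_eq_card, hρ _ hy₁]
    have h2 : (B.filter fun w => ¬ G.Adj y₀ w) ⊆ B.filter (G.Adj y₁) := by
      intro w hw
      rw [Finset.mem_filter] at hw ⊢
      refine ⟨hw.1, ?_⟩
      by_cases hwy : w = y₀
      · subst hwy; exact hadj₁.symm
      · have := hB w hw.1 hwy hw.2 y₁ hy₁
        rw [adjInd_eq_one.2 hadj₁] at this
        exact (adjInd_eq_one.1 this).symm
    have := Finset.card_le_card h2
    omega
  have hcount' : ((B.filter (G.Adj y₀)).card : ℤ) = 2 := by rw [← degIn_eq_card, hρ _ hy₀]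
  have hsplit := Finset.card_filter_add_card_filter_not (s := B) (G.Adj y₀)
  have hdom := (h.bounds _ ha₀.mem a₀ (by simp)).2
  rw [ha3] at hdom
  -- The base is now a 4-cycle, and `u`, `a₀` together with two opposite vertices span a single
  -- edge. A member would then need a vertex of degree four.
  have hk5 : k = 5 := by omega
  obtain ⟨w, hw⟩ := Finset.card_pos.1 (show 0 < ((B.filter fun w => ¬ G.Adj y₀ w).erase y₀).card by
    rw [Finset.card_erase_of_mem (by simp [hy₀])]; omega)
  simp only [Finset.mem_erase, Finset.mem_filter] at hw
  obtain ⟨hwy, hwB, hwadj⟩ := hw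
  have huy : u ≠ y₀ := by rintro rfl; exact h.notMem hy₀
  have huw : u ≠ w := by rintro rfl; exact h.notMem hwB
  have hay : a₀ ≠ y₀ := by rintro rfl; exact ha₀.notMem hy₀
  have haw : a₀ ≠ w := by rintro rfl; exact ha₀.notMem hwB
  have hd1 : w ∉ (∅ : Finset W) := by simp
  have hd2 : y₀ ∉ insert w (∅ : Finset W) := by simp [hwy.symm]
  have hd3 : a₀ ∉ insert y₀ (insert w (∅ : Finset W)) := by simp [hay, haw]
  have hd4 : u ∉ insert a₀ (insert y₀ (insert w (∅ : Finset W))) := by simp [huy, huw, ha₀.adj.ne]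
  obtain ⟨x, hx, hd⟩ := h.exists_degSum h.le_card h.mem_ext
    (S := insert u (insert a₀ (insert y₀ (insert w ∅)))) (by
      rw [Finset.card_insert_of_notMem hd4, Finset.card_insert_of_notMem hd3,
        Finset.card_insert_of_notMem hd2, Finset.card_insert_of_notMem hd1]; simp [hk5])
  have hBsum : degSum G B = 8 := by
    unfold degSum
    rw [Finset.sum_congr rfl hρ, Finset.sum_const, nsmul_eq_mul]
    omega
  rw [hE, hBsum, degSum_insert hd4, degSum_insert hd3, degSum_insert hd2, degSum_insert hd1,
    degIn_insert hd3, degIn_insert hd2, degIn_insert hd2, degIn_insert hd1, degIn_insert hd1,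
    degIn_insert hd1, adjInd_eq_one.2 ha₀.adj, adjInd_eq_zero.2 (h.not_adj y₀ hy₀),
    adjInd_eq_zero.2 (h.not_adj w hwB), adjInd_eq_zero.2 hna, hN w hwB, adjInd_eq_zero.2 hwadj]
    at hd
  simp [degSum] at hd
  have := (h.bounds _ h.mem_ext x hx).2
  omega

end DetachedVertex

end

section

open scoped Classical

variable {W : Type*} [Fintype W] {G : SimpleGraph W} {k m : ℕ} {F : Set (Finset W)}

namespace DetachedVertex

variable {B : Finset W} {u v y a s : W}

/-- Every degree occurring in a member is at most `max c (degIn G B v)`. -/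
theorem degIn_le (h : DetachedVertex G k m F B u v) {c : ℤ} (hc : ∀ s ∈ B, degIn G B s + 1 ≤ c)
    {T : Finset W} (hT : T ∈ F) {x : W} (hx : x ∈ T) : degIn G T x ≤ max c (degIn G B v) := by
  obtain ⟨z, hz, hd⟩ := h.exists_deg hT h.mem_ext hx
  rw [← hd]
  rcases Finset.mem_insert.1 hz with rfl | hzB
  · rw [h.degIn_ext_self]; exact le_max_right _ _
  · rw [h.degIn_ext]
    linarith [adjInd_le_one (G := G) z v, hc z hzB, le_max_left c (degIn G B v)]

/-- The left side is the degree of the support in its member; if it were at most `degIn G B v`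
instead, `y` would have degree zero. -/
theorem degIn_add_le (h : DetachedVertex G k m F B u v) {c : ℤ}
    (hc : ∀ s ∈ B, degIn G B s + 1 ≤ c) (hy : y ∈ B) (hpos : 1 ≤ degIn G B y) :
    degIn G B v + degIn G B y ≤ c := by
  obtain ⟨a, ha⟩ := h.exists_support hy
  have h1 := h.degIn_le hc ha.mem (x := a) (by simp)
  rw [h.degIn_member_support hy ha] at h1
  rcases le_max_iff.1 h1 with h2 | h2
  · exact h2
  · omega

/-- A neighbour in the base of degree one is joined to the support. -/
theorem adj_support_of_adj (h : DetachedVertex G k m F B u v) (hy : y ∈ B)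
    (ha : IsSupport G F B u y a) (hs : s ∈ B) (hadj : G.Adj y s) (hd : degIn G B s = 1) :
    G.Adj a s := by
  have h1 := (h.bounds _ ha.mem s (mem_member hs hadj.ne')).1
  rw [h.degIn_member_base hy ha hs, adjInd_eq_one.2 hadj.symm, hd, adjInd_comm] at h1
  exact adjInd_eq_one.1 (le_antisymm (adjInd_le_one _ _) (by linarith))

/-- By `exchange` all degrees in `B` are at most one. If all vanish, `B + v` is a star centred at
`v`. Otherwise take `y` of degree one with neighbour `y'`: the support of `y` has just one neighbour
in `B`, but it must be joined to `y'`, which would become isolated, and to `s`, by `exchange`. -/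
theorem false_of_isolated (h : DetachedVertex G k m F B u v) (hs : s ∈ B)
    (hd : degIn G B s = 0) : False := by
  have hle : ∀ y ∈ B, degIn G B y ≤ 1 := fun y hy => by
    obtain ⟨a, ha⟩ := h.exists_support hy
    have := h.exchange hy ha hs
    linarith [adjInd_nonneg (G := G) a y, adjInd_le_one (G := G) a s]
  by_cases hall : ∀ y ∈ B, degIn G B y = 0
  · refine h.not_star h.mem_ext (r := v) (by simp) ?_ ?_
    · intro x hx hxv
      have h1 := (h.bounds _ h.mem_ext x hx).1
      have hxB := (Finset.mem_insert.1 hx).resolve_left hxv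
      rw [h.degIn_ext, hall x hxB] at h1
      exact (adjInd_eq_one.1 (le_antisymm (adjInd_le_one _ _) (by linarith))).symm
    · intro x hx z hz hxv hzv
      have hxB := (Finset.mem_insert.1 hx).resolve_left hxv
      exact degIn_eq_zero.1 (hall x hxB) z ((Finset.mem_insert.1 hz).resolve_left hzv)
  · push Not at hall
    obtain ⟨y, hy, hyd⟩ := hall
    have hyd1 : degIn G B y = 1 := by
      have := hle y hy
      have := degIn_nonneg (G := G) B y
      omega
    obtain ⟨a, ha⟩ := h.exists_support hy
    obtain ⟨y', hy', hadj⟩ := degIn_pos.1 (show 0 < degIn G B y by omega)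
    have hy'd : degIn G B y' = 1 := by
      have := hle y' hy'
      have := degIn_pos.2 ⟨y, hy, hadj.symm⟩
      omega
    have hay' := h.adj_support_of_adj hy ha hy' hadj hy'd
    have h1 := h.exchange hy ha hs
    rw [hyd1, hd] at h1
    have h2 := adjInd_nonneg (G := G) a y
    have h3 := adjInd_le_one (G := G) a s
    have h4 := h.degIn_support hy ha
    have h5 := h.degIn_add_le (c := 2) (fun s hs => by linarith [hle s hs]) hy (by omega)
    have h6 : y' = s := eq_of_degIn_le_one (by linarith [h.one_le]) hy' hs hay'
      (adjInd_eq_one.1 (show adjInd G a s = 1 by linarith))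
    rw [h6, hd] at hy'd
    omega

/-- The support of `y` has the partner of `y` as its only neighbour in `B`, so different `y` have
different supports. This gives `u` at least `k - 1 ≥ 4` neighbours, while degrees in members, and
hence in `G`, are at most two. -/
theorem false_of_perfect_matching (h : DetachedVertex G k m F B u v)
    (hd : ∀ s ∈ B, degIn G B s = 1) : False := by
  have hBc := h.card_base
  have hk : 5 ≤ k := by
    have h1 := even_degSum (G := G) B
    unfold degSum at h1
    rw [Finset.sum_congr rfl hd, Finset.sum_const, nsmul_eq_mul, mul_one, Int.even_coe_nat] at h1
    have := h.four_le
    obtain ⟨r, hr⟩ := h1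
    omega
  obtain ⟨y₀, hy₀⟩ := h.base_nonempty
  have hv : degIn G B v = 1 := by
    have h1 := h.degIn_add_le (c := 2) (fun s hs => by rw [hd s hs]; norm_num) hy₀ (hd _ hy₀).ge
    have h2 := h.one_le
    rw [hd _ hy₀] at h1
    omega
  have hdeg : ∀ T ∈ F, ∀ x ∈ T, degIn G T x ≤ (2 : ℕ) := fun T hT x hx =>
    (h.degIn_le (c := 2) (fun s hs => by rw [hd s hs]; norm_num) hT hx).trans (by rw [hv]; norm_num)
  have hu := h.degIn_univ_le h.le_card hdeg (by omega) u
  choose! f hf using fun y (hy : y ∈ B) => h.exists_support hy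
  have hfd : ∀ y ∈ B, degIn G B (f y) = 1 := by
    intro y hy
    have h1 := h.degIn_support hy (hf y hy)
    rw [hv, hd y hy] at h1
    rcases adjInd_zero_or_one (G := G) (f y) y with h2 | h2
    · linarith
    · have h3 : degIn G B (f y) = B.card := degIn_eq_card_iff.2 fun s hs => by
        have := h.exchange hy (hf y hy) hs
        rw [hd y hy, hd s hs, h2] at this
        exact adjInd_eq_one.1 (le_antisymm (adjInd_le_one _ _) (by linarith))
      omega
  have hinj : Set.InjOn f B := by
    intro y hy z hz hyz
    obtain ⟨y', hy', hadj⟩ := degIn_pos.1 (show 0 < degIn G B y by rw [hd y hy]; norm_num)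
    obtain ⟨z', hz', hadj'⟩ := degIn_pos.1 (show 0 < degIn G B z by rw [hd z hz]; norm_num)
    have h1 := h.adj_support_of_adj hy (hf y hy) hy' hadj (hd _ hy')
    have h2 := h.adj_support_of_adj hz (hf z hz) hz' hadj' (hd _ hz')
    rw [← hyz] at h2
    have h3 := eq_of_degIn_le_one (hfd y hy).le hy' hz' h1 h2
    subst h3
    exact eq_of_degIn_le_one (hd _ hy').le hy hz hadj.symm hadj'.symm
  have h1 : B.image f ⊆ Finset.univ.filter (G.Adj u) := by
    intro w hw
    obtain ⟨y, hy, rfl⟩ := Finset.mem_image.1 hw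
    simpa using (hf y hy).adj
  have h2 := Finset.card_le_card h1
  rw [Finset.card_image_of_injOn hinj] at h2
  rw [degIn_eq_card] at hu
  omega

/-- The support of a vertex of degree two is joined exactly to the leaves of `B`; parity then leaves
two leaves `e₁`, `e₂`. Members have exactly one vertex of degree three, and the leaves attached to
it are compared. What remains is a base that is a path on four vertices, with `k = 5`. -/
theorem false_of_degrees_one_two (h : DetachedVertex G k m F B u v)
    (hd : ∀ s ∈ B, degIn G B s = 1 ∨ degIn G B s = 2) (hy : y ∈ B) (hyd : degIn G B y = 2)
    (hs : s ∈ B) (hsd : degIn G B s = 1) : False := by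
  have hBc := h.card_base
  have hc : ∀ s ∈ B, degIn G B s + 1 ≤ 3 := fun s hs => by rcases hd s hs with e | e <;> omega
  have hv : degIn G B v = 1 := by
    have h1 := h.degIn_add_le hc hy (by omega)
    have h2 := h.one_le
    omega
  set L := B.filter fun s => degIn G B s = 1 with hL
  have hadjL : ∀ y ∈ B, degIn G B y = 2 → ∀ a, IsSupport G F B u y a → degIn G B a = 2 ∧
      ∀ e ∈ L, G.Adj a e := by
    intro y hy hyd a ha
    have key : ∀ e ∈ L, adjInd G a y = 0 ∧ adjInd G a e = 1 := by
      intro e he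
      rw [Finset.mem_filter] at he
      have h1 := h.exchange hy ha he.1
      have h2 := adjInd_nonneg (G := G) a y
      have h3 := adjInd_le_one (G := G) a e
      rw [hyd, he.2] at h1
      omega
    refine ⟨?_, fun e he => adjInd_eq_one.1 (key e he).2⟩
    have h1 := h.degIn_support hy ha
    rw [(key s (by simp [hL, hs, hsd])).1, hv, hyd] at h1
    linarith
  obtain ⟨a, ha⟩ := h.exists_support hy
  have hLcard : L.card = 2 := by
    obtain ⟨h1, h2⟩ := hadjL y hy hyd a ha
    have h3 : L ⊆ B.filter (G.Adj a) := fun e he =>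
      Finset.mem_filter.2 ⟨(Finset.mem_filter.1 he).1, h2 e he⟩
    have h4 := Finset.card_le_card h3
    rw [degIn_eq_card] at h1
    have h5 := even_degSum (G := G) B
    have h6 : degSum G B = 2 * B.card - L.card := by
      have h7 : ∀ s ∈ B, degIn G B s = 2 - if degIn G B s = 1 then 1 else 0 := fun s hs => by
        rcases hd s hs with e | e <;> simp [e]
      unfold degSum
      rw [Finset.sum_congr rfl h7, Finset.sum_sub_distrib, Finset.sum_const, Finset.sum_boole,
        nsmul_eq_mul, mul_comm]
    have h8 : 0 < L.card := Finset.card_pos.2 ⟨s, by simp [hL, hs, hsd]⟩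
    obtain ⟨r, hr⟩ := h5
    omega
  have hiff : ∀ y ∈ B, degIn G B y = 2 → ∀ a, IsSupport G F B u y a →
      ∀ e ∈ B, (G.Adj a e ↔ e ∈ L) := by
    intro y hy hyd a ha e he
    obtain ⟨h1, h2⟩ := hadjL y hy hyd a ha
    have h3 : L = B.filter (G.Adj a) := by
      refine Finset.eq_of_subset_of_card_le (fun e he =>
        Finset.mem_filter.2 ⟨(Finset.mem_filter.1 he).1, h2 e he⟩) ?_
      rw [degIn_eq_card] at h1
      omega
    rw [h3]; simp [he]
  obtain ⟨e₁, e₂, he, hLe⟩ := Finset.card_eq_two.1 hLcard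
  have he₁ : e₁ ∈ B ∧ degIn G B e₁ = 1 := Finset.mem_filter.1 (show e₁ ∈ L by simp [hLe])
  have he₂ : e₂ ∈ B ∧ degIn G B e₂ = 1 := Finset.mem_filter.1 (show e₂ ∈ L by simp [hLe])
  have hthree : ∀ y ∈ B, degIn G B y = 2 → ∀ a, IsSupport G F B u y a →
      degIn G (insert a (insert u (B.erase y))) a = 3 := fun y hy hyd a ha => by
    rw [h.degIn_member_support hy ha, hv, hyd]; rfl
  have hex : ∀ T ∈ F, ∃ x ∈ T, degIn G T x = 3 := fun T hT => by
    obtain ⟨x, hx, hxd⟩ := h.exists_deg ha.mem hT (x := a) (by simp)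
    exact ⟨x, hx, by rw [hxd, hthree y hy hyd a ha]⟩
  have huniq : ∀ T ∈ F, ∀ x ∈ T, ∀ z ∈ T, degIn G T x = 3 → degIn G T z = 3 → x = z := by
    intro T hT x hx z hz hxd hzd
    obtain ⟨f, hf, -, hdeg⟩ := h.exists_iso hT h.mem_ext
    have key : ∀ x ∈ T, degIn G T x = 3 → f x ∈ B ∧ G.Adj v (f x) := by
      intro x hx hxd
      have h1 := hdeg x hx
      rcases Finset.mem_insert.1 (hf.mapsTo hx) with h2 | h2
      · rw [h2, h.degIn_ext_self, hv] at h1; omega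
      · rw [h.degIn_ext, hxd] at h1
        have := hc _ h2
        have := adjInd_le_one (G := G) (f x) v
        exact ⟨h2, (adjInd_eq_one.1 (show adjInd G (f x) v = 1 by omega)).symm⟩
    exact hf.injOn hx hz (eq_of_degIn_le_one hv.le (key x hx hxd).1 (key z hz hzd).1
      (key x hx hxd).2 (key z hz hzd).2)
  have hk5 : 5 ≤ k := by
    have h1 := (h.bounds _ ha.mem a (by simp)).2
    rw [hthree y hy hyd a ha] at h1
    omega
  -- If they are adjacent, the member obtained by deleting `e₁` has no vertex of degree three.
  by_cases hee : G.Adj e₁ e₂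
  · obtain ⟨a₁, ha₁⟩ := h.exists_support he₁.1
    have h1 := h.degIn_support he₁.1 ha₁
    rw [hv, he₁.2] at h1
    have h2 := h.adj_support_of_adj he₁.1 ha₁ he₂.1 hee he₂.2
    obtain ⟨x, hx, hxd⟩ := hex _ ha₁.mem
    simp only [Finset.mem_insert, Finset.mem_erase] at hx
    rcases hx with rfl | rfl | ⟨hxe, hxB⟩
    · rw [h.degIn_member_support he₁.1 ha₁, hv, he₁.2] at hxd; omega
    · rw [h.degIn_member_leaf he₁.1 ha₁] at hxd; omega
    · rw [h.degIn_member_base he₁.1 ha₁ hxB] at hxd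
      have h3 := adjInd_le_one (G := G) x a₁
      have h4 := adjInd_nonneg (G := G) x e₁
      have h5 := hc x hxB
      have h6 : x = e₂ := eq_of_degIn_le_one (G := G) (T := B.erase e₁) (x := a₁)
        (by rw [degIn_erase he₁.1]; linarith) (by simp [hxe, hxB]) (by simp [he.symm, he₂.1])
        (adjInd_eq_one.1 (show adjInd G x a₁ = 1 by omega)).symm h2
      rw [h6, he₂.2] at hxd
      have := adjInd_le_one (G := G) e₂ a₁
      have := adjInd_nonneg (G := G) e₂ e₁
      omega
  have hL1 : e₁ ∈ L := by simp [hLe]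
  have hL2 : e₂ ∈ L := by simp [hLe]
  have hnL : ∀ y ∈ B, degIn G B y = 2 → y ∉ L := fun y hy hyd e => by
    have := (Finset.mem_filter.1 e).2; omega
  -- Delete the neighbour `y₁` of `e₁`: then both `u` and `e₁` are leaves at the vertex of degree
  -- three. Delete a vertex `y₂` adjacent to neither leaf: then only `u` is. The two members would
  -- not be isomorphic.
  have hB : ∀ y ∈ B, degIn G B y = 2 → G.Adj y e₁ ∨ G.Adj y e₂ := by
    by_contra! hcon
    obtain ⟨y₂, hy₂, hyd₂, hn₁, hn₂⟩ := hcon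
    obtain ⟨y₁, hy₁, hadj⟩ := degIn_pos.1 (show 0 < degIn G B e₁ by omega)
    have hyd₁ : degIn G B y₁ = 2 := by
      refine (hd _ hy₁).resolve_left fun e => ?_
      have : y₁ ∈ L := Finset.mem_filter.2 ⟨hy₁, e⟩
      rw [hLe, Finset.mem_insert, Finset.mem_singleton] at this
      rcases this with rfl | rfl
      · exact hadj.ne rfl
      · exact hee hadj
    obtain ⟨a₁, ha₁⟩ := h.exists_support hy₁
    obtain ⟨a₂, ha₂⟩ := h.exists_support hy₂
    obtain ⟨f, hf, hfadj, hdeg⟩ := h.exists_iso ha₁.mem ha₂.mem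
    have hne : e₁ ≠ y₁ := hadj.ne
    have hmem : e₁ ∈ insert a₁ (insert u (B.erase y₁)) := mem_member he₁.1 hne
    have hfa : f a₁ = a₂ := huniq _ ha₂.mem _ (hf.mapsTo (by simp)) _ (by simp)
      (by rw [hdeg a₁ (by simp), hthree _ hy₁ hyd₁ _ ha₁]) (hthree _ hy₂ hyd₂ _ ha₂)
    have key : ∀ x ∈ insert a₁ (insert u (B.erase y₁)), G.Adj x a₁ →
        degIn G (insert a₁ (insert u (B.erase y₁))) x = 1 → f x = u := by
      intro x hx hxa hxd
      have h1 := hf.mapsTo hx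
      have h2 := (hfadj x hx a₁ (by simp)).2 hxa
      have h3 := hdeg x hx
      rw [hfa] at h2
      rw [hxd] at h3
      simp only [Finset.coe_insert, Set.mem_insert_iff, Finset.mem_coe, Finset.mem_erase] at h1
      rcases h1 with h1 | h1 | ⟨hne, hB⟩
      · exact absurd h1 h2.ne
      · exact h1
      · rw [h.degIn_member_base hy₂ ha₂ hB, adjInd_eq_one.2 h2] at h3
        have h4 := (hiff _ hy₂ hyd₂ _ ha₂ _ hB).1 h2.symm
        have h5 := (Finset.mem_filter.1 h4).2
        rw [adjInd_eq_zero.2, h5] at h3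
        · omega
        · rw [hLe, Finset.mem_insert, Finset.mem_singleton] at h4
          rcases h4 with h4 | h4 <;> rw [h4]
          · exact fun e => hn₁ e.symm
          · exact fun e => hn₂ e.symm
    have h1 := key u (by simp) ha₁.adj (h.degIn_member_leaf hy₁ ha₁)
    have hea : G.Adj e₁ a₁ := ((hiff _ hy₁ hyd₁ _ ha₁ _ he₁.1).2 hL1).symm
    have h2 := key e₁ hmem hea (by
      rw [h.degIn_member_base hy₁ ha₁ he₁.1, adjInd_eq_one.2 hadj, adjInd_eq_one.2 hea, he₁.2]; rfl)
    have h3 := hf.injOn hmem (by simp) (h2.trans h1.symm)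
    exact h.notMem (h3 ▸ he₁.1)
  have hnbr : ∀ e ∈ L, (B.filter (G.Adj e)).card = 1 := fun e he => by
    have := (Finset.mem_filter.1 he).2
    rw [degIn_eq_card] at this
    exact_mod_cast this
  have hBL : B \ L ⊆ B.filter (G.Adj e₁) ∪ B.filter (G.Adj e₂) := by
    intro z hz
    rw [Finset.mem_sdiff] at hz
    have hzd := (hd z hz.1).resolve_left fun e => hz.2 (Finset.mem_filter.2 ⟨hz.1, e⟩)
    simp only [Finset.mem_union, Finset.mem_filter, hz.1, true_and]
    exact (hB z hz.1 hzd).imp (fun e => e.symm) fun e => e.symm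
  have hBLc : (B \ L).card = B.card - 2 := by
    rw [Finset.card_sdiff_of_subset (Finset.filter_subset _ _), hLcard]
  have hcard := (Finset.card_le_card hBL).trans (Finset.card_union_le _ _)
  rw [hnbr _ hL1, hnbr _ hL2] at hcard
  have hk : k = 5 := by omega
  obtain ⟨y', hy'⟩ := Finset.card_eq_one.1 (show ((B \ L).erase y).card = 1 by
    rw [Finset.card_erase_of_mem (Finset.mem_sdiff.2 ⟨hy, hnL y hy hyd⟩)]; omega)
  have hy'mem : y' ∈ (B \ L).erase y := by simp [hy']
  rw [Finset.mem_erase, Finset.mem_sdiff] at hy'mem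
  obtain ⟨hyy, hy'B, hy'L⟩ := hy'mem
  have hyd' := (hd y' hy'B).resolve_left fun e => hy'L (Finset.mem_filter.2 ⟨hy'B, e⟩)
  have hBeq : ∀ z ∈ B, z = e₁ ∨ z = e₂ ∨ z = y ∨ z = y' := by
    intro z hz
    by_cases hzL : z ∈ L
    · rw [hLe, Finset.mem_insert, Finset.mem_singleton] at hzL; tauto
    · by_cases hzy : z = y
      · tauto
      · have : z ∈ (B \ L).erase y := by simp [hz, hzL, hzy]
        rw [hy', Finset.mem_singleton] at this; tauto
  have hyy' : G.Adj y y' := by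
    by_contra hn
    have h1 : B.filter (G.Adj y) ⊆ {e₁, e₂} := by
      intro z hz
      rw [Finset.mem_filter] at hz
      rcases hBeq z hz.1 with rfl | rfl | rfl | rfl
      · simp
      · simp
      · exact absurd hz.2 G.irrefl
      · exact absurd hz.2 hn
    have h2 : B.filter (G.Adj y) = {e₁, e₂} := Finset.eq_of_subset_of_card_le h1 (by
      rw [degIn_eq_card] at hyd
      rw [Finset.card_pair he]; omega)
    have h3 : ∀ e ∈ ({e₁, e₂} : Finset W), G.Adj y e := fun e he => by
      rw [← h2] at he; exact (Finset.mem_filter.1 he).2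
    rcases hB y' hy'B hyd' with h4 | h4
    · exact hyy (eq_of_degIn_le_one he₁.2.le hy'B hy h4.symm (h3 e₁ (by simp)).symm)
    · exact hyy (eq_of_degIn_le_one he₂.2.le hy'B hy h4.symm (h3 e₂ (by simp)).symm)
  have hay : ¬ G.Adj a y := fun e => hnL y hy hyd ((hiff y hy hyd a ha y hy).1 e)
  have hay' : ¬ G.Adj a y' := fun e => hy'L ((hiff y hy hyd a ha y' hy'B).1 e)
  have huy : u ≠ y := by rintro rfl; exact h.notMem hy
  have huy' : u ≠ y' := by rintro rfl; exact h.notMem hy'B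
  have hay2 : a ≠ y := by rintro rfl; exact ha.notMem hy
  have hay2' : a ≠ y' := by rintro rfl; exact ha.notMem hy'B
  have hd1 : y' ∉ (∅ : Finset W) := by simp
  have hd2 : y ∉ insert y' (∅ : Finset W) := by simp [hyy.symm]
  have hd3 : a ∉ insert y (insert y' (∅ : Finset W)) := by simp [hay2, hay2']
  have hd4 : u ∉ insert a (insert y (insert y' (∅ : Finset W))) := by simp [huy, huy', ha.adj.ne]
  -- These four vertices induce two disjoint edges. The edge count forces the extending vertex to
  -- have degree two, so no vertex of degree three arises.
  set S := insert u (insert a (insert y (insert y' (∅ : Finset W)))) with hS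
  have hSd : ∀ x, degIn G S x = adjInd G x u + (adjInd G x a + (adjInd G x y + adjInd G x y')) :=
    fun x => by
      rw [hS, degIn_insert hd4, degIn_insert hd3, degIn_insert hd2, degIn_insert hd1]; simp
  have iua := adjInd_eq_one.2 ha.adj
  have iuy := adjInd_eq_zero.2 (h.not_adj y hy)
  have iuy' := adjInd_eq_zero.2 (h.not_adj y' hy'B)
  have iay := adjInd_eq_zero.2 hay
  have iay' := adjInd_eq_zero.2 hay'
  have iyy' := adjInd_eq_one.2 hyy'
  have hSd1 : ∀ x ∈ S, degIn G S x = 1 := by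
    intro x hx
    simp only [hS, Finset.mem_insert, Finset.notMem_empty, or_false] at hx
    rw [hSd]
    rcases hx with rfl | rfl | rfl | rfl
    · rw [iua, iuy, iuy']; simp
    · rw [adjInd_comm, iua, iay, iay']; simp
    · rw [adjInd_comm x u, adjInd_comm x a, iuy, iay, iyy']; simp
    · rw [adjInd_comm x u, adjInd_comm x a, adjInd_comm x y, iuy', iay', iyy']; simp
  have hSc : S.card = 4 := by
    rw [hS, Finset.card_insert_of_notMem hd4, Finset.card_insert_of_notMem hd3,
        Finset.card_insert_of_notMem hd2, Finset.card_insert_of_notMem hd1]; simp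
  have hSsum : degSum G S = 4 := by
    unfold degSum
    rw [Finset.sum_congr rfl hSd1, Finset.sum_const, hSc]; norm_num
  have hBsum : degSum G B = 6 := by
    have h1 : B = insert e₁ (insert e₂ (insert y (insert y' ∅))) := by
      ext z
      simp only [Finset.mem_insert, Finset.notMem_empty, or_false]
      exact ⟨hBeq z, by rintro (rfl | rfl | rfl | rfl) <;> tauto⟩
    have h2 : ∀ z ∈ B, degIn G B z = 2 - if z ∈ L then 1 else 0 := fun z hz => by
      by_cases hzL : z ∈ L
      · simp [hzL, (Finset.mem_filter.1 hzL).2]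
      · simp [hzL, (hd z hz).resolve_left fun e => hzL (Finset.mem_filter.2 ⟨hz, e⟩)]
    unfold degSum
    rw [Finset.sum_congr rfl h2, Finset.sum_sub_distrib, Finset.sum_const, Finset.sum_boole,
      Finset.filter_mem_eq_inter, Finset.inter_eq_right.2 (Finset.filter_subset _ _), hLcard,
      nsmul_eq_mul]
    omega
  obtain ⟨w, hw, hF⟩ := h.exists_insert S (by omega) h.le_card
  have h1 := h.degSum_eq hF h.mem_ext
  rw [degSum_insert hw, degSum_insert h.notMem_ext, hSsum, hBsum, hv] at h1
  obtain ⟨x, hx, hxd⟩ := hex _ hF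
  rw [degIn_insert hw] at hxd
  rcases Finset.mem_insert.1 hx with rfl | hxS
  · rw [adjInd_self] at hxd; omega
  · rw [hSd1 x hxS] at hxd
    have := adjInd_le_one (G := G) x w
    omega

/-- When members have two leaves, `B + v` has a leaf in `B`, so the minimum degree of `B` is at most
one. Since degrees in `B` differ by at most one, only the treated degree patterns remain. -/
theorem false (h : DetachedVertex G k m F B u v) : False := by
  by_cases huniq : ∀ T ∈ F, ∀ x ∈ T, ∀ y ∈ T, degIn G T x = 1 → degIn G T y = 1 → x = y
  · exact h.false_of_unique_leaf huniq
  have htwo : ∀ T ∈ F, ∀ x, ∃ y ∈ T, y ≠ x ∧ degIn G T y = 1 := by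
    push Not at huniq
    obtain ⟨T', hT', p, hp, q, hq, hpd, hqd, hpq⟩ := huniq
    intro T hT x
    obtain ⟨f, hf, -, hdeg⟩ := h.exists_iso hT' hT
    by_cases hx : f p = x
    · exact ⟨f q, hf.mapsTo hq, fun e => hpq (hf.injOn hp hq (hx.trans e.symm)),
        by rw [hdeg q hq, hqd]⟩
    · exact ⟨f p, hf.mapsTo hp, hx, by rw [hdeg p hp, hpd]⟩
  obtain ⟨s, hs, hmin⟩ := Finset.exists_min_image B (degIn G B) h.base_nonempty
  have hle : ∀ y ∈ B, degIn G B y ≤ degIn G B s + 1 := fun y hy => by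
    obtain ⟨a, ha⟩ := h.exists_support hy
    have := h.exchange hy ha hs
    linarith [adjInd_nonneg (G := G) a y, adjInd_le_one (G := G) a s]
  rcases lt_trichotomy (degIn G B s) 1 with h1 | h1 | h1
  · exact h.false_of_isolated hs (by have := degIn_nonneg (G := G) B s; omega)
  · by_cases hall : ∀ y ∈ B, degIn G B y = 1
    · exact h.false_of_perfect_matching hall
    · push Not at hall
      obtain ⟨y, hy, hyd⟩ := hall
      have h2 : ∀ z ∈ B, degIn G B z = 1 ∨ degIn G B z = 2 := fun z hz => by
        have := hle z hz
        have := hmin z hz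
        omega
      exact h.false_of_degrees_one_two h2 hy ((h2 y hy).resolve_left hyd) hs h1
  · have h2 : ∀ y ∈ B, 2 ≤ degIn G B y := fun y hy => by linarith [hmin y hy]
    obtain ⟨x, hx, hxv, hxd⟩ := htwo _ h.mem_ext v
    have hxB := (Finset.mem_insert.1 hx).resolve_left hxv
    rw [h.degIn_ext] at hxd
    linarith [h2 x hxB, adjInd_nonneg (G := G) x v]

end DetachedVertex

end

/-! ### Members without isolated and dominating vertices -/

section

open scoped Classical

variable {W : Type*} [Fintype W] {G : SimpleGraph W} {k m : ℕ} {F : Set (Finset W)}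

namespace ProperFamily

theorem exists_mem (h : ProperFamily G k m F) (x : W) : ∃ T ∈ F, x ∈ T := by
  obtain ⟨S, hxS, -, hS⟩ := Finset.exists_subsuperset_card_eq (s := {x}) (n := k - 1)
    (Finset.subset_univ _) (by have := h.four_le; simp; omega)
    (by rw [Finset.card_univ, h.card_univ]; omega)
  obtain ⟨v, -, hF⟩ := h.exists_insert S (by have := h.four_le; omega) h.le_card
  exact ⟨_, hF, Finset.mem_insert_of_mem (hxS (by simp))⟩

/-- If no member has an isolated or a dominating vertex, then all degrees of `G` are at least the
minimum degree of the members plus `m`. -/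
theorem add_le_degIn_univ (h : ProperFamily G k m F)
    (hb : ∀ T ∈ F, ∀ x ∈ T, 1 ≤ degIn G T x ∧ degIn G T x ≤ k - 2) {a : ℤ}
    (ha : ∀ T ∈ F, ∀ x ∈ T, a ≤ degIn G T x) (hex : ∃ T ∈ F, ∃ x ∈ T, degIn G T x = a) (v : W) :
    a + m ≤ degIn G Finset.univ v := by
  by_contra! hlt
  have hk := h.four_le
  obtain ⟨T, hT, x, hx, hxd⟩ := hex
  have hak := (hb T hT x hx).2
  obtain ⟨T', hT', hv⟩ := h.exists_mem v
  have h1 := (hb T' hT' v hv).1.trans (degIn_mono (G := G) (Finset.subset_univ T') v)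
  obtain ⟨g, hg⟩ := Int.eq_ofNat_of_zero_le (degIn_nonneg (G := G) Finset.univ v)
  rw [hg] at hlt h1
  -- The least degree that the lemma allows for `v`. It is at least `a`, while `g < a + m`, so it
  -- must come from the `1` in the maximum; hence `g ≤ m`, and `v` has at least `k - 1`
  -- non-neighbours.
  obtain ⟨T₁, hT₁, hvT₁, hd⟩ := h.exists_mem_degIn_eq h.card_univ hg (t := max 1 (g - m))
    (by omega) (by omega) (by omega) (by omega)
  have h2 := ha T₁ hT₁ v hvT₁
  rw [hd] at h2
  have hgm : g ≤ m := by omega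
  obtain ⟨B, hB, hBc⟩ := Finset.exists_subset_card_eq
    (s := Finset.univ.filter fun w => w ≠ v ∧ ¬ G.Adj v w) (n := k - 1) (by
      have h3 := Finset.card_filter_add_card_filter_not (s := (Finset.univ : Finset W)) (G.Adj v)
      have h4 : (Finset.univ.filter (G.Adj v)).card = g := by
        rw [degIn_eq_card] at hg; exact_mod_cast hg
      have h5 : (Finset.univ.filter fun w => ¬ G.Adj v w).erase v =
          Finset.univ.filter fun w => w ≠ v ∧ ¬ G.Adj v w := by
        ext; simp
      rw [← h5, Finset.card_erase_of_mem (by simp)]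
      rw [Finset.card_univ, h.card_univ] at h3
      omega)
  obtain ⟨w, hw, hF⟩ := h.exists_insert B (by omega) h.le_card
  exact DetachedVertex.false (G := G) (k := k) (m := m) (F := F) (B := B) (u := v) (v := w)
    { toProperFamily := h
      bounds := hb
      card_base := by omega
      notMem := fun e => (Finset.mem_filter.1 (hB e)).2.1 rfl
      not_adj := fun s hs => (Finset.mem_filter.1 (hB hs)).2.2
      notMem_ext := hw
      mem_ext := hF }

/-- The lower degree bound for `G` and the same bound for its complement together say that the
family is balanced. -/
theorem eq_two_and_even_of_bounds (h : ProperFamily G k m F)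
    (hb : ∀ T ∈ F, ∀ x ∈ T, 1 ≤ degIn G T x ∧ degIn G T x ≤ k - 2) : m = 2 ∧ Even k := by
  have hk := h.four_le
  have hex : ∀ T ∈ F, ∃ x, x ∈ T := fun T hT =>
    Finset.card_pos.1 (by have := h.card T hT; omega)
  obtain ⟨T, hT⟩ := h.mem_nonempty
  obtain ⟨p, hp, hpmin⟩ := Finset.exists_min_image T (degIn G T) (hex T hT)
  obtain ⟨q, hq, hqmax⟩ := Finset.exists_max_image T (degIn G T) (hex T hT)
  have hbounds : ∀ T' ∈ F, ∀ x ∈ T', degIn G T p ≤ degIn G T' x ∧ degIn G T' x ≤ degIn G T q := by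
    intro T' hT' x hx
    obtain ⟨y, hy, hyd⟩ := h.exists_deg hT' hT hx
    rw [← hyd]
    exact ⟨hpmin y hy, hqmax y hy⟩
  have hlow := h.add_le_degIn_univ hb (fun T' hT' x hx => (hbounds T' hT' x hx).1) ⟨T, hT, p, hp, rfl⟩
  have hhigh := h.compl.add_le_degIn_univ (a := k - 1 - degIn G T q)
    (fun T' hT' x hx => by
      rw [degIn_compl_of_mem T' hx, h.card T' hT']
      have := hb T' hT' x hx
      constructor <;> linarith)
    (fun T' hT' x hx => by
      rw [degIn_compl_of_mem T' hx, h.card T' hT']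
      linarith [(hbounds T' hT' x hx).2])
    ⟨T, hT, q, hq, by rw [degIn_compl_of_mem T hq, h.card T hT]⟩
  have hbal : BalancedFamily G k m F (degIn G T p) (degIn G T q) :=
    { toRainbowFamily := h.toRainbowFamily
      card_univ := h.card_univ
      two_le := h.two_le
      pos := (hb T hT p hp).1
      add_two_le := by linarith [(hb T hT q hq).2]
      bounds := hbounds
      exists_min := fun T' hT' => h.exists_deg hT hT' hp
      exists_max := fun T' hT' => h.exists_deg hT hT' hq
      bounds_univ := fun v => by
        refine ⟨hlow v, ?_⟩
        have := hhigh v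
        rw [degIn_compl_of_mem _ (Finset.mem_univ v), Finset.card_univ, h.card_univ] at this
        push_cast at this
        linarith }
  exact ⟨hbal.eq_two, hbal.even⟩

end ProperFamily

end

/-! ### Members with two isolated vertices, and isolated vertices of the whole graph -/

section

open scoped Classical

variable {W : Type*} [Fintype W] {G : SimpleGraph W} {k m : ℕ} {F : Set (Finset W)}

theorem degSum_mono {W : Type*} {G : SimpleGraph W} {S T : Finset W} (h : S ⊆ T) :
    degSum G S ≤ degSum G T :=
  (Finset.sum_le_sum fun x _ => degIn_mono h x).trans
    (Finset.sum_le_sum_of_subset_of_nonneg h fun x _ _ => degIn_nonneg T x)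

namespace ProperFamily

theorem degSum_le (h : ProperFamily G k m F) {T : Finset W} (hT : T ∈ F) {S : Finset W}
    (hS : S.card + 1 = k) : degSum G S ≤ degSum G T := by
  obtain ⟨x, hx, hd⟩ := h.exists_degSum h.le_card hT hS
  linarith [degIn_nonneg (G := G) T x]

/-- Let `K` be the set of non-isolated vertices of `T`. It is closed under adjacency in `G`, there
is an edge `o₁o₂` outside it, and edge counting gives `|K| = k - 2`. Replacing any `s ∈ K` by this
edge must create isolated vertices, so each `s` has a leaf attached to it alone. Then `K` induces a
perfect matching, so `k` is even, and `G` has maximum degree at most one. -/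
theorem eq_two_and_even_of_two_isolated (h : ProperFamily G k m F) {T : Finset W} (hT : T ∈ F)
    {p q : W} (hp : p ∈ T) (hq : q ∈ T) (hpq : p ≠ q) (hpd : degIn G T p = 0)
    (hqd : degIn G T q = 0) : m = 2 ∧ Even k := by
  have hk := h.four_le
  have hm := h.two_le
  have hTc := h.card T hT
  set K := T.filter fun x => degIn G T x ≠ 0 with hK
  have hKT : K ⊆ T := Finset.filter_subset _ _
  have hmemK : ∀ {x}, x ∈ K ↔ x ∈ T ∧ degIn G T x ≠ 0 := Finset.mem_filter
  have hpK : p ∉ K := fun e => (hmemK.1 e).2 hpd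
  have hqK : q ∉ K := fun e => (hmemK.1 e).2 hqd
  -- no edge leaves `K`
  have hclosed : ∀ x ∈ K, ∀ y, G.Adj x y → y ∈ K := by
    intro x hx y hadj
    by_contra hy
    by_cases hyT : y ∈ T
    · exact hy (hmemK.2 ⟨hyT, (degIn_pos.2 ⟨x, hKT hx, hadj.symm⟩).ne'⟩)
    · have h1 := h.swap_le_of_min h.le_card hT hp (fun z _ => hpd ▸ degIn_nonneg T z) hq hpq hyT
      have h2 := adjInd_nonneg (G := G) p q
      have h3 : adjInd G y x ≤ degIn G ((T.erase p).erase q) y := adjInd_le_degIn (by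
        simp only [Finset.mem_erase]
        exact ⟨fun e => hqK (e ▸ hx), fun e => hpK (e ▸ hx), hKT hx⟩)
      rw [degIn_erase (by simp [hq, hpq.symm]), degIn_erase hp, adjInd_eq_one.2 hadj.symm] at h3
      linarith
  have hdegK : ∀ x ∈ K, ∀ S : Finset W, K ⊆ S → degIn G S x = degIn G K x := by
    intro x hx S hKS
    refine (Finset.sum_subset hKS fun y _ hy => adjInd_eq_zero.2 fun e => hy ?_).symm
    exact hclosed x hx y e
  have hsumT : degSum G T = degSum G K := by
    unfold degSum
    rw [← Finset.sum_subset hKT fun x hx hxK => by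
      by_contra hne; exact hxK (hmemK.2 ⟨hx, hne⟩)]
    exact Finset.sum_congr rfl fun x hx => hdegK x hx T hKT
  have hKpos : ∀ x ∈ K, 0 < degIn G K x := fun x hx => by
    rw [← hdegK x hx T hKT]
    exact lt_of_le_of_ne (degIn_nonneg _ _) (Ne.symm (hmemK.1 hx).2)
  obtain ⟨x, hx, x', hx', hxx⟩ := h.exists_adj hT
  have hxK : x ∈ K := hmemK.2 ⟨hx, (degIn_pos.2 ⟨x', hx', hxx⟩).ne'⟩
  have hx'K : x' ∈ K := hclosed x hxK x' hxx
  -- there is an edge outside `K`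
  obtain ⟨o₁, o₂, ho₁, ho₂, hoo⟩ : ∃ o₁ o₂, o₁ ∉ K ∧ o₂ ∉ K ∧ G.Adj o₁ o₂ := by
    by_contra! hcon
    have hiso : ∀ y, y ∉ K → degIn G Finset.univ y = 0 := fun y hy =>
      degIn_eq_zero.2 fun z _ e => hcon y z hy (fun hz => hy (hclosed z hz y e.symm)) e
    have hsumU : degSum G Finset.univ = degSum G T := by
      rw [hsumT]
      unfold degSum
      rw [← Finset.sum_subset (Finset.subset_univ K) fun y _ hy => hiso y hy]
      exact Finset.sum_congr rfl fun y hy => hdegK y hy _ (Finset.subset_univ _)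
    obtain ⟨A, hA, -, hAc⟩ := Finset.exists_subsuperset_card_eq (s := {x, x'}) (n := m + 1)
      (Finset.subset_univ _) (by rw [Finset.card_pair hxx.ne]; omega)
      (by rw [Finset.card_univ, h.card_univ]; omega)
    obtain ⟨c, hc, hF⟩ := h.exists_erase_compl h.card_univ (by omega) hAc
    have key : ∀ z ∈ K, z ∈ A → z ≠ c → False := by
      intro z hzK hzA hzc
      have h1 : (A.erase c)ᶜ ⊆ Finset.univ.erase z := by
        intro w hw
        simp only [Finset.mem_compl, Finset.mem_erase, not_and] at hw
        simp only [Finset.mem_erase, Finset.mem_univ, and_true]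
        rintro rfl
        exact hw hzc hzA
      have h2 := degSum_mono (G := G) h1
      rw [h.degSum_eq hF hT, degSum_erase (Finset.mem_univ z), hsumU,
        hdegK z hzK _ (Finset.subset_univ _)] at h2
      linarith [hKpos z hzK]
    by_cases hxc : x = c
    · exact key x' hx'K (hA (by simp)) (by rw [← hxc]; exact hxx.ne')
    · exact key x hxK (hA (by simp)) hxc
  have hKc : K.card + 2 ≤ k := by
    have h1 : K ⊆ (T.erase p).erase q := fun z hz => by
      simp only [Finset.mem_erase]
      exact ⟨fun e => hqK (e ▸ hz), fun e => hpK (e ▸ hz), hKT hz⟩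
    have h2 := Finset.card_le_card h1
    rw [Finset.card_erase_of_mem (by simp [hq, hpq.symm]), Finset.card_erase_of_mem hp] at h2
    omega
  have ho₂' : o₂ ∉ insert o₁ K := by simp [hoo.ne', ho₂]
  have hKc' : K.card + 2 = k := by
    by_contra hne
    obtain ⟨S, hS, -, hSc⟩ := Finset.exists_subsuperset_card_eq
      (s := insert o₂ (insert o₁ K)) (n := k - 1) (Finset.subset_univ _)
      (by rw [Finset.card_insert_of_notMem ho₂', Finset.card_insert_of_notMem ho₁]; omega)
      (by rw [Finset.card_univ, h.card_univ]; omega)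
    have h1 := degSum_mono (G := G) hS
    have h2 := h.degSum_le hT (S := S) (by omega)
    rw [degSum_insert ho₂', degSum_insert ho₁, degIn_insert ho₁, adjInd_eq_one.2 hoo.symm] at h1
    have h3 := degIn_nonneg (G := G) K o₁
    have h4 := degIn_nonneg (G := G) K o₂
    linarith
  -- every vertex of `K` has a private leaf
  have hleaf : ∀ s ∈ K, ∃ w ∈ K, G.Adj w s ∧ degIn G K w = 1 := by
    intro s hs
    have h1 : o₁ ∉ K.erase s := fun e => ho₁ (Finset.mem_of_mem_erase e)
    have h2 : o₂ ∉ insert o₁ (K.erase s) := by simp [hoo.ne', ho₂]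
    obtain ⟨v, hv, hF⟩ := h.exists_insert (insert o₂ (insert o₁ (K.erase s))) (by
      rw [Finset.card_insert_of_notMem h2, Finset.card_insert_of_notMem h1,
        Finset.card_erase_of_mem hs]
      have := Finset.card_pos.2 ⟨s, hs⟩
      omega) h.le_card
    obtain ⟨f, hf, -, hdeg⟩ := h.exists_iso hT hF
    obtain ⟨w, hw, hwv, hwd⟩ : ∃ w ∈ insert v (insert o₂ (insert o₁ (K.erase s))), w ≠ v ∧
        degIn G (insert v (insert o₂ (insert o₁ (K.erase s)))) w = 0 := by
      by_cases hfp : f p = v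
      · exact ⟨f q, hf.mapsTo hq, fun e => hpq (hf.injOn hp hq (hfp.trans e.symm)),
          by rw [hdeg q hq, hqd]⟩
      · exact ⟨f p, hf.mapsTo hp, hfp, by rw [hdeg p hp, hpd]⟩
    rw [degIn_eq_zero] at hwd
    simp only [Finset.mem_insert, Finset.mem_erase] at hw hwd
    rcases hw with hw | rfl | rfl | ⟨hws, hwK⟩
    · exact absurd hw hwv
    · exact absurd hoo.symm (hwd o₁ (by tauto))
    · exact absurd hoo (hwd o₂ (by tauto))
    · have h3 : degIn G (K.erase s) w = 0 := degIn_eq_zero.2 fun z hz =>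
        hwd z (by simp only [Finset.mem_erase] at hz; tauto)
      rw [degIn_erase hs] at h3
      have h4 := hKpos w hwK
      have h5 := adjInd_le_one (G := G) w s
      exact ⟨w, hwK, adjInd_eq_one.1 (by omega), by omega⟩
  have hone : ∀ y ∈ K, degIn G K y = 1 := by
    choose! f hf using hleaf
    have hinj : Set.InjOn f K := by
      intro s hs t ht hst
      exact eq_of_degIn_le_one (hf s hs).2.2.le hs ht (hf s hs).2.1 (hst ▸ (hf t ht).2.1)
    have himg : K.image f = K := Finset.eq_of_subset_of_card_le
      (fun y hy => by
        obtain ⟨s, hs, rfl⟩ := Finset.mem_image.1 hy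
        exact (hf s hs).1)
      (by rw [Finset.card_image_of_injOn hinj])
    intro y hy
    rw [← himg] at hy
    obtain ⟨s, hs, rfl⟩ := Finset.mem_image.1 hy
    exact (hf s hs).2.2
  have hTle : ∀ y ∈ T, degIn G T y ≤ 1 := fun y hy => by
    by_cases hyK : y ∈ K
    · rw [hdegK y hyK T hKT, hone y hyK]
    · have : degIn G T y = 0 := by by_contra hne; exact hyK (hmemK.2 ⟨hy, hne⟩)
      omega
  have hG : ∀ v, degIn G Finset.univ v ≤ (1 : ℕ) := h.degIn_univ_le h.le_card
    (fun T' hT' y hy => by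
      obtain ⟨z, hz, hd⟩ := h.exists_deg hT' hT hy
      rw [← hd]; exact_mod_cast hTle z hz) (by omega)
  have hmate : ∀ {v y z : W}, G.Adj v y → G.Adj v z → y = z := fun {v y z} h1 h2 =>
    eq_of_degIn_le_one (by exact_mod_cast hG v) (Finset.mem_univ y) (Finset.mem_univ z) h1 h2
  have hkeven : Even k := by
    have h1 := even_degSum (G := G) K
    unfold degSum at h1
    rw [Finset.sum_congr rfl hone, Finset.sum_const, nsmul_eq_mul, mul_one, Int.even_coe_nat] at h1
    rw [← hKc']
    exact h1.add even_two
  refine ⟨?_, hkeven⟩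
  by_contra hm2
  by_cases hK3 : 3 ≤ K.card
  · obtain ⟨s, hs⟩ := Finset.card_pos.1 (show 0 < ((K.erase x).erase x').card by
      rw [Finset.card_erase_of_mem (by simp [hxx.ne', hx'K]), Finset.card_erase_of_mem hxK]; omega)
    simp only [Finset.mem_erase] at hs
    obtain ⟨hsx', hsx, hsK⟩ := hs
    have hxs : ¬ G.Adj x s := fun e => hsx' (hmate e hxx)
    -- Exchange at a vertex of maximum degree gives each outer vertex a neighbour in `T`,
    -- necessarily `p` or `q`. Each of these has at most one neighbour, so there are at most two
    -- outer vertices.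
    have hsub : Tᶜ ⊆ Finset.univ.filter (G.Adj p) ∪ Finset.univ.filter (G.Adj q) := by
      intro y hy
      rw [Finset.mem_compl] at hy
      have h1 := h.le_swap_of_max h.le_card hT hx (fun z hz => by
        rw [hdegK x hxK T hKT, hone x hxK]; exact hTle z hz) (hKT hsK) hsx.symm hy
      rw [hdegK s hsK T hKT, hone s hsK, adjInd_eq_zero.2 hxs] at h1
      obtain ⟨z, hz, hyz⟩ := degIn_pos.1 (show 0 < degIn G T y by
        linarith [adjInd_nonneg (G := G) y x, adjInd_nonneg (G := G) y s])
      have hzK : z ∉ K := fun e => hy (hKT (hclosed z e y hyz.symm))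
      have hzpq : z = p ∨ z = q := by
        by_contra! hne
        have h2 : insert z (insert p (insert q K)) ⊆ T := by
          intro w hw
          simp only [Finset.mem_insert] at hw
          rcases hw with rfl | rfl | rfl | hw
          · exact hz
          · exact hp
          · exact hq
          · exact hKT hw
        have h3 := Finset.card_le_card h2
        rw [Finset.card_insert_of_notMem (by simp [hne, hzK]),
          Finset.card_insert_of_notMem (by simp [hpq, hpK]), Finset.card_insert_of_notMem hqK] at h3
        omega
      simp only [Finset.mem_union, Finset.mem_filter, Finset.mem_univ, true_and]
      rcases hzpq with rfl | rfl
      · exact .inl hyz.symm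
      · exact .inr hyz.symm
    have h1 := (Finset.card_le_card hsub).trans (Finset.card_union_le _ _)
    have h2 := hG p
    have h3 := hG q
    rw [degIn_eq_card] at h2 h3
    rw [card_compl_member h.toRainbowFamily h.card_univ hT] at h1
    omega
  · have hKxx : K = {x, x'} := (Finset.eq_of_subset_of_card_le
      (by intro w; simp; rintro (rfl | rfl) <;> assumption) (by rw [Finset.card_pair hxx.ne]; omega)).symm
    have hk4 : k = 4 := by rw [hKxx, Finset.card_pair hxx.ne] at hKc'; omega
    have ho₁x : o₁ ≠ x ∧ o₁ ≠ x' := by simpa [hKxx] using ho₁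
    have ho₂x : o₂ ≠ x ∧ o₂ ≠ x' := by simpa [hKxx] using ho₂
    have hc4 : ({x, x', o₁, o₂} : Finset W).card ≤ 4 := Finset.card_le_four
    obtain ⟨o₃, ho₃⟩ := Finset.card_pos.1 (show 0 < ({x, x', o₁, o₂} : Finset W)ᶜ.card by
      rw [Finset.card_compl, h.card_univ]; omega)
    have hN : (Finset.univ.filter (G.Adj o₃)).card ≤ 1 := by
      have := hG o₃
      rw [degIn_eq_card] at this
      exact_mod_cast this
    obtain ⟨o₄, ho₄⟩ := Finset.card_pos.1 (show 0 < ((({x, x', o₁, o₂} : Finset W)ᶜ.erase o₃) \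
        Finset.univ.filter (G.Adj o₃)).card by
      have h1 := Finset.le_card_sdiff (Finset.univ.filter (G.Adj o₃))
        (({x, x', o₁, o₂} : Finset W)ᶜ.erase o₃)
      rw [Finset.card_erase_of_mem ho₃, Finset.card_compl, h.card_univ] at h1
      omega)
    simp only [Finset.mem_sdiff, Finset.mem_erase, Finset.mem_compl, Finset.mem_insert,
      Finset.mem_singleton, Finset.mem_filter, Finset.mem_univ, true_and, not_or] at ho₃ ho₄
    obtain ⟨h31, h32, h33, h34⟩ := ho₃
    obtain ⟨⟨h43, h41, h42, h44, h45⟩, h46⟩ := ho₄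
    -- For `k = 4`, all edges of `G` are monochromatic under this colouring, so a rainbow set
    -- contains no edge, although members do. Having at least seven vertices makes the fourth class
    -- nonempty.
    let c : W → Fin 4 := fun w => if w = x ∨ w = x' then 0 else if w = o₁ ∨ w = o₂ then 1
      else if w = o₃ ∨ G.Adj o₃ w then 2 else 3
    obtain ⟨T', hT', -, hinj⟩ := h.exists_superset (r := 4) ∅ (by simp [hk4]) c (by
      intro i
      fin_cases i
      · exact ⟨x, by simp, by simp [c]⟩
      · exact ⟨o₁, by simp, by simp [c, ho₁x]⟩
      · exact ⟨o₃, by simp, by simp [c, h31, h32, h33, h34]⟩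
      · exact ⟨o₄, by simp, by simp [c, h41, h42, h43, h44, h45, h46]⟩)
    obtain ⟨y, hy, z, hz, hyz⟩ := h.exists_adj hT'
    refine hyz.ne (hinj (by simpa using hy) (by simpa using hz) ?_)
    have hx1 : ∀ {w}, G.Adj x w ↔ w = x' := fun {w} => ⟨fun e => hmate e hxx, fun e => e ▸ hxx⟩
    have hx2 : ∀ {w}, G.Adj x' w ↔ w = x :=
      fun {w} => ⟨fun e => hmate e hxx.symm, fun e => e ▸ hxx.symm⟩
    have ho1 : ∀ {w}, G.Adj o₁ w ↔ w = o₂ := fun {w} => ⟨fun e => hmate e hoo, fun e => e ▸ hoo⟩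
    have ho2 : ∀ {w}, G.Adj o₂ w ↔ w = o₁ :=
      fun {w} => ⟨fun e => hmate e hoo.symm, fun e => e ▸ hoo.symm⟩
    have hA : ∀ {y z}, G.Adj y z → (y = x ∨ y = x') → (z = x ∨ z = x') := by
      rintro y z e (rfl | rfl)
      · exact .inr (hx1.1 e)
      · exact .inl (hx2.1 e)
    have hB : ∀ {y z}, G.Adj y z → (y = o₁ ∨ y = o₂) → (z = o₁ ∨ z = o₂) := by
      rintro y z e (rfl | rfl)
      · exact .inr (ho1.1 e)
      · exact .inl (ho2.1 e)
    have hC : ∀ {y z}, G.Adj y z → (y = o₃ ∨ G.Adj o₃ y) → (z = o₃ ∨ G.Adj o₃ z) := by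
      rintro y z e (rfl | e')
      · exact .inr e
      · exact .inl (hmate e e'.symm)
    have eA : (y = x ∨ y = x') ↔ (z = x ∨ z = x') := ⟨hA hyz, hA hyz.symm⟩
    have eB : (y = o₁ ∨ y = o₂) ↔ (z = o₁ ∨ z = o₂) := ⟨hB hyz, hB hyz.symm⟩
    have eC : (y = o₃ ∨ G.Adj o₃ y) ↔ (z = o₃ ∨ G.Adj o₃ z) := ⟨hC hyz, hC hyz.symm⟩
    simp only [c, eA, eB, eC]

/-- Not all members consist of an isolated vertex of `G` and a set without isolated vertices. -/
theorem exists_isolated_not_isolated (h : ProperFamily G k m F)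
    (huniq : ∀ T ∈ F, ∃ p ∈ T, degIn G T p = 0 ∧ ∀ q ∈ T, degIn G T q = 0 → q = p) :
    ∃ T ∈ F, ∃ p ∈ T, degIn G T p = 0 ∧ 0 < degIn G Finset.univ p := by
  by_contra! hcon
  have hk := h.four_le
  have hm := h.two_le
  have hiso : ∀ T ∈ F, ∃ p ∈ T, degIn G Finset.univ p = 0 := fun T hT => by
    obtain ⟨p, hp, hpd, -⟩ := huniq T hT
    exact ⟨p, hp, le_antisymm (hcon T hT p hp hpd) (degIn_nonneg _ _)⟩
  have hz : ∀ {v : W}, degIn G Finset.univ v = 0 → ∀ S : Finset W, degIn G S v = 0 :=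
    fun {v} hv S => le_antisymm (hv ▸ degIn_mono (Finset.subset_univ S) v) (degIn_nonneg _ _)
  obtain ⟨T₀, hT₀⟩ := h.mem_nonempty
  obtain ⟨v₀, hv₀T, hv₀⟩ := hiso T₀ hT₀
  have hv₀uniq : ∀ v, degIn G Finset.univ v = 0 → v = v₀ := by
    intro v hv
    by_contra hne
    obtain ⟨S, hS, -, hSc⟩ := Finset.exists_subsuperset_card_eq (s := {v, v₀}) (n := k - 1)
      (Finset.subset_univ _) (by rw [Finset.card_pair hne]; omega)
      (by rw [Finset.card_univ, h.card_univ]; omega)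
    obtain ⟨w, hw, hF⟩ := h.exists_insert S (by omega) h.le_card
    obtain ⟨p, -, -, hp⟩ := huniq _ hF
    exact hne ((hp v (by simp [hS (show v ∈ {v, v₀} by simp)]) (hz hv _)).trans
      (hp v₀ (by simp [hS (show v₀ ∈ ({v, v₀} : Finset W) by simp)]) (hz hv₀ _)).symm)
  -- Every member contains the only isolated vertex `v₀` of `G`, so all `(k-1)`-sets avoiding it
  -- induce isomorphic graphs.
  have hmem : ∀ S : Finset W, S.card + 1 = k → v₀ ∉ S → insert v₀ S ∈ F := by
    intro S hS hv
    obtain ⟨w, hw, hF⟩ := h.exists_insert S hS h.le_card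
    obtain ⟨p, hp, hpd⟩ := hiso _ hF
    rw [hv₀uniq p hpd] at hp
    rcases Finset.mem_insert.1 hp with e | e
    · rwa [e]
    · exact absurd e hv
  have hsum : ∀ S : Finset W, S.card + 1 = k → v₀ ∉ S → degSum G S = degSum G T₀ := by
    intro S hS hv
    rw [← h.degSum_eq (hmem S hS hv) hT₀, degSum_insert hv, hz hv₀]; ring
  have hswap : ∀ S : Finset W, S.card + 1 = k → v₀ ∉ S → ∀ x ∈ S, ∀ y, y ∉ S → y ≠ v₀ →
      degIn G S y - adjInd G y x = degIn G S x := by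
    intro S hS hv x hx y hy hyv
    have hy' : y ∉ S.erase x := fun e => hy (Finset.mem_of_mem_erase e)
    have h1 := hsum (insert y (S.erase x))
      (by rw [Finset.card_insert_of_notMem hy', Finset.card_erase_add_one hx]; exact hS)
      (by simp [hyv.symm, hv])
    rw [degSum_insert hy', degSum_erase hx, degIn_erase hx, hsum S hS hv] at h1
    linarith
  -- the graph without `v₀` is complete or empty
  have hdist : ∀ a b c, a ≠ v₀ → b ≠ v₀ → c ≠ v₀ → G.Adj a b → ¬ G.Adj a c → a ≠ c → False := by
    intro a b c ha hb hc hab hac hanc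
    have hbc : b ≠ c := by rintro rfl; exact hac hab
    have key : ∀ y, y ≠ v₀ → y ≠ b → y ≠ c → ∃ S : Finset W, S.card + 1 = k ∧ b ∈ S ∧ c ∈ S ∧
        v₀ ∉ S ∧ a ∉ S ∧ y ∉ S := by
      intro y hyv hyb hyc
      obtain ⟨S, hS, hS', hSc⟩ := Finset.exists_subsuperset_card_eq (s := {b, c})
        (t := {v₀, a, y}ᶜ) (n := k - 1)
        (by intro w; simp; rintro (rfl | rfl) <;> simp [*, hab.ne', hanc.symm, hyb.symm, hyc.symm])
        (by rw [Finset.card_pair hbc]; omega)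
        (by
          have := Finset.card_le_three (a := v₀) (b := a) (c := y)
          rw [Finset.card_compl, h.card_univ]; omega)
      refine ⟨S, by omega, hS (by simp), hS (by simp), ?_⟩
      refine ⟨fun e => ?_, fun e => ?_, fun e => ?_⟩ <;> simpa using hS' e
    have hrest : ∀ y, y ≠ v₀ → y ≠ b → y ≠ c → adjInd G y b - adjInd G y c = 1 := by
      intro y hyv hyb hyc
      obtain ⟨S, hSc, hbS, hcS, hvS, haS, hyS⟩ := key y hyv hyb hyc
      have h1 := hswap S hSc hvS b hbS a haS ha
      have h2 := hswap S hSc hvS c hcS a haS ha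
      have h3 := hswap S hSc hvS b hbS y hyS hyv
      have h4 := hswap S hSc hvS c hcS y hyS hyv
      rw [adjInd_eq_one.2 hab] at h1
      rw [adjInd_eq_zero.2 hac] at h2
      linarith
    -- Seen from `a`, the degree of `b` in `S` is one less than that of `c`; yet by `hrest` every
    -- other vertex of `S` is joined to `b` and not to `c`.
    obtain ⟨S, hSc, hbS, hcS, hvS, haS, -⟩ := key a ha hab.ne hanc
    have h1 := hswap S hSc hvS b hbS a haS ha
    have h2 := hswap S hSc hvS c hcS a haS ha
    rw [adjInd_eq_one.2 hab] at h1
    rw [adjInd_eq_zero.2 hac] at h2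
    have hcS' : c ∈ S.erase b := by simp [hbc.symm, hcS]
    have h3 : degIn G ((S.erase b).erase c) b - degIn G ((S.erase b).erase c) c =
        ((S.erase b).erase c).card := by
      unfold degIn
      rw [← Finset.sum_sub_distrib, Finset.sum_congr rfl fun y hy => ?_, Finset.sum_const,
        nsmul_eq_mul, mul_one]
      simp only [Finset.mem_erase] at hy
      rw [adjInd_comm b, adjInd_comm c]
      exact hrest y (fun e => hvS (e ▸ hy.2.2)) hy.2.1 hy.1
    rw [degIn_erase hcS', degIn_erase hcS', degIn_erase hbS, degIn_erase hbS, adjInd_comm c b,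
      adjInd_self, adjInd_self] at h3
    have h4 := Finset.card_erase_add_one hcS'
    have h5 := Finset.card_erase_add_one hbS
    omega
  obtain ⟨S, hS, hSc⟩ := Finset.exists_subset_card_eq (s := (Finset.univ : Finset W).erase v₀)
    (n := k - 1) (by
      rw [Finset.card_erase_of_mem (Finset.mem_univ _), Finset.card_univ, h.card_univ]
      omega)
  have hv₀S : v₀ ∉ S := fun e => by simpa using hS e
  have hF := hmem S (by omega) hv₀S
  have hSv : ∀ {x}, x ∈ S → x ≠ v₀ := fun {x} hx e => hv₀S (e ▸ hx)
  obtain ⟨x, hx, y, hy, hxy⟩ := h.exists_adj hF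
  have hnv : ∀ z, ¬ G.Adj v₀ z := fun z => degIn_eq_zero.1 hv₀ z (Finset.mem_univ z)
  have hxv : x ≠ v₀ := by rintro rfl; exact hnv y hxy
  have hyv : y ≠ v₀ := by rintro rfl; exact hnv x hxy.symm
  have hcomplete : ∀ a b, a ≠ v₀ → b ≠ v₀ → a ≠ b → G.Adj a b := by
    intro a b ha hb hab
    by_contra hn
    have hxa : x ≠ a → G.Adj x a := fun hne => by
      by_contra hn'
      exact hdist x y a hxv hyv ha hxy hn' hne
    by_cases hxa' : x = a
    · subst hxa'; exact hdist x y b hxv hyv hb hxy hn hab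
    · exact hdist a x b ha hxv hb (hxa hxa').symm hn hab
  refine h.compl.not_star hF (r := v₀) (by simp) ?_ ?_
  · intro z hz hzv
    simp [hzv.symm, hnv]
  · intro z hz w hw hzv hwv hadj
    rw [SimpleGraph.compl_adj] at hadj
    exact hadj.2 (hcomplete z w hzv hwv hadj.1)

end ProperFamily

end

/-! ### A unique isolated vertex: exchanges with the base -/

section

open scoped Classical

variable {W : Type*} [Fintype W] {G : SimpleGraph W} {k m : ℕ} {F : Set (Finset W)}

/-- A member `B ∪ {u}` in which `u` is isolated, for a family whose members have at most one
isolated vertex. -/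
structure IsolatedVertex (G : SimpleGraph W) (k m : ℕ) (F : Set (Finset W)) (B : Finset W)
    (u : W) : Prop extends ProperFamily G k m F where
  unique : ∀ T ∈ F, ∀ x ∈ T, ∀ y ∈ T, degIn G T x = 0 → degIn G T y = 0 → x = y
  card_base : B.card + 1 = k
  notMem : u ∉ B
  not_adj : ∀ s ∈ B, ¬ G.Adj u s
  mem : insert u B ∈ F

namespace IsolatedVertex

variable {B : Finset W} {u a s s₁ s₂ : W}

theorem degIn_base (h : IsolatedVertex G k m F B u) : degIn G B u = 0 :=
  degIn_eq_zero.2 h.not_adj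

theorem degIn_member (h : IsolatedVertex G k m F B u) (hs : s ∈ B) :
    degIn G (insert u B) s = degIn G B s := by
  rw [degIn_insert h.notMem, adjInd_eq_zero.2 fun e => h.not_adj s hs e.symm, zero_add]

theorem degIn_member_self (h : IsolatedVertex G k m F B u) : degIn G (insert u B) u = 0 := by
  rw [degIn_insert h.notMem, adjInd_self, h.degIn_base, zero_add]

theorem degSum_member (h : IsolatedVertex G k m F B u) :
    degSum G (insert u B) = degSum G B := by
  rw [degSum_insert h.notMem, h.degIn_base]; ring

theorem one_le (h : IsolatedVertex G k m F B u) (hs : s ∈ B) : 1 ≤ degIn G B s := by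
  by_contra! hlt
  have h0 : degIn G B s = 0 := by have := degIn_nonneg (G := G) B s; omega
  have := h.unique _ h.mem s (by simp [hs]) u (by simp) (by rw [h.degIn_member hs, h0])
    h.degIn_member_self
  exact h.notMem (this ▸ hs)

theorem exists_nbr (h : IsolatedVertex G k m F B u) (hs : s ∈ B) : ∃ r ∈ B, G.Adj s r :=
  degIn_pos.1 (h.one_le hs)

/-- Three vertices without an isolated one form a path or a triangle, and adding `u` gives `P₃ + K₁`
or the complement of a star. -/
theorem five_le (h : IsolatedVertex G k m F B u) : 5 ≤ k := by
  by_contra! hlt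
  have hk := h.four_le
  have hBc := h.card_base
  obtain ⟨x, y, z, hxy, hxz, hyz, hB⟩ := Finset.card_eq_three.1 (show B.card = 3 by omega)
  have hx : x ∈ B := by simp [hB]
  have hy : y ∈ B := by simp [hB]
  have hz : z ∈ B := by simp [hB]
  have hux : u ≠ x := by rintro rfl; exact h.notMem hx
  have huy : u ≠ y := by rintro rfl; exact h.notMem hy
  have huz : u ≠ z := by rintro rfl; exact h.notMem hz
  have path : ∀ {p q r : W}, B = {p, q, r} → p ≠ q → p ≠ r → q ≠ r → G.Adj p q → G.Adj q r →
      ¬ G.Adj p r → False := by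
    intro p q r hB hpq hpr hqr h1 h2 h3
    have hp : p ∈ B := by simp [hB]
    have hq : q ∈ B := by simp [hB]
    have hr : r ∈ B := by simp [hB]
    refine h.not_exceptional _ h.mem (.inr (.inr ⟨p, q, r, u, ?_, hpq, hpr, ?_, hqr, ?_, ?_, h1,
      h2, h3, fun e => h.not_adj p hp e.symm, fun e => h.not_adj q hq e.symm,
      fun e => h.not_adj r hr e.symm⟩))
    · rw [hB]; ext; simp; tauto
    · rintro rfl; exact h.notMem hp
    · rintro rfl; exact h.notMem hq
    · rintro rfl; exact h.notMem hr
  have d : ∀ w, degIn G B w = adjInd G w x + (adjInd G w y + adjInd G w z) := by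
    intro w
    rw [hB, degIn_insert (by simp [hxy, hxz]), degIn_insert (by simp [hyz])]
    simp [degIn]
  have dx := h.one_le hx
  have dy := h.one_le hy
  have dz := h.one_le hz
  rw [d] at dx dy dz
  simp only [adjInd_self] at dx dy dz
  rw [adjInd_comm y x] at dy
  rw [adjInd_comm z x, adjInd_comm z y] at dz
  by_cases h1 : G.Adj x y <;> by_cases h2 : G.Adj x z <;> by_cases h3 : G.Adj y z
  · refine h.compl.not_star h.mem (r := u) (by simp) ?_ ?_
    · intro w hw hwu
      rw [SimpleGraph.compl_adj]
      exact ⟨hwu.symm, h.not_adj w ((Finset.mem_insert.1 hw).resolve_left hwu)⟩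
    · intro w hw w' hw' hwu hwu' hadj
      rw [SimpleGraph.compl_adj] at hadj
      have e1 := (Finset.mem_insert.1 hw).resolve_left hwu
      have e2 := (Finset.mem_insert.1 hw').resolve_left hwu'
      simp only [hB, Finset.mem_insert, Finset.mem_singleton] at e1 e2
      rcases e1 with rfl | rfl | rfl <;> rcases e2 with rfl | rfl | rfl <;>
        simp_all [G.adj_comm]
  · exact path (p := y) (q := x) (r := z) (by rw [hB]; ext; simp; tauto) hxy.symm hyz hxz h1.symm h2 h3
  · exact path hB hxy hxz hyz h1 h3 h2
  · rw [adjInd_eq_zero.2 h2, adjInd_eq_zero.2 h3] at dz; omega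
  · exact path (p := x) (q := z) (r := y) (by rw [hB]; ext; simp; tauto) hxz hxy hyz.symm h2
      h3.symm h1
  · rw [adjInd_eq_zero.2 h1, adjInd_eq_zero.2 h3] at dy; omega
  · rw [adjInd_eq_zero.2 h1, adjInd_eq_zero.2 h2] at dx; omega
  · rw [adjInd_eq_zero.2 h1, adjInd_eq_zero.2 h2] at dx; omega

/-- A `(k-1)`-set without isolated vertices is isomorphic to the base. -/
theorem exists_iso_base (h : IsolatedVertex G k m F B u) {S : Finset W} (hS : S.card + 1 = k)
    (hpos : ∀ x ∈ S, 1 ≤ degIn G S x) :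
    ∃ f : W → W, Set.BijOn f S B ∧ (∀ x ∈ S, ∀ y ∈ S, (G.Adj (f x) (f y) ↔ G.Adj x y)) ∧
      ∀ x ∈ S, degIn G B (f x) = degIn G S x := by
  obtain ⟨v, hv, hF⟩ := h.exists_insert S hS h.le_card
  obtain ⟨f, hf, hadj, hdeg⟩ := h.exists_iso hF h.mem
  -- The extended set has an isolated vertex, and it cannot lie in `S`; so it is the added vertex,
  -- and the isomorphism of members restricts to `S` and `B`.
  have hfv : f v = u := by
    obtain ⟨x, hx, hxu⟩ := hf.surjOn (show u ∈ ((insert u B : Finset W) : Set W) by simp)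
    have h1 := hdeg x hx
    rw [hxu, h.degIn_member_self] at h1
    rcases Finset.mem_insert.1 hx with rfl | hxS
    · exact hxu
    · have := hpos x hxS
      have := degIn_mono (G := G) (Finset.subset_insert v S) x
      omega
  have hmaps : ∀ x ∈ S, f x ∈ B := fun x hx => by
    refine (Finset.mem_insert.1 (hf.mapsTo (show x ∈ insert v S by simp [hx]))).resolve_left ?_
    intro e
    exact hv (hf.injOn (by simp [hx]) (by simp) (e.trans hfv.symm) ▸ hx)
  have hvadj : ∀ x ∈ S, adjInd G x v = 0 := fun x hx => adjInd_eq_zero.2 fun e => by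
    have := (hadj x (by simp [hx]) v (by simp)).2 e
    rw [hfv] at this
    exact h.not_adj _ (hmaps x hx) this.symm
  refine ⟨f, ⟨hmaps, ?_, ?_⟩, ?_, ?_⟩
  · intro x hx y hy e
    exact hf.injOn (Finset.mem_insert_of_mem hx) (Finset.mem_insert_of_mem hy) e
  · intro y hy
    obtain ⟨x, hx, rfl⟩ := hf.surjOn (show y ∈ ((insert u B : Finset W) : Set W) by
      simpa using Or.inr hy)
    rcases Finset.mem_insert.1 hx with rfl | hxS
    · exact absurd (hfv ▸ hy) h.notMem
    · exact ⟨x, hxS, rfl⟩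
  · intro x hx y hy
    exact hadj x (by simp [hx]) y (by simp [hy])
  · intro x hx
    have := hdeg x (by simp [hx])
    rwa [h.degIn_member (hmaps x hx), degIn_insert hv, hvadj x hx, zero_add] at this

theorem sum_eq_base (h : IsolatedVertex G k m F B u) {S : Finset W} (hS : S.card + 1 = k)
    (hpos : ∀ x ∈ S, 1 ≤ degIn G S x) (φ : ℤ → ℤ) :
    ∑ x ∈ S, φ (degIn G S x) = ∑ x ∈ B, φ (degIn G B x) := by
  obtain ⟨f, hf, -, hdeg⟩ := h.exists_iso_base hS hpos
  exact Finset.sum_bij (fun x _ => f x) (fun x hx => hf.mapsTo hx)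
    (fun x hx y hy e => hf.injOn hx hy e)
    (fun y hy => by obtain ⟨x, hx, rfl⟩ := hf.surjOn hy; exact ⟨x, hx, rfl⟩)
    (fun x hx => by rw [hdeg x hx])

theorem degSum_eq_base (h : IsolatedVertex G k m F B u) {S : Finset W} (hS : S.card + 1 = k)
    (hpos : ∀ x ∈ S, 1 ≤ degIn G S x) : degSum G S = degSum G B :=
  h.sum_eq_base hS hpos id

theorem exchange (h : IsolatedVertex G k m F B u) {y : W} (hy : y ∉ B) (hyu : y ≠ u)
    (hs : s ∈ B) : degIn G B y - adjInd G y s ≤ degIn G B s := by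
  have h1 := h.swap_le_of_min h.le_card h.mem (p := u) (s := s) (y := y) (by simp)
    (fun x _ => by rw [h.degIn_member_self]; exact degIn_nonneg _ _) (by simp [hs])
    (fun e => h.notMem (e ▸ hs)) (by simp [hy, hyu])
  rw [degIn_insert h.notMem, h.degIn_member hs, adjInd_eq_zero.2 (h.not_adj s hs)] at h1
  linarith

/-- Replacing a vertex of the base by `a`. -/
theorem degIn_swap {W : Type*} {G : SimpleGraph W} {B : Finset W} {a s : W} (ha : a ∉ B) (hs : s ∈ B) (x : W) :
    degIn G (insert a (B.erase s)) x = adjInd G x a + (degIn G B x - adjInd G x s) := by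
  rw [degIn_insert (fun e => ha (Finset.mem_of_mem_erase e)), degIn_erase hs]

theorem card_swap (h : IsolatedVertex G k m F B u) (ha : a ∉ B) (hs : s ∈ B) :
    (insert a (B.erase s)).card + 1 = k := by
  rw [Finset.card_insert_of_notMem (fun e => ha (Finset.mem_of_mem_erase e)),
    Finset.card_erase_add_one hs, h.card_base]

theorem swap_pos {W : Type*} {G : SimpleGraph W} {B : Finset W} {a s : W} (ha : a ∉ B) (hs : s ∈ B) (h1 : 1 ≤ degIn G B a - adjInd G a s)
    (h2 : ∀ x ∈ B, x ≠ s → 1 ≤ degIn G B x - adjInd G x s + adjInd G x a) :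
    ∀ x ∈ insert a (B.erase s), 1 ≤ degIn G (insert a (B.erase s)) x := by
  intro x hx
  rw [degIn_swap ha hs]
  simp only [Finset.mem_insert, Finset.mem_erase] at hx
  rcases hx with rfl | ⟨hxs, hx⟩
  · rw [adjInd_self]; linarith
  · linarith [h2 x hx hxs]

/-- The hypotheses ensure that `B - s + a` has no isolated vertex, so it has as many edges as `B`.
-/
theorem degIn_of_swap (h : IsolatedVertex G k m F B u) (ha : a ∉ B) (hs : s ∈ B)
    (h1 : 1 ≤ degIn G B a - adjInd G a s)
    (h2 : ∀ x ∈ B, x ≠ s → 1 ≤ degIn G B x - adjInd G x s + adjInd G x a) :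
    degIn G B s = degIn G B a - adjInd G a s := by
  have h3 := h.degSum_eq_base (h.card_swap ha hs) (swap_pos ha hs h1 h2)
  rw [degSum_insert (fun e => ha (Finset.mem_of_mem_erase e)), degSum_erase hs,
    degIn_erase hs] at h3
  linarith

/-- The base with two vertices replaced by `u` and a neighbour `a` of `u`. -/
theorem degIn_swap_two (h : IsolatedVertex G k m F B u) (ha : a ∉ B) (hua : G.Adj u a)
    (hs₁ : s₁ ∈ B) (hs₂ : s₂ ∈ B) (hne : s₁ ≠ s₂) (x : W) :
    degIn G (insert u (insert a ((B.erase s₁).erase s₂))) x =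
      adjInd G x u + (adjInd G x a + (degIn G B x - adjInd G x s₁ - adjInd G x s₂)) := by
  have h1 : s₂ ∈ B.erase s₁ := by simp [hne.symm, hs₂]
  rw [degIn_insert, degIn_insert, degIn_erase h1, degIn_erase hs₁]
  · simp [ha]
  · simp [hua.ne, h.notMem]

theorem card_swap_two (h : IsolatedVertex G k m F B u) (ha : a ∉ B) (hua : G.Adj u a)
    (hs₁ : s₁ ∈ B) (hs₂ : s₂ ∈ B) (hne : s₁ ≠ s₂) :
    (insert u (insert a ((B.erase s₁).erase s₂))).card + 1 = k := by
  have h1 : s₂ ∈ B.erase s₁ := by simp [hne.symm, hs₂]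
  rw [Finset.card_insert_of_notMem, Finset.card_insert_of_notMem, Finset.card_erase_add_one h1,
    Finset.card_erase_add_one hs₁, h.card_base]
  · simp [ha]
  · simp [hua.ne, h.notMem]

theorem degSum_swap_two (h : IsolatedVertex G k m F B u) (ha : a ∉ B) (hua : G.Adj u a)
    (hs₁ : s₁ ∈ B) (hs₂ : s₂ ∈ B) (hne : s₁ ≠ s₂) :
    degSum G (insert u (insert a ((B.erase s₁).erase s₂))) = degSum G B -
      2 * (degIn G B s₁ + degIn G B s₂ - adjInd G s₁ s₂) +
      2 * (1 + degIn G B a - adjInd G a s₁ - adjInd G a s₂) := by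
  have h1 : s₂ ∈ B.erase s₁ := by simp [hne.symm, hs₂]
  have h2 : a ∉ (B.erase s₁).erase s₂ := by simp [ha]
  rw [degSum_insert (by simp [hua.ne, h.notMem]), degSum_insert h2, degSum_erase h1,
    degSum_erase hs₁, degIn_insert h2, degIn_erase h1, degIn_erase h1, degIn_erase hs₁,
    degIn_erase hs₁, degIn_erase hs₁, h.degIn_base, adjInd_eq_one.2 hua,
    adjInd_eq_zero.2 (h.not_adj s₁ hs₁), adjInd_eq_zero.2 (h.not_adj s₂ hs₂), adjInd_comm s₂ s₁]
  ring

theorem swap_two_pos (h : IsolatedVertex G k m F B u) (ha : a ∉ B) (hua : G.Adj u a)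
    (hs₁ : s₁ ∈ B) (hs₂ : s₂ ∈ B) (hne : s₁ ≠ s₂)
    (hx : ∀ x ∈ B, x ≠ s₁ → x ≠ s₂ →
      1 ≤ degIn G B x - adjInd G x s₁ - adjInd G x s₂ + adjInd G x a) :
    ∀ x ∈ insert u (insert a ((B.erase s₁).erase s₂)),
      1 ≤ degIn G (insert u (insert a ((B.erase s₁).erase s₂))) x := by
  intro x hxS
  simp only [Finset.mem_insert, Finset.mem_erase] at hxS
  rcases hxS with rfl | rfl | ⟨h2, h1, hxB⟩
  · exact degIn_pos.2 ⟨a, by simp, hua⟩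
  · exact degIn_pos.2 ⟨u, by simp, hua.symm⟩
  · rw [h.degIn_swap_two ha hua hs₁ hs₂ hne,
      adjInd_eq_zero.2 fun e => h.not_adj x hxB e.symm]
    linarith [hx x hxB h1 h2]

theorem degIn_of_swap_two (h : IsolatedVertex G k m F B u) (ha : a ∉ B) (hua : G.Adj u a)
    (hs₁ : s₁ ∈ B) (hs₂ : s₂ ∈ B) (hne : s₁ ≠ s₂)
    (hx : ∀ x ∈ B, x ≠ s₁ → x ≠ s₂ →
      1 ≤ degIn G B x - adjInd G x s₁ - adjInd G x s₂ + adjInd G x a) :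
    degIn G B s₁ + degIn G B s₂ - adjInd G s₁ s₂ =
      1 + degIn G B a - adjInd G a s₁ - adjInd G a s₂ := by
  have h1 := h.degSum_eq_base (h.card_swap_two ha hua hs₁ hs₂ hne)
    (h.swap_two_pos ha hua hs₁ hs₂ hne hx)
  rw [h.degSum_swap_two ha hua hs₁ hs₂ hne] at h1
  linarith

/-- With three neighbours of `a` in `B`, no exchange isolates anything. Single exchanges give `degIn
G B s = degIn G B a - adjInd G a s`, and substituting this into the double exchange gives `degIn G B
a = 1 + adjInd G s₁ s₂`. -/
theorem degIn_base_le_two (h : IsolatedVertex G k m F B u) (ha : a ∉ B) (hua : G.Adj u a) :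
    degIn G B a ≤ 2 := by
  by_contra! hlt
  have hle : ∀ s ∈ B, degIn G B a ≤ degIn G B s + adjInd G s a := fun s hs => by
    have := h.exchange ha hua.ne' hs
    rw [adjInd_comm] at this; linarith
  have h01 := fun x y => adjInd_le_one (G := G) x y
  have hdeg : ∀ s ∈ B, degIn G B s = degIn G B a - adjInd G a s := fun s hs =>
    h.degIn_of_swap ha hs (by linarith [h01 a s]) fun x hx _ => by
      linarith [hle x hx, h01 x s]
  obtain ⟨s₁, s₂, hs₁, hs₂, hne⟩ : ∃ s₁ s₂, s₁ ∈ B ∧ s₂ ∈ B ∧ s₁ ≠ s₂ := by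
    have h1 : 1 < B.card := by have := h.card_base; have := h.four_le; omega
    obtain ⟨s₁, hs₁, s₂, hs₂, hne⟩ := Finset.one_lt_card.1 h1
    exact ⟨s₁, s₂, hs₁, hs₂, hne⟩
  have := h.degIn_of_swap_two ha hua hs₁ hs₂ hne fun x hx _ _ => by
    linarith [hle x hx, h01 x s₁, h01 x s₂]
  rw [hdeg _ hs₁, hdeg _ hs₂] at this
  linarith [h01 s₁ s₂]

/-- Here the neighbours `b`, `b'` of `a` have degree one in `B`, the others degree two, and
nonadjacent vertices of `B` have a common neighbour. As `|B| ≥ 4`, the neighbour of the leaf `b`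
must serve too many pairs at once. -/
theorem degIn_base_ne_two (h : IsolatedVertex G k m F B u) (ha : a ∉ B) (hua : G.Adj u a) :
    degIn G B a ≠ 2 := by
  intro hd
  have h01 := fun x y => adjInd_le_one (G := G) x y
  have h00 := fun x y => adjInd_nonneg (G := G) x y
  have hle : ∀ s ∈ B, 2 ≤ degIn G B s + adjInd G s a := fun s hs => by
    have := h.exchange ha hua.ne' hs
    rw [adjInd_comm] at this; linarith
  have hdeg : ∀ s ∈ B, degIn G B s = 2 - adjInd G a s := fun s hs => by
    rw [← hd]
    exact h.degIn_of_swap ha hs (by linarith [h01 a s]) fun x hx _ => by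
      linarith [hle x hx, h01 x s]
  -- nonadjacent vertices of the base have a common neighbour there
  have hcommon : ∀ s₁ ∈ B, ∀ s₂ ∈ B, s₁ ≠ s₂ → ¬ G.Adj s₁ s₂ →
      ∃ x ∈ B, G.Adj x s₁ ∧ G.Adj x s₂ := by
    intro s₁ hs₁ s₂ hs₂ hne hnadj
    by_contra! hcon
    have := h.degIn_of_swap_two ha hua hs₁ hs₂ hne fun x hx _ _ => by
      have h1 := hle x hx
      by_cases hx1 : G.Adj x s₁
      · rw [adjInd_eq_zero.2 (hcon x hx hx1)]; linarith [h01 x s₁]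
      · rw [adjInd_eq_zero.2 hx1]; linarith [h01 x s₂]
    rw [hdeg _ hs₁, hdeg _ hs₂, hd, adjInd_eq_zero.2 hnadj] at this
    linarith
  have hN : (B.filter (G.Adj a)).card = 2 := by rw [degIn_eq_card] at hd; exact_mod_cast hd
  obtain ⟨b, b', hbb, hNb⟩ := Finset.card_eq_two.1 hN
  have hb : b ∈ B ∧ G.Adj a b := Finset.mem_filter.1 (show b ∈ B.filter (G.Adj a) by simp [hNb])
  have hb' : b' ∈ B ∧ G.Adj a b' :=
    Finset.mem_filter.1 (show b' ∈ B.filter (G.Adj a) by simp [hNb])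
  have hbd : degIn G B b = 1 := by rw [hdeg _ hb.1, adjInd_eq_one.2 hb.2]; rfl
  have hbd' : degIn G B b' = 1 := by rw [hdeg _ hb'.1, adjInd_eq_one.2 hb'.2]; rfl
  obtain ⟨c, hc, hbc⟩ := h.exists_nbr hb.1
  obtain ⟨s, hs⟩ : ∃ s, s ∈ B \ {b, b', c} := by
    refine Finset.card_pos.1 ?_
    have h1 := Finset.le_card_sdiff {b, b', c} B
    have h2 := Finset.card_le_three (a := b) (b := b') (c := c)
    have := h.card_base
    have := h.five_le
    omega
  simp only [Finset.mem_sdiff, Finset.mem_insert, Finset.mem_singleton, not_or] at hs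
  obtain ⟨hsB, hsb, hsb', hsc⟩ := hs
  have hbs : ¬ G.Adj b s := fun e => hsc (eq_of_degIn_le_one hbd.le hsB hc e hbc)
  obtain ⟨x, hx, hxb, hxs⟩ := hcommon b hb.1 s hsB (Ne.symm hsb) hbs
  have hxc : x = c := eq_of_degIn_le_one hbd.le hx hc hxb.symm hbc
  subst hxc
  by_cases hxb' : x = b'
  · subst hxb'
    exact hsb (eq_of_degIn_le_one hbd'.le hsB hb.1 hxs hxb)
  · have hbb' : ¬ G.Adj b b' := fun e => hxb' (eq_of_degIn_le_one hbd.le hx hb'.1 hbc e)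
    obtain ⟨y, hy, hyb, hyb'⟩ := hcommon b hb.1 b' hb'.1 hbb hbb'
    have hyx : y = x := eq_of_degIn_le_one hbd.le hy hx hyb.symm hbc
    subst hyx
    have h1 : ({b, b', s} : Finset W) ⊆ B.filter (G.Adj y) := by
      intro w hw
      simp only [Finset.mem_insert, Finset.mem_singleton] at hw
      rw [Finset.mem_filter]
      rcases hw with rfl | rfl | rfl
      · exact ⟨hb.1, hyb⟩
      · exact ⟨hb'.1, hyb'⟩
      · exact ⟨hsB, hxs⟩
    have h2 := Finset.card_le_card h1
    rw [Finset.card_eq_three.2 ⟨b, b', s, hbb, Ne.symm hsb, Ne.symm hsb', rfl⟩] at h2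
    have h3 := hdeg y hx
    rw [degIn_eq_card] at h3
    have := h00 a y
    omega

end IsolatedVertex

end

/-! ### A tail: its neighbour lies in an isolated edge of the base -/

section

open scoped Classical

/-- Edge counts do not suffice for tails. The sum of squared degrees is a second invariant of sets
isomorphic to the base, and this evaluates its change at one vertex. -/
theorem sum_sq_add_ite {W : Type*} (B : Finset W) (d : W → ℤ) {p : W} (hp : p ∈ B) (c : ℤ) :
    ∑ x ∈ B, (d x + if x = p then c else 0) ^ 2 = ∑ x ∈ B, d x ^ 2 + (2 * c * d p + c ^ 2) := by
  have h1 : ∀ x ∈ B, (d x + if x = p then c else 0) ^ 2 =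
      d x ^ 2 + if x = p then 2 * c * d p + c ^ 2 else 0 := fun x _ => by
    by_cases hx : x = p
    · subst hx; simp; ring
    · simp [hx]
  rw [Finset.sum_congr rfl h1, Finset.sum_add_distrib]
  simp [hp]

theorem adjInd_leaf {W : Type*} {G : SimpleGraph W} {B : Finset W} {l r x : W}
    (hl : degIn G B l = 1) (hr : r ∈ B) (hlr : G.Adj l r) (hx : x ∈ B) :
    adjInd G x l = if x = r then 1 else 0 := by
  by_cases hxr : x = r
  · rw [hxr, adjInd_eq_one.2 hlr.symm, if_pos rfl]
  · rw [if_neg hxr, adjInd_eq_zero]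
    exact fun e => hxr (eq_of_degIn_le_one hl.le hx hr e.symm hlr)

variable {W : Type*} [Fintype W] {G : SimpleGraph W} {k m : ℕ} {F : Set (Finset W)}

/-- A neighbour `a` of the isolated vertex `u` with exactly one neighbour `c` in the base. -/
structure TailVertex (G : SimpleGraph W) (k m : ℕ) (F : Set (Finset W)) (B : Finset W)
    (u a c : W) : Prop extends IsolatedVertex G k m F B u where
  notMem_tail : a ∉ B
  adj_tail : G.Adj u a
  mem_base : c ∈ B
  adj_base : G.Adj a c
  deg_tail : degIn G B a = 1

namespace TailVertex

variable {B : Finset W} {u a c s s₁ s₂ x l r l₁ l₂ r₁ r₂ : W}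

theorem ind (h : TailVertex G k m F B u a c) (hx : x ∈ B) :
    adjInd G x a = if x = c then 1 else 0 :=
  adjInd_leaf h.deg_tail h.mem_base h.adj_base hx

theorem ind' (h : TailVertex G k m F B u a c) (hx : x ∈ B) :
    adjInd G a x = if x = c then 1 else 0 := by rw [adjInd_comm, h.ind hx]

/-- If no leaf hangs on `s`, replacing `s` by `a` isolates nothing, so `s` has the same degree as
`a`, namely one. The vertex `c` is harmless, being joined to `a`. -/
theorem deg_or_exists_leaf (h : TailVertex G k m F B u a c) (hs : s ∈ B) (hsc : s ≠ c) :
    degIn G B s = 1 ∨ ∃ x ∈ B, x ≠ c ∧ degIn G B x = 1 ∧ G.Adj x s := by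
  by_contra! hcon
  obtain ⟨h1, h2⟩ := hcon
  have h3 : adjInd G a s = 0 := by rw [h.ind' hs, if_neg hsc]
  have := h.degIn_of_swap h.notMem_tail hs (by rw [h3, h.deg_tail]; rfl) fun x hx hxs => by
    have h4 := h.one_le hx
    by_cases hadj : G.Adj x s
    · rw [adjInd_eq_one.2 hadj, h.ind hx]
      by_cases hxc : x = c
      · rw [if_pos hxc]; linarith
      · have := h2 x hx hxc
        rw [if_neg hxc]
        by_contra! hlt
        exact this (by omega) hadj
    · rw [adjInd_eq_zero.2 hadj]
      linarith [adjInd_nonneg (G := G) x a]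
  rw [h3, h.deg_tail] at this
  exact h1 this

theorem deg_add (h : TailVertex G k m F B u a c) (hs₁ : s₁ ∈ B) (hs₂ : s₂ ∈ B) (hne : s₁ ≠ s₂)
    (h₁ : s₁ ≠ c) (h₂ : s₂ ≠ c) (hx : ∀ x ∈ B, x ≠ s₁ → x ≠ s₂ →
      1 ≤ degIn G B x - adjInd G x s₁ - adjInd G x s₂ + adjInd G x a) :
    degIn G B s₁ + degIn G B s₂ - adjInd G s₁ s₂ = 2 := by
  rw [h.degIn_of_swap_two h.notMem_tail h.adj_tail hs₁ hs₂ hne hx, h.deg_tail, h.ind' hs₁,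
    h.ind' hs₂, if_neg h₁, if_neg h₂]
  rfl

theorem deg_add_base (h : TailVertex G k m F B u a c) (hs : s ∈ B) (hsc : s ≠ c)
    (hx : ∀ x ∈ B, x ≠ c → x ≠ s → 1 ≤ degIn G B x - adjInd G x c - adjInd G x s) :
    degIn G B c + degIn G B s - adjInd G c s = 1 := by
  rw [h.degIn_of_swap_two h.notMem_tail h.adj_tail h.mem_base hs hsc.symm fun x hxB h1 h2 => by
    linarith [hx x hxB h1 h2, adjInd_nonneg (G := G) x a], h.deg_tail, h.ind' h.mem_base,
    h.ind' hs, if_pos rfl, if_neg hsc]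
  rfl

/-- Deleting an isolated edge leaves no isolated vertex, but the edge `ua` and the edge `ac`
together add two edges where only one was removed. -/
theorem not_isolated_edge (h : TailVertex G k m F B u a c) (hs₁ : s₁ ∈ B) (hs₂ : s₂ ∈ B)
    (h₁ : s₁ ≠ c) (h₂ : s₂ ≠ c) (hadj : G.Adj s₁ s₂) (hd₁ : degIn G B s₁ = 1)
    (hd₂ : degIn G B s₂ = 1) : False := by
  have := h.deg_add hs₁ hs₂ hadj.ne h₁ h₂ fun x hx hx1 hx2 => by
    rw [adjInd_leaf hd₁ hs₂ hadj hx, adjInd_leaf hd₂ hs₁ hadj.symm hx, if_neg hx1, if_neg hx2]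
    linarith [h.one_le hx, adjInd_nonneg (G := G) x a]
  rw [hd₁, hd₂, adjInd_eq_one.2 hadj] at this
  omega

/-- Comparing the squares of the degrees after replacing a leaf by `a`. -/
theorem sq_swap_leaf (h : TailVertex G k m F B u a c) (hl : l ∈ B) (hlc : l ≠ c)
    (hd : degIn G B l = 1) (hr : r ∈ B) (hlr : G.Adj l r) (hrc : r ≠ c)
    (hrd : 2 ≤ degIn G B r) : degIn G B r = degIn G B c + 1 := by
  have hpos := IsolatedVertex.swap_pos (G := G) h.notMem_tail hl (by
    rw [h.ind' hl, if_neg hlc, h.deg_tail]; rfl) fun x hx _ => by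
      rw [adjInd_leaf hd hr hlr hx]
      have := adjInd_nonneg (G := G) x a
      have := h.one_le hx
      by_cases hxr : x = r
      · rw [if_pos hxr, hxr]; rw [hxr] at this; linarith [adjInd_nonneg (G := G) r a]
      · rw [if_neg hxr]; linarith
  have h1 := h.sum_eq_base (h.card_swap h.notMem_tail hl) hpos fun d => d ^ 2
  have h2 : ∀ x ∈ B, degIn G (insert a (B.erase l)) x ^ 2 =
      ((degIn G B x + if x = r then -1 else 0) + if x = c then 1 else 0) ^ 2 := fun x hx => by
    rw [IsolatedVertex.degIn_swap h.notMem_tail hl, h.ind hx, adjInd_leaf hd hr hlr hx]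
    by_cases hxr : x = r
    · simp only [if_pos hxr]; ring
    · simp only [if_neg hxr]; ring
  have h3 := Finset.add_sum_erase B (fun x => degIn G (insert a (B.erase l)) x ^ 2) hl
  rw [Finset.sum_congr rfl h2, sum_sq_add_ite _ _ h.mem_base, sum_sq_add_ite _ _ hr,
    if_neg hrc.symm, h2 l hl, if_neg hlc, if_neg hlr.ne, hd] at h3
  rw [Finset.sum_insert (fun e => h.notMem_tail (Finset.mem_of_mem_erase e)),
    IsolatedVertex.degIn_swap h.notMem_tail hl, h.deg_tail, h.ind' hl, if_neg hlc, adjInd_self] at h1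
  linarith

/-- Comparing the squares of the degrees after replacing two leaves by `u` and `a`. -/
theorem sq_swap_two_leaves (h : TailVertex G k m F B u a c) (hl₁ : l₁ ∈ B) (hl₂ : l₂ ∈ B)
    (hne : l₁ ≠ l₂) (hc₁ : l₁ ≠ c) (hc₂ : l₂ ≠ c) (hd₁ : degIn G B l₁ = 1)
    (hd₂ : degIn G B l₂ = 1) (hr₁ : r₁ ∈ B) (hr₂ : r₂ ∈ B) (ha₁ : G.Adj l₁ r₁)
    (ha₂ : G.Adj l₂ r₂) (h12 : l₁ ≠ r₂) (h21 : l₂ ≠ r₁)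
    (hx : ∀ x ∈ B, x ≠ l₁ → x ≠ l₂ → 1 ≤ ((degIn G B x + if x = r₁ then -1 else 0) +
      if x = r₂ then -1 else 0) + if x = c then 1 else 0) :
    2 * degIn G B r₁ + 2 * (degIn G B r₂ + if r₂ = r₁ then -1 else 0) =
      2 * ((degIn G B c + if c = r₁ then -1 else 0) + if c = r₂ then -1 else 0) + 6 := by
  have hpos := h.swap_two_pos h.notMem_tail h.adj_tail hl₁ hl₂ hne fun x hxB hx1 hx2 => by
    have := hx x hxB hx1 hx2
    rw [adjInd_leaf hd₁ hr₁ ha₁ hxB, adjInd_leaf hd₂ hr₂ ha₂ hxB, h.ind hxB]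
    split_ifs at this ⊢ <;> linarith
  have h1 := h.sum_eq_base (h.card_swap_two h.notMem_tail h.adj_tail hl₁ hl₂ hne) hpos
    fun d => d ^ 2
  have h2 : ∀ x ∈ B, degIn G (insert u (insert a ((B.erase l₁).erase l₂))) x ^ 2 =
      (((degIn G B x + if x = r₁ then -1 else 0) + if x = r₂ then -1 else 0) +
        if x = c then 1 else 0) ^ 2 := fun x hxB => by
    rw [h.degIn_swap_two h.notMem_tail h.adj_tail hl₁ hl₂ hne,
      adjInd_leaf hd₁ hr₁ ha₁ hxB, adjInd_leaf hd₂ hr₂ ha₂ hxB, h.ind hxB,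
      adjInd_eq_zero.2 fun e => h.not_adj x hxB e.symm]
    split_ifs <;> ring
  have hl₂' : l₂ ∈ B.erase l₁ := by simp [hne.symm, hl₂]
  have h3 := Finset.add_sum_erase B
    (fun x => degIn G (insert u (insert a ((B.erase l₁).erase l₂))) x ^ 2) hl₁
  have h4 := Finset.add_sum_erase (B.erase l₁)
    (fun x => degIn G (insert u (insert a ((B.erase l₁).erase l₂))) x ^ 2) hl₂'
  rw [Finset.sum_congr rfl h2, sum_sq_add_ite _ _ h.mem_base, sum_sq_add_ite _ _ hr₂,
    sum_sq_add_ite _ _ hr₁, h2 l₁ hl₁, if_neg ha₁.ne, if_neg h12, if_neg hc₁, hd₁] at h3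
  rw [h2 l₂ hl₂, if_neg ha₂.ne, if_neg h21, if_neg hc₂, hd₂] at h4
  have hau : a ∉ (B.erase l₁).erase l₂ := by simp [h.notMem_tail]
  rw [Finset.sum_insert (by simp [h.adj_tail.ne, h.notMem]), Finset.sum_insert hau,
    h.degIn_swap_two h.notMem_tail h.adj_tail hl₁ hl₂ hne u,
    h.degIn_swap_two h.notMem_tail h.adj_tail hl₁ hl₂ hne a, h.deg_tail, h.degIn_base,
    h.ind' hl₁, h.ind' hl₂, if_neg hc₁, if_neg hc₂, adjInd_self, adjInd_self,
    adjInd_eq_one.2 h.adj_tail, adjInd_eq_one.2 h.adj_tail.symm,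
    adjInd_eq_zero.2 (h.not_adj l₁ hl₁), adjInd_eq_zero.2 (h.not_adj l₂ hl₂)] at h1
  linarith

/-- The neighbour of the tail has degree one in the base. -/
theorem degIn_base_eq_one (h : TailVertex G k m F B u a c) : degIn G B c = 1 := by
  by_contra hne
  have hc2 : 2 ≤ degIn G B c := by have := h.one_le h.mem_base; omega
  have hlc : ∀ {l}, degIn G B l = 1 → l ≠ c := fun {l} hl e => by rw [e] at hl; omega
  have hsup : ∀ {l r}, l ∈ B → r ∈ B → degIn G B l = 1 → G.Adj l r → 2 ≤ degIn G B r := by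
    intro l r hl hr hd hadj
    by_contra! hlt
    have hrd : degIn G B r = 1 := by have := h.one_le hr; omega
    exact h.not_isolated_edge hl hr (hlc hd) (hlc hrd) hadj hd hrd
  have hlr : ∀ {l r l'}, l ∈ B → r ∈ B → degIn G B l = 1 → G.Adj l r → degIn G B l' = 1 →
      l' ≠ r := by
    rintro l r l' hl hr hd hadj hd' rfl
    have := hsup hl hr hd hadj
    omega
  -- The square counts say that a supporting vertex other than `c` has degree one more than `c`.
  -- With the double exchange this forces `degIn G B c = 1`, whether or not `r₂ = c`.
  have htwo : ∀ {l₁ r₁ l₂ r₂}, l₁ ∈ B → r₁ ∈ B → degIn G B l₁ = 1 → G.Adj l₁ r₁ → l₂ ∈ B →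
      r₂ ∈ B → degIn G B l₂ = 1 → G.Adj l₂ r₂ → r₁ ≠ c → r₁ ≠ r₂ → False := by
    intro l₁ r₁ l₂ r₂ hl₁ hr₁ hd₁ ha₁ hl₂ hr₂ hd₂ ha₂ hr₁c hrr
    have hne : l₁ ≠ l₂ := by
      rintro rfl; exact hrr (eq_of_degIn_le_one hd₁.le hr₁ hr₂ ha₁ ha₂)
    have e1 := h.sq_swap_leaf hl₁ (hlc hd₁) hd₁ hr₁ ha₁ hr₁c (hsup hl₁ hr₁ hd₁ ha₁)
    have h2 := hsup hl₂ hr₂ hd₂ ha₂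
    have e2 := h.sq_swap_two_leaves hl₁ hl₂ hne (hlc hd₁) (hlc hd₂) hd₁ hd₂ hr₁ hr₂ ha₁ ha₂
      (hlr hl₂ hr₂ hd₂ ha₂ hd₁) (hlr hl₁ hr₁ hd₁ ha₁ hd₂) (by
        intro x hx _ _
        have := h.one_le hx
        by_cases x1 : x = r₁
        · subst x1
          rw [if_pos rfl, if_neg hrr, if_neg hr₁c]; omega
        · by_cases x2 : x = r₂
          · subst x2
            rw [if_neg x1, if_pos rfl]
            split_ifs <;> omega
          · rw [if_neg x1, if_neg x2]
            split_ifs <;> omega)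
    rw [if_neg hrr.symm, if_neg hr₁c.symm] at e2
    by_cases hr₂c : r₂ = c
    · subst hr₂c
      rw [if_pos rfl] at e2
      omega
    · have e3 := h.sq_swap_leaf hl₂ (hlc hd₂) hd₂ hr₂ ha₂ hr₂c (hsup hl₂ hr₂ hd₂ ha₂)
      rw [if_neg (Ne.symm hr₂c)] at e2
      omega
  by_cases hex : ∃ r ∈ B, r ≠ c ∧ degIn G B r ≠ 1
  · obtain ⟨r, hr, hrc, hrd⟩ := hex
    obtain ⟨l, hl, -, hd, hadj⟩ := (h.deg_or_exists_leaf hr hrc).resolve_left hrd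
    obtain ⟨y, hy⟩ : ∃ y, y ∈ (B.filter (G.Adj c)).erase r := by
      refine Finset.card_pos.1 ?_
      rw [degIn_eq_card] at hc2
      have := Finset.pred_card_le_card_erase (s := B.filter (G.Adj c)) (a := r)
      omega
    simp only [Finset.mem_erase, Finset.mem_filter] at hy
    obtain ⟨hyr, hyB, hcy⟩ := hy
    rcases h.deg_or_exists_leaf hyB hcy.ne' with hyd | ⟨l', hl', -, hd', hadj'⟩
    · exact htwo hl hr hd hadj hyB h.mem_base hyd hcy.symm hrc hrc
    · exact htwo hl hr hd hadj hl' hyB hd' hadj' hrc (Ne.symm hyr)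
  -- All vertices except `c` are leaves, so the base is a star centred at `c`. The double exchange
  -- of two leaves gives `c` degree two, although `|B| ≥ 4`.
  · push Not at hex
    have hstar : ∀ x ∈ B, x ≠ c → G.Adj x c := by
      intro x hx hxc
      obtain ⟨r, hr, hxr⟩ := h.exists_nbr hx
      by_cases hrc : r = c
      · rwa [← hrc]
      · exact absurd (hex r hr hrc) (by have := hsup hx hr (hex x hx hxc) hxr; omega)
    have hBc := h.card_base
    have h5 := h.five_le
    obtain ⟨l₁, hl₁, l₂, hl₂, hne⟩ := Finset.one_lt_card.1 (show 1 < (B.erase c).card by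
      rw [Finset.card_erase_of_mem h.mem_base]; omega)
    simp only [Finset.mem_erase] at hl₁ hl₂
    have hcd : degIn G B c = B.card - 1 := by
      have h6 := degIn_eq_card_iff.2 (fun x hx => (hstar x (Finset.mem_of_mem_erase hx)
        (Finset.ne_of_mem_erase hx)).symm : ∀ x ∈ B.erase c, G.Adj c x)
      rw [degIn_erase h.mem_base, adjInd_self, Finset.card_erase_of_mem h.mem_base] at h6
      omega
    have e2 := h.sq_swap_two_leaves hl₁.2 hl₂.2 hne hl₁.1 hl₂.1 (hex _ hl₁.2 hl₁.1)
      (hex _ hl₂.2 hl₂.1) h.mem_base h.mem_base (hstar _ hl₁.2 hl₁.1) (hstar _ hl₂.2 hl₂.1)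
      hl₁.1 hl₂.1 (by
        intro x hx _ _
        have := h.one_le hx
        by_cases hxc : x = c
        · subst hxc
          simp only [if_true]; omega
        · simp only [if_neg hxc]; omega)
    simp only [if_true] at e2
    omega

/-- The neighbour of the tail lies in an isolated edge of the base. -/
theorem degIn_nbr_eq_one (h : TailVertex G k m F B u a c) (hr : r ∈ B) (hcr : G.Adj c r) :
    degIn G B r = 1 := by
  by_contra hne
  have hcd := h.degIn_base_eq_one
  have hr2 : 2 ≤ degIn G B r := by have := h.one_le hr; omega
  -- Exchanging `c` together with a leaf `s` not adjacent to it removes two edges and adds one; this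
  -- is a contradiction unless some vertex gets isolated.
  have key : ∀ s q, s ∈ B → s ≠ c → s ≠ r → degIn G B s = 1 → q ∈ B → G.Adj s q → 2 ≤ degIn G B q →
      (r = q → 3 ≤ degIn G B r) → False := by
    intro s q hs hsc hsr hd hq hsq hqd hrq
    have := h.deg_add_base hs hsc fun x hx hxc hxs => by
      rw [adjInd_leaf hcd hr hcr hx, adjInd_leaf hd hq hsq hx]
      have := h.one_le hx
      by_cases x1 : x = r
      · subst x1
        by_cases x2 : x = q
        · rw [if_pos rfl, if_pos x2]; linarith [hrq x2]
        · rw [if_pos rfl, if_neg x2]; linarith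
      · by_cases x2 : x = q
        · rw [if_neg x1, if_pos x2, x2]; linarith
        · rw [if_neg x1, if_neg x2]; linarith
    rw [hcd, hd, adjInd_eq_zero.2 fun e =>
      hsr (eq_of_degIn_le_one hcd.le hs hr e hcr)] at this
    omega
  obtain ⟨w, hw, hwc, hwd, hwr⟩ := (h.deg_or_exists_leaf hr hcr.ne').resolve_left hne
  have hrw : w ≠ r := hwr.ne
  by_cases hr3 : 3 ≤ degIn G B r
  · exact key w r hw hwc hrw hwd hr hwr hr2 fun _ => hr3
  have hNr : ∀ x ∈ B, G.Adj r x → x = c ∨ x = w := by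
    intro x hx hrx
    by_contra! hcon
    have h1 : ({c, w, x} : Finset W) ⊆ B.filter (G.Adj r) := by
      intro y hy
      simp only [Finset.mem_insert, Finset.mem_singleton] at hy
      rw [Finset.mem_filter]
      rcases hy with rfl | rfl | rfl
      · exact ⟨h.mem_base, hcr.symm⟩
      · exact ⟨hw, hwr.symm⟩
      · exact ⟨hx, hrx⟩
    have h2 := Finset.card_le_card h1
    rw [Finset.card_eq_three.2 ⟨c, w, x, hwc.symm, hcon.1.symm, hcon.2.symm, rfl⟩] at h2
    rw [degIn_eq_card] at hr3
    omega
  obtain ⟨z, hz⟩ : ∃ z, z ∈ B \ {c, r, w} := by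
    refine Finset.card_pos.1 ?_
    have h1 := Finset.le_card_sdiff {c, r, w} B
    have h2 := Finset.card_le_three (a := c) (b := r) (c := w)
    have := h.card_base
    have := h.five_le
    omega
  simp only [Finset.mem_sdiff, Finset.mem_insert, Finset.mem_singleton, not_or] at hz
  obtain ⟨hzB, hzc, hzr, hzw⟩ := hz
  obtain ⟨s, q, hs, hsc, hsd, hq, hsq, hqr⟩ : ∃ s q, s ∈ B ∧ s ≠ c ∧ degIn G B s = 1 ∧ q ∈ B ∧
      G.Adj s q ∧ q ≠ r := by
    rcases h.deg_or_exists_leaf hzB hzc with hzd | ⟨s, hs, hsc, hsd, hsz⟩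
    · obtain ⟨q, hq, hzq⟩ := h.exists_nbr hzB
      refine ⟨z, q, hzB, hzc, hzd, hq, hzq, ?_⟩
      rintro rfl
      rcases hNr z hzB hzq.symm with e | e
      · exact hzc e
      · exact hzw e
    · exact ⟨s, z, hs, hsc, hsd, hzB, hsz, hzr⟩
  have hsr : s ≠ r := by rintro rfl; omega
  have hqc : q ≠ c := by
    rintro rfl
    exact hsr (eq_of_degIn_le_one hcd.le hs hr hsq.symm hcr)
  have hq2 : 2 ≤ degIn G B q := by
    by_contra! hlt
    have hqd : degIn G B q = 1 := by have := h.one_le hq; omega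
    exact h.not_isolated_edge hs hq hsc hqc hsq hsd hqd
  exact key s q hs hsc hsr hsd hq hsq hq2 fun e => absurd e.symm hqr

end TailVertex

end

/-! ### A tail: the base is an edge and a three-vertex path -/

section

open scoped Classical

theorem degSum_five {W : Type*} {G : SimpleGraph W} {a b c d e : W} (hab : a ≠ b) (hac : a ≠ c)
    (had : a ≠ d) (hae : a ≠ e) (hbc : b ≠ c) (hbd : b ≠ d) (hbe : b ≠ e) (hcd : c ≠ d)
    (hce : c ≠ e) (hde : d ≠ e) :
    ({a, b, c, d, e} : Finset W).card = 5 ∧ degSum G {a, b, c, d, e} =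
      2 * (adjInd G a b + adjInd G a c + adjInd G a d + adjInd G a e + adjInd G b c +
        adjInd G b d + adjInd G b e + adjInd G c d + adjInd G c e + adjInd G d e) := by
  have h1 : a ∉ ({b, c, d, e} : Finset W) := by simp [*]
  have h2 : b ∉ ({c, d, e} : Finset W) := by simp [*]
  have h3 : c ∉ ({d, e} : Finset W) := by simp [*]
  have h4 : d ∉ ({e} : Finset W) := by simp [*]
  constructor
  · rw [Finset.card_insert_of_notMem h1, Finset.card_insert_of_notMem h2,
      Finset.card_insert_of_notMem h3, Finset.card_pair hde]
  · rw [degSum_insert h1, degSum_insert h2, degSum_insert h3, degSum_insert h4, degIn_insert h2,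
      degIn_insert h3, degIn_insert h3, degIn_insert h4, degIn_insert h4, degIn_insert h4]
    simp [degSum, degIn]
    ring

variable {W : Type*} [Fintype W] {G : SimpleGraph W} {k m : ℕ} {F : Set (Finset W)}

namespace TailVertex

variable {B : Finset W} {u a c : W}

theorem not_adj_of_degIn_univ_le_two {W : Type*} [Fintype W] {G : SimpleGraph W} {x y₁ y₂ y₃ : W}
    (h : degIn G Finset.univ x ≤ 2) (h1 : G.Adj x y₁) (h2 : G.Adj x y₂) (h12 : y₁ ≠ y₂)
    (h13 : y₃ ≠ y₁) (h23 : y₃ ≠ y₂) : ¬ G.Adj x y₃ := by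
  intro h3
  have e : ({y₁, y₂, y₃} : Finset W) ⊆ Finset.univ.filter (G.Adj x) := by
    intro w hw
    simp only [Finset.mem_insert, Finset.mem_singleton] at hw
    rcases hw with rfl | rfl | rfl <;> simpa
  have := Finset.card_le_card e
  rw [Finset.card_eq_three.2 ⟨y₁, y₂, y₃, h12, h13.symm, h23.symm, rfl⟩] at this
  rw [degIn_eq_card] at h
  omega

/-- The exceptional configuration where the base is the disjoint union of an edge and a path on
three vertices. -/
theorem eq_two_of_edge_path (h : TailVertex G k m F B u a c) {e l r q : W}
    (hB : ∀ x, x ∈ B ↔ x = c ∨ x = e ∨ x = l ∨ x = r ∨ x = q) (hce : G.Adj c e)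
    (hlr : G.Adj l r) (hqr : G.Adj q r) (hlq : l ≠ q) (hc : degIn G B c = 1)
    (he : degIn G B e = 1) (hl : degIn G B l = 1) (hr : degIn G B r = 2) (hq : degIn G B q = 1)
    : m = 2 := by
  by_contra hm2
  have hm := h.two_le
  have heB : e ∈ B := (hB e).2 (by tauto)
  have hlB : l ∈ B := (hB l).2 (by tauto)
  have hrB : r ∈ B := (hB r).2 (by tauto)
  have hqB : q ∈ B := (hB q).2 (by tauto)
  have hcB := h.mem_base
  have hcr : c ≠ r := by rintro rfl; omega
  have her : e ≠ r := by rintro rfl; omega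
  have hcl : c ≠ l := by
    rintro rfl; exact her (eq_of_degIn_le_one hc.le heB hrB hce hlr)
  have hcq : c ≠ q := by
    rintro rfl; exact her (eq_of_degIn_le_one hc.le heB hrB hce hqr)
  have hel : e ≠ l := by
    rintro rfl; exact hcr (eq_of_degIn_le_one he.le hcB hrB hce.symm hlr)
  have heq : e ≠ q := by
    rintro rfl; exact hcr (eq_of_degIn_le_one he.le hcB hrB hce.symm hqr)
  have naB : ∀ {x}, x ∈ B → x ≠ a := fun {x} hx e => h.notMem_tail (e ▸ hx)
  have nuB : ∀ {x}, x ∈ B → x ≠ u := fun {x} hx e => h.notMem (e ▸ hx)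
  have hBsum : degSum G B = 6 ∧ B.card = 5 := by
    have hBeq : B = {c, e, l, r, q} := by ext x; simp [hB]
    obtain ⟨h1, h2⟩ := degSum_five (G := G) hce.ne hcl hcr hcq hel her heq hlr.ne hlq hqr.ne'
    refine ⟨?_, by rw [hBeq, h1]⟩
    rw [hBeq, h2, adjInd_eq_one.2 hce, adjInd_eq_one.2 hlr, adjInd_eq_one.2 hqr.symm,
      adjInd_leaf hl hrB hlr hcB, adjInd_leaf hq hrB hqr hcB, adjInd_leaf hl hrB hlr heB,
      adjInd_leaf hq hrB hqr heB, adjInd_leaf hq hrB hqr hlB, adjInd_comm c r, adjInd_comm e r,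
      adjInd_leaf hc heB hce hrB, adjInd_leaf he hcB hce.symm hrB]
    simp [hcr, her, hlr.ne, Ne.symm hcr, Ne.symm her]
  have hk6 : k = 6 := by have := h.card_base; omega
  have hdegT : ∀ x ∈ insert u B, degIn G (insert u B) x ≤ 2 := by
    intro x hx
    rcases Finset.mem_insert.1 hx with rfl | hxB
    · rw [h.degIn_member_self]; norm_num
    · rw [h.degIn_member hxB]
      rcases (hB x).1 hxB with rfl | rfl | rfl | rfl | rfl <;> omega
  have hG : ∀ v, degIn G Finset.univ v ≤ (2 : ℕ) := h.degIn_univ_le h.le_card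
    (fun T hT x hx => by
      obtain ⟨y, hy, hd⟩ := h.exists_deg hT h.mem hx
      rw [← hd]; exact_mod_cast hdegT y hy) (by omega)
  have three : ∀ {x y₁ y₂ y₃}, G.Adj x y₁ → G.Adj x y₂ → y₁ ≠ y₂ → y₃ ≠ y₁ → y₃ ≠ y₂ →
      ¬ G.Adj x y₃ := fun {x y₁ y₂ y₃} h1 h2 => not_adj_of_degIn_univ_le_two (by exact_mod_cast hG x) h1 h2
  have hac : G.Adj a c := h.adj_base
  have hua : G.Adj u a := h.adj_tail
  have iae : adjInd G a e = 0 := by rw [h.ind' heB, if_neg hce.ne']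
  have ial : adjInd G a l = 0 := by rw [h.ind' hlB, if_neg hcl.symm]
  have iaq : adjInd G a q = 0 := by rw [h.ind' hqB, if_neg hcq.symm]
  have iel : adjInd G e l = 0 := by rw [adjInd_leaf hl hrB hlr heB, if_neg her]
  have ieq : adjInd G e q = 0 := by rw [adjInd_leaf hq hrB hqr heB, if_neg her]
  have ilq : adjInd G l q = 0 := by rw [adjInd_leaf hq hrB hqr hlB, if_neg hlr.ne]
  -- Degrees in `G` are at most two, so `o` is not adjacent to `a`, `c`, `r`. If `o` is adjacent to
  -- `e`, exchange makes it adjacent to `u`, and `u a c e o` is a cycle with more edges than `B`. If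
  -- not, `{a, e, l, q, o}` is independent, which requires a vertex of degree three in a member.
  have key : ∀ o, o ∉ insert u B → o ≠ a → G.Adj l o ∨ G.Adj q o := by
    intro o ho hoa
    have hou : o ≠ u := by rintro rfl; simp at ho
    have hoB : o ∉ B := fun e => ho (by simp [e])
    have noB : ∀ {x}, x ∈ B → o ≠ x := fun {x} hx e => hoB (e ▸ hx)
    have hao : ¬ G.Adj a o := three hua.symm hac (nuB hcB).symm hou (noB hcB)
    have hco : ¬ G.Adj c o := three hce hac.symm (naB heB) (noB heB) hoa
    have hro : ¬ G.Adj r o := three hlr.symm hqr.symm hlq (noB hlB) (noB hqB)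
    by_contra! hcon
    have ilo := adjInd_eq_zero.2 hcon.1
    have iqo := adjInd_eq_zero.2 hcon.2
    have iao := adjInd_eq_zero.2 hao
    by_cases heo : G.Adj e o
    · have h1 := h.exchange hoB hou hcB
      rw [adjInd_eq_zero.2 fun e => hco e.symm, hc] at h1
      have h2 := h.le_swap_of_max h.le_card h.mem (p := r) (s := e) (y := o) (by simp [hrB])
        (fun x hx => by rw [h.degIn_member hrB, hr]; exact hdegT x hx) (by simp [heB]) her.symm ho
      rw [h.degIn_member heB, he, adjInd_leaf he hcB hce.symm hrB, if_neg hcr.symm,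
        adjInd_eq_zero.2 fun e => hro e.symm, adjInd_eq_one.2 heo.symm, degIn_insert h.notMem] at h2
      have h3 : adjInd G o u = 1 := le_antisymm (adjInd_le_one _ _) (by linarith)
      have huo := (adjInd_eq_one.1 h3).symm
      obtain ⟨h4, h5⟩ := degSum_five (G := G) hua.ne (nuB hcB).symm (nuB heB).symm hou.symm
        (naB hcB).symm (naB heB).symm hoa.symm hce.ne (noB hcB).symm (noB heB).symm
      have h6 := h.degSum_eq_base (S := {u, a, c, e, o}) (by omega) (by
        intro x hx
        simp only [Finset.mem_insert, Finset.mem_singleton] at hx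
        apply degIn_pos.2
        rcases hx with rfl | rfl | rfl | rfl | rfl
        · exact ⟨a, by simp, hua⟩
        · exact ⟨u, by simp, hua.symm⟩
        · exact ⟨a, by simp, hac.symm⟩
        · exact ⟨c, by simp, hce.symm⟩
        · exact ⟨e, by simp, heo.symm⟩)
      rw [h5, adjInd_eq_one.2 hua, adjInd_eq_one.2 hac, adjInd_eq_one.2 hce, adjInd_eq_one.2 heo,
        adjInd_eq_one.2 huo, hBsum.1] at h6
      have := adjInd_nonneg (G := G) u c
      have := adjInd_nonneg (G := G) u e
      have := adjInd_nonneg (G := G) a e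
      have := adjInd_nonneg (G := G) a o
      have := adjInd_nonneg (G := G) c o
      linarith
    · obtain ⟨h4, h5⟩ := degSum_five (G := G) (naB heB).symm (naB hlB).symm (naB hqB).symm
        hoa.symm hel heq (noB heB).symm hlq (noB hlB).symm (noB hqB).symm
      obtain ⟨x, hx, hd⟩ := h.exists_degSum h.le_card h.mem (S := {a, e, l, q, o}) (by omega)
      rw [h5, h.degSum_member, hBsum.1, iae, ial, iaq, iel, ieq, ilq, ilo, iqo, iao,
        adjInd_eq_zero.2 heo] at hd
      have := hdegT x hx
      omega
  obtain ⟨o₁, ho₁, o₂, ho₂, hne⟩ := Finset.one_lt_card.1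
    (show 1 < ((insert u B)ᶜ.erase a).card by
      rw [Finset.card_erase_of_mem (by simp [hua.ne', h.notMem_tail]),
        card_compl_member h.toRainbowFamily h.card_univ h.mem]; omega)
  simp only [Finset.mem_erase, Finset.mem_compl] at ho₁ ho₂
  -- The path `o₁ l r q o₂` has no isolated vertex and at least four edges, while the base has
  -- three.
  have final : ∀ o₁ o₂, o₁ ∉ insert u B → o₂ ∉ insert u B → o₁ ≠ o₂ → G.Adj l o₁ → G.Adj q o₂ →
      False := by
    intro o₁ o₂ ho₁ ho₂ hne h1 h2
    have n1 : ∀ {x}, x ∈ B → o₁ ≠ x := fun {x} hx e => ho₁ (by simp [e, hx])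
    have n2 : ∀ {x}, x ∈ B → o₂ ≠ x := fun {x} hx e => ho₂ (by simp [e, hx])
    obtain ⟨h4, h5⟩ := degSum_five (G := G) (n1 hlB) (n1 hrB) (n1 hqB) hne hlr.ne hlq
      (n2 hlB).symm hqr.ne' (n2 hrB).symm (n2 hqB).symm
    have h6 := h.degSum_eq_base (S := {o₁, l, r, q, o₂}) (by omega) (by
      intro x hx
      simp only [Finset.mem_insert, Finset.mem_singleton] at hx
      apply degIn_pos.2
      rcases hx with rfl | rfl | rfl | rfl | rfl
      · exact ⟨l, by simp, h1.symm⟩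
      · exact ⟨r, by simp, hlr⟩
      · exact ⟨l, by simp, hlr.symm⟩
      · exact ⟨r, by simp, hqr⟩
      · exact ⟨q, by simp, h2.symm⟩)
    rw [h5, adjInd_eq_one.2 h1.symm, adjInd_eq_one.2 hlr, adjInd_eq_one.2 hqr.symm,
      adjInd_eq_one.2 h2, hBsum.1] at h6
    have := adjInd_nonneg (G := G) o₁ r
    have := adjInd_nonneg (G := G) o₁ q
    have := adjInd_nonneg (G := G) o₁ o₂
    have := adjInd_nonneg (G := G) l q
    have := adjInd_nonneg (G := G) l o₂
    have := adjInd_nonneg (G := G) r o₂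
    linarith
  have nB : ∀ {o x}, o ∉ insert u B → x ∈ B → o ≠ x := fun ho hx e => ho (by simp [e, hx])
  rcases key o₁ ho₁.2 ho₁.1 with h1 | h1 <;> rcases key o₂ ho₂.2 ho₂.1 with h2 | h2
  · exact three hlr h1 (nB ho₁.2 hrB).symm (nB ho₂.2 hrB) hne.symm h2
  · exact final o₁ o₂ ho₁.2 ho₂.2 hne h1 h2
  · exact final o₂ o₁ ho₂.2 ho₁.2 hne.symm h2 h1
  · exact three hqr h1 (nB ho₁.2 hrB).symm (nB ho₂.2 hrB) hne.symm h2

/-- The base has exactly one isolated edge, `ce`. Deleting a leaf `l` elsewhere and adding `a` turns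
`ce` into part of a longer path, so another isolated edge must appear: the component of `l` was a
path on three vertices. Two such components would produce two isolated edges after a double
exchange. So `|B| = 5` and `k = 6`. -/
theorem eq_two_and_even (h : TailVertex G k m F B u a c) : m = 2 ∧ Even k := by
  have hc := h.degIn_base_eq_one
  have hcB := h.mem_base
  obtain ⟨e, heB, hce⟩ := h.exists_nbr hcB
  have he := h.degIn_nbr_eq_one heB hce
  have edge : ∀ {x y}, x ∈ B → y ∈ B → G.Adj x y → degIn G B x = 1 → degIn G B y = 1 →
      x = c ∧ y = e ∨ x = e ∧ y = c := by
    intro x y hx hy hxy hxd hyd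
    by_cases hxc : x = c
    · subst hxc; exact .inl ⟨rfl, eq_of_degIn_le_one hc.le hy heB hxy hce⟩
    · by_cases hyc : y = c
      · subst hyc; exact .inr ⟨eq_of_degIn_le_one hc.le hx heB hxy.symm hce, rfl⟩
      · exact (h.not_isolated_edge hx hy hxc hyc hxy hxd hyd).elim
  have hrd : ∀ {l r}, l ∈ B → r ∈ B → degIn G B l = 1 → G.Adj l r → l ≠ c → l ≠ e →
      2 ≤ degIn G B r := by
    intro l r hl hr hd hlr hlc hle
    by_contra! hlt
    have := edge hl hr hlr hd (by have := h.one_le hr; omega)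
    tauto
  have hpath : ∀ l ∈ B, ∀ r ∈ B, degIn G B l = 1 → G.Adj l r → l ≠ c → l ≠ e →
      degIn G B r = 2 ∧ ∃ q ∈ B, q ≠ l ∧ G.Adj q r ∧ degIn G B q = 1 := by
    intro l hl r hr hd hlr hlc hle
    have hr2 := hrd hl hr hd hlr hlc hle
    have hpos := IsolatedVertex.swap_pos (G := G) h.notMem_tail hl (by
      rw [h.ind' hl, if_neg hlc, h.deg_tail]; rfl) fun x hx _ => by
        rw [adjInd_leaf hd hr hlr hx]
        have h1 := adjInd_nonneg (G := G) x a
        have h2 := h.one_le hx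
        by_cases hxr : x = r
        · subst hxr; rw [if_pos rfl]; linarith
        · rw [if_neg hxr]; linarith
    obtain ⟨f, hf, hfadj, hdeg⟩ := h.exists_iso_base (h.card_swap h.notMem_tail hl) hpos
    obtain ⟨x, hx, hxc⟩ := hf.surjOn hcB
    obtain ⟨y, hy, hye⟩ := hf.surjOn heB
    have hxy : G.Adj x y := (hfadj x hx y hy).1 (by rw [hxc, hye]; exact hce)
    have hxd := hdeg x hx
    have hyd := hdeg y hy
    rw [hxc, hc] at hxd
    rw [hye, he] at hyd
    rw [IsolatedVertex.degIn_swap h.notMem_tail hl] at hxd hyd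
    have hcl : adjInd G c l = 0 := by
      rw [adjInd_leaf hd hr hlr hcB, if_neg]
      rintro rfl; omega
    have hnc : ∀ {z}, 1 = adjInd G z a + (degIn G B z - adjInd G z l) → z ≠ c := by
      rintro z hz rfl
      rw [hcl, hc, h.ind hcB, if_pos rfl] at hz
      omega
    have hna : ∀ {z w}, z ∈ insert a (B.erase l) → w ∈ insert a (B.erase l) → G.Adj z w →
        w ≠ c → z ≠ a := by
      rintro z w hz hw hzw hwc rfl
      simp only [Finset.mem_insert, Finset.mem_erase] at hw
      rcases hw with e1 | e1
      · exact hzw.ne e1.symm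
      · exact hwc (eq_of_degIn_le_one h.deg_tail.le e1.2 hcB hzw h.adj_base)
    have hxa := hna hx hy hxy (hnc hyd)
    have hya := hna hy hx hxy.symm (hnc hxd)
    have hxc' := hnc hxd
    have hyc' := hnc hyd
    simp only [Finset.coe_insert, Set.mem_insert_iff, Finset.mem_coe, Finset.mem_erase, hxa, hya,
      false_or] at hx hy
    rw [h.ind hx.2, if_neg hxc'] at hxd
    rw [h.ind hy.2, if_neg hyc'] at hyd
    have fin : ∀ {x y}, x ∈ B → y ∈ B → y ≠ l → G.Adj x y → G.Adj x l →
        1 = degIn G B x - adjInd G x l → 1 = degIn G B y - adjInd G y l →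
        degIn G B r = 2 ∧ ∃ q ∈ B, q ≠ l ∧ G.Adj q r ∧ degIn G B q = 1 := by
      intro x y hx hy hyl hxy hxl h1 h2
      have hxr : x = r := eq_of_degIn_le_one hd.le hx hr hxl.symm hlr
      subst hxr
      rw [adjInd_eq_one.2 hxl] at h1
      rw [adjInd_leaf hd hr hlr hy, if_neg hxy.ne'] at h2
      exact ⟨by omega, y, hy, hyl, hxy.symm, by omega⟩
    by_cases hxl : G.Adj x l
    · exact fin hx.2 hy.2 hy.1 hxy hxl (by omega) (by omega)
    · by_cases hyl : G.Adj y l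
      · exact fin hy.2 hx.2 hx.1 hxy.symm hyl (by omega) (by omega)
      · rw [adjInd_eq_zero.2 hxl] at hxd
        rw [adjInd_eq_zero.2 hyl] at hyd
        exact (h.not_isolated_edge hx.2 hy.2 hxc' hyc' hxy (by omega) (by omega)).elim
  have hleaf : ∀ z ∈ B, z ≠ c → z ≠ e → ∃ l ∈ B, ∃ r ∈ B, degIn G B l = 1 ∧ G.Adj l r ∧ l ≠ c ∧
      l ≠ e ∧ (l = z ∨ r = z) := by
    intro z hz hzc hze
    rcases h.deg_or_exists_leaf hz hzc with hzd | ⟨x, hx, hxc, hxd, hxz⟩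
    · obtain ⟨r, hr, hzr⟩ := h.exists_nbr hz
      exact ⟨z, hz, r, hr, hzd, hzr, hzc, hze, .inl rfl⟩
    · refine ⟨x, hx, z, hz, hxd, hxz, hxc, ?_, .inr rfl⟩
      rintro rfl
      exact hzc (eq_of_degIn_le_one hxd.le hz hcB hxz hce.symm)
  obtain ⟨z, hz⟩ : ∃ z, z ∈ B \ {c, e} := by
    refine Finset.card_pos.1 ?_
    have h1 := Finset.le_card_sdiff {c, e} B
    have h2 := Finset.card_le_two (a := c) (b := e)
    have := h.card_base
    have := h.five_le
    omega
  simp only [Finset.mem_sdiff, Finset.mem_insert, Finset.mem_singleton, not_or] at hz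
  obtain ⟨l₁, hl₁, r₁, hr₁, hd₁, ha₁, hlc₁, hle₁, -⟩ := hleaf z hz.1 hz.2.1 hz.2.2
  obtain ⟨hrd₁, q₁, hq₁, hql₁, hqr₁, hqd₁⟩ := hpath l₁ hl₁ r₁ hr₁ hd₁ ha₁ hlc₁ hle₁
  have hNr : ∀ x ∈ B, G.Adj x r₁ → x = l₁ ∨ x = q₁ := by
    intro x hx hxr
    by_contra! hcon
    have h1 : ({l₁, q₁, x} : Finset W) ⊆ B.filter (G.Adj r₁) := by
      intro y hy
      simp only [Finset.mem_insert, Finset.mem_singleton] at hy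
      rw [Finset.mem_filter]
      rcases hy with rfl | rfl | rfl
      · exact ⟨hl₁, ha₁.symm⟩
      · exact ⟨hq₁, hqr₁.symm⟩
      · exact ⟨hx, hxr.symm⟩
    have h2 := Finset.card_le_card h1
    rw [Finset.card_eq_three.2 ⟨l₁, q₁, x, hql₁.symm, hcon.1.symm, hcon.2.symm, rfl⟩] at h2
    rw [degIn_eq_card] at hrd₁
    omega
  have hB : ∀ x, x ∈ B ↔ x = c ∨ x = e ∨ x = l₁ ∨ x = r₁ ∨ x = q₁ := by
    intro x
    refine ⟨fun hx => ?_, by rintro (rfl | rfl | rfl | rfl | rfl) <;> assumption⟩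
    by_contra! hcon
    obtain ⟨hxc, hxe, hxl, hxr, hxq⟩ := hcon
    obtain ⟨l₂, hl₂, r₂, hr₂, hd₂, ha₂, hlc₂, hle₂, hor⟩ := hleaf x hx hxc hxe
    obtain ⟨hrd₂, q₂, hq₂, hql₂, hqr₂, hqd₂⟩ := hpath l₂ hl₂ r₂ hr₂ hd₂ ha₂ hlc₂ hle₂
    have hrr : r₁ ≠ r₂ := by
      rintro rfl
      rcases hor with rfl | rfl
      · rcases hNr l₂ hx ha₂ with e1 | e1
        · exact hxl e1
        · exact hxq e1
      · exact hxr rfl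
    have hne : ∀ {y y'}, y ∈ B → degIn G B y = 1 → G.Adj y r₁ → G.Adj y' r₂ → y ≠ y' := by
      rintro y y' hy hyd h1 h2 rfl
      exact hrr (eq_of_degIn_le_one hyd.le hr₁ hr₂ h1 h2)
    have hll := hne hl₁ hd₁ ha₁ ha₂
    -- After deleting `l₁` and `l₂`, both `r₁q₁` and `r₂q₂` are isolated edges, and the isomorphism
    -- would send both onto `ce`.
    have hpos := h.swap_two_pos h.notMem_tail h.adj_tail hl₁ hl₂ hll fun x hx _ _ => by
      rw [adjInd_leaf hd₁ hr₁ ha₁ hx, adjInd_leaf hd₂ hr₂ ha₂ hx]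
      have h1 := adjInd_nonneg (G := G) x a
      have h2 := h.one_le hx
      by_cases e1 : x = r₁
      · subst e1; rw [if_pos rfl, if_neg hrr]; omega
      · by_cases e2 : x = r₂
        · subst e2; rw [if_neg e1, if_pos rfl]; omega
        · rw [if_neg e1, if_neg e2]; omega
    obtain ⟨f, hf, hfadj, hdeg⟩ :=
      h.exists_iso_base (h.card_swap_two h.notMem_tail h.adj_tail hl₁ hl₂ hll) hpos
    have hmem : ∀ {y}, y ∈ B → y ≠ l₁ → y ≠ l₂ →
        y ∈ insert u (insert a ((B.erase l₁).erase l₂)) := fun hy h1 h2 => by simp [hy, h1, h2]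
    have hfd : ∀ {y}, y ∈ B → y ≠ l₁ → y ≠ l₂ → y ≠ c → degIn G B (f y) =
        degIn G B y - (if y = r₁ then 1 else 0) - if y = r₂ then 1 else 0 := by
      intro y hy h1 h2 hyc
      rw [hdeg y (hmem hy h1 h2), h.degIn_swap_two h.notMem_tail h.adj_tail hl₁ hl₂ hll,
        adjInd_leaf hd₁ hr₁ ha₁ hy, adjInd_leaf hd₂ hr₂ ha₂ hy, h.ind hy, if_neg hyc,
        adjInd_eq_zero.2 fun e => h.not_adj y hy e.symm]
      ring
    have hr₁c : r₁ ≠ c := by rintro rfl; omega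
    have hr₂c : r₂ ≠ c := by rintro rfl; omega
    have hr₁l₁ := ha₁.ne'
    have hr₂l₂ := ha₂.ne'
    have hr₁l₂ : r₁ ≠ l₂ := by rintro rfl; omega
    have hr₂l₁ : r₂ ≠ l₁ := by rintro rfl; omega
    have hre : ∀ {r}, degIn G B r = 2 → e ≠ r := by rintro r hr rfl; omega
    have hq₁c : q₁ ≠ c := by
      rintro rfl; exact hre hrd₁ (eq_of_degIn_le_one hc.le heB hr₁ hce hqr₁)
    have hq₂c : q₂ ≠ c := by
      rintro rfl; exact hre hrd₂ (eq_of_degIn_le_one hc.le heB hr₂ hce hqr₂)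
    have hq₁l₂ := hne hq₁ hqd₁ hqr₁ ha₂
    have hq₂l₁ := (hne hl₁ hd₁ ha₁ hqr₂).symm
    have hq₁r₁ := hqr₁.ne
    have hq₂r₂ := hqr₂.ne
    have hq₁r₂ : q₁ ≠ r₂ := by rintro rfl; omega
    have hq₂r₁ : q₂ ≠ r₁ := by rintro rfl; omega
    have er₁ := hfd hr₁ hr₁l₁ hr₁l₂ hr₁c
    have er₂ := hfd hr₂ hr₂l₁ hr₂l₂ hr₂c
    have eq₁ := hfd hq₁ hql₁ hq₁l₂ hq₁c
    have eq₂ := hfd hq₂ hq₂l₁ hql₂ hq₂c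
    rw [if_pos rfl, if_neg hrr, hrd₁] at er₁
    rw [if_neg hrr.symm, if_pos rfl, hrd₂] at er₂
    rw [if_neg hq₁r₁, if_neg hq₁r₂, hqd₁] at eq₁
    rw [if_neg hq₂r₁, if_neg hq₂r₂, hqd₂] at eq₂
    have mr₁ := hmem hr₁ hr₁l₁ hr₁l₂
    have mr₂ := hmem hr₂ hr₂l₁ hr₂l₂
    have mq₁ := hmem hq₁ hql₁ hq₁l₂
    have mq₂ := hmem hq₂ hq₂l₁ hql₂
    have E₁ := edge (hf.mapsTo mr₁) (hf.mapsTo mq₁) ((hfadj _ mr₁ _ mq₁).2 hqr₁.symm) er₁ eq₁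
    have E₂ := edge (hf.mapsTo mr₂) (hf.mapsTo mq₂) ((hfadj _ mr₂ _ mq₂).2 hqr₂.symm) er₂ eq₂
    have hE : f r₁ = f r₂ ∨ f r₁ = f q₂ := by
      rcases E₁ with ⟨e1, e2⟩ | ⟨e1, e2⟩ <;> rcases E₂ with ⟨e3, e4⟩ | ⟨e3, e4⟩ <;>
        simp [e1, e3, e4]
    rcases hE with hE | hE
    · exact hrr (hf.injOn mr₁ mr₂ hE)
    · exact hq₂r₁ (hf.injOn mr₁ mq₂ hE).symm
  refine ⟨h.eq_two_of_edge_path hB hce ha₁ hqr₁ hql₁.symm hc he hd₁ hrd₁ hqd₁, ?_⟩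
  have hre : e ≠ r₁ := by rintro rfl; omega
  have hrc : c ≠ r₁ := by rintro rfl; omega
  have hqc : c ≠ q₁ := by
    rintro rfl; exact hre (eq_of_degIn_le_one hc.le heB hr₁ hce hqr₁)
  have hqe : e ≠ q₁ := by
    rintro rfl; exact hrc (eq_of_degIn_le_one he.le hcB hr₁ hce.symm hqr₁)
  have hBeq : B = {c, e, l₁, r₁, q₁} := by ext x; simp [hB]
  have h5 := (degSum_five (G := G) hce.ne hlc₁.symm hrc hqc hle₁.symm hre hqe ha₁.ne hql₁.symm
    hqr₁.ne').1
  have := h.card_base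
  rw [hBeq, h5] at this
  rw [← this]
  decide

end TailVertex

end

/-! ### No tail: the base is a matching and a component on three vertices -/

section

open scoped Classical

variable {W : Type*} [Fintype W] {G : SimpleGraph W} {k m : ℕ} {F : Set (Finset W)}

namespace IsolatedVertex

variable {B : Finset W} {u a : W}

/-- The neighbours of the isolated vertex are not joined to the base. -/
theorem eq_two_and_even_of_no_tail (h : IsolatedVertex G k m F B u) (hua : G.Adj u a)
    (hN : ∀ a, G.Adj u a → degIn G B a = 0) : m = 2 ∧ Even k := by
  have hm := h.two_le
  have h5 := h.five_le
  have hBc := h.card_base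
  have hNB : ∀ {w s}, G.Adj u w → s ∈ B → ¬ G.Adj w s := fun {w s} hw hs =>
    degIn_eq_zero.1 (hN w hw) s hs
  have haB : a ∉ B := fun e => h.not_adj a e hua
  have haT : a ∉ insert u B := by simp [hua.ne', haB]
  have h01 := fun x y => adjInd_le_one (G := G) x y
  have h00 := fun x y => adjInd_nonneg (G := G) x y
  have hTc := card_compl_member h.toRainbowFamily h.card_univ h.mem
  obtain ⟨x, hx, hmax⟩ := Finset.exists_max_image B (degIn G B)
    (Finset.card_pos.1 (by omega))
  have hmaxT : ∀ z ∈ insert u B, degIn G (insert u B) z ≤ degIn G (insert u B) x := by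
    intro z hz
    rw [h.degIn_member hx]
    rcases Finset.mem_insert.1 hz with rfl | hzB
    · rw [h.degIn_member_self]; exact degIn_nonneg _ _
    · rw [h.degIn_member hzB]; exact hmax z hzB
  have hux : u ≠ x := fun e => h.notMem (e ▸ hx)
  -- Exchanging `x` and `s` for the edge `ua` adds only that edge; the edges lost cannot exceed
  -- those lost by deleting a vertex of maximum degree.
  have hle : ∀ s ∈ B, s ≠ x → degIn G B s ≤ 1 + adjInd G x s := by
    intro s hs hsx
    obtain ⟨y, hy, hd⟩ := h.exists_degSum h.le_card h.mem
      (h.card_swap_two haB hua hx hs hsx.symm)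
    rw [h.degSum_swap_two haB hua hx hs hsx.symm, h.degSum_member, hN a hua,
      adjInd_eq_zero.2 (hNB hua hx), adjInd_eq_zero.2 (hNB hua hs)] at hd
    have := hmaxT y hy
    rw [h.degIn_member hx] at this
    linarith
  -- If deleting two vertices isolates nothing, they meet just one edge, because the edge `ua`
  -- replaces what they meet. This limits all components of the base.
  have hpair : ∀ s₁ ∈ B, ∀ s₂ ∈ B, s₁ ≠ s₂ → (∀ y ∈ B, y ≠ s₁ → y ≠ s₂ →
      1 ≤ degIn G B y - adjInd G y s₁ - adjInd G y s₂) →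
      degIn G B s₁ + degIn G B s₂ - adjInd G s₁ s₂ = 1 := by
    intro s₁ hs₁ s₂ hs₂ hne hy
    have := h.degIn_of_swap_two haB hua hs₁ hs₂ hne fun y hyB h1 h2 => by
      linarith [hy y hyB h1 h2, h00 y a]
    rw [hN a hua, adjInd_eq_zero.2 (hNB hua hs₁), adjInd_eq_zero.2 (hNB hua hs₂)] at this
    linarith
  have hGle : ∀ D : ℕ, degIn G B x ≤ D → D + 3 ≤ k → ∀ v, degIn G Finset.univ v ≤ D := by
    intro D hD hDk
    refine h.degIn_univ_le h.le_card (fun T hT y hy => ?_) hDk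
    obtain ⟨z, hz, hd⟩ := h.exists_deg hT h.mem hy
    rw [← hd]
    have := hmaxT z hz
    rw [h.degIn_member hx] at this
    linarith
  have hx1 := h.one_le hx
  have hF : ∀ {o s}, o ∉ insert u B → ¬ G.Adj u o → s ∈ B → s ≠ x →
      degIn G B s - adjInd G x s ≤ degIn G B o - adjInd G o x - adjInd G o s := by
    intro o s ho huo hs hsx
    have := h.le_swap_of_max h.le_card h.mem (by simp [hx]) hmaxT (s := s) (by simp [hs])
      hsx.symm ho
    rwa [h.degIn_member hs, degIn_insert h.notMem, adjInd_eq_zero.2 fun e => huo e.symm,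
      zero_add] at this
  -- Then `B` is a perfect matching and degrees in `G` are at most one. Exchange gives a second
  -- outer vertex `o` a neighbour in `B`, which already has its partner there.
  by_cases hx2 : degIn G B x = 1
  · exfalso
    have hG := hGle 1 hx2.le (by omega)
    obtain ⟨o, ho⟩ := Finset.card_pos.1 (show 0 < ((insert u B)ᶜ.erase a).card by
      rw [Finset.card_erase_of_mem (by simpa using haT)]; omega)
    simp only [Finset.mem_erase, Finset.mem_compl] at ho
    obtain ⟨s, hs⟩ := Finset.card_pos.1 (show 0 < ((B.erase x) \ B.filter (G.Adj x)).card by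
      have h1 := Finset.le_card_sdiff (B.filter (G.Adj x)) (B.erase x)
      rw [Finset.card_erase_of_mem hx] at h1
      rw [degIn_eq_card] at hx2
      omega)
    simp only [Finset.mem_sdiff, Finset.mem_erase, Finset.mem_filter, not_and] at hs
    have mate : ∀ {v y z}, G.Adj v y → G.Adj v z → y = z := fun {v y z} h1 h2 =>
      eq_of_degIn_le_one (by exact_mod_cast hG v) (Finset.mem_univ y) (Finset.mem_univ z) h1 h2
    have h1 := hF ho.2 (fun e => ho.1 (mate e hua)) hs.1.2 hs.1.1
    rw [adjInd_eq_zero.2 (hs.2 hs.1.2)] at h1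
    obtain ⟨z, hz, hoz⟩ := degIn_pos.1 (show 0 < degIn G B o by
      linarith [h.one_le hs.1.2, h00 o x, h00 o s])
    obtain ⟨w, hw, hzw⟩ := h.exists_nbr hz
    exact ho.2 (by rw [mate hoz.symm hzw]; simp [hw])
  have hx2' : 2 ≤ degIn G B x := by omega
  have hnbr_ind : ∀ {y z w : W}, degIn G B y ≤ 2 → y ∈ B → z ∈ B → w ∈ B → x ≠ z →
      G.Adj y x → G.Adj y z → w ≠ x → w ≠ z → adjInd G w y = 0 := by
    intro y z w hyd hy hz hw hxz hyx hyz hwx hwz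
    rw [adjInd_eq_zero]
    intro hwy
    have h1 : ({x, z, w} : Finset W) ⊆ B.filter (G.Adj y) := by
      intro v hv
      simp only [Finset.mem_insert, Finset.mem_singleton] at hv
      rw [Finset.mem_filter]
      rcases hv with rfl | rfl | rfl
      · exact ⟨hx, hyx⟩
      · exact ⟨hz, hyz⟩
      · exact ⟨hw, hwy.symm⟩
    have h2 := Finset.card_le_card h1
    rw [Finset.card_eq_three.2 ⟨x, z, w, hxz, hwx.symm, hwz.symm, rfl⟩] at h2
    rw [degIn_eq_card] at hyd
    omega
  have hd2 : ∀ y ∈ B, y ≠ x → degIn G B y ≤ 2 := fun y hy hyx => by linarith [hle y hy hyx, h01 x y]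
  -- a second neighbour of a neighbour of `x` is a neighbour of `x`
  have htri : ∀ y ∈ B, ∀ z ∈ B, G.Adj x y → G.Adj y z → z ≠ x → G.Adj x z := by
    intro y hy z hz hxy hyz hzx
    by_contra hn
    have hzd : degIn G B z = 1 := by
      have h1 := hle z hz hzx
      rw [adjInd_eq_zero.2 hn] at h1
      linarith [h.one_le hz]
    have := hpair y hy z hz hyz.ne fun w hw hwy hwz => by
      rw [adjInd_leaf hzd hy hyz.symm hw, if_neg hwy]
      by_cases hwx : w = x
      · subst hwx; linarith [h01 w y]
      · rw [hnbr_ind (hd2 y hy hxy.ne') hy hz hw hzx.symm hxy.symm hyz hwx hwz]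
        linarith [h.one_le hw]
    rw [hzd, adjInd_eq_one.2 hyz] at this
    have hy2 : ({x, z} : Finset W) ⊆ B.filter (G.Adj y) := by
      intro v hv
      simp only [Finset.mem_insert, Finset.mem_singleton] at hv
      rw [Finset.mem_filter]
      rcases hv with rfl | rfl
      · exact ⟨hx, hxy.symm⟩
      · exact ⟨hz, hyz⟩
    have h2 := Finset.card_le_card hy2
    rw [Finset.card_pair hzx.symm] at h2
    rw [degIn_eq_card] at this
    omega
  have hleafs : ∀ y ∈ B, G.Adj x y → (∀ z ∈ B, G.Adj y z → z = x) → degIn G B y = 1 := by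
    intro y hy hxy hz
    have h1 : B.filter (G.Adj y) ⊆ {x} := fun w hw => by
      rw [Finset.mem_filter] at hw
      simpa using hz w hw.1 hw.2
    have h2 := Finset.card_le_card h1
    have h3 := h.one_le hy
    rw [degIn_eq_card] at h3 ⊢
    simp at h2
    omega
  -- With at least three neighbours, all of them are leaves, for an edge among them could be
  -- deleted; and then two leaves can be deleted without isolating `x`. Both contradict `hpair`.
  have hxeq : degIn G B x = 2 := by
    by_contra hne
    have hx3 : 3 ≤ degIn G B x := by omega
    have hall : ∀ y ∈ B, G.Adj x y → degIn G B y = 1 := by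
      intro y hy hxy
      refine hleafs y hy hxy fun z hz hyz => ?_
      by_contra hzx
      have hxz := htri y hy z hz hxy hyz hzx
      have hyle := hd2 y hy hxy.ne'
      have hzle := hd2 z hz hzx
      have := hpair y hy z hz hyz.ne fun w hw hwy hwz => by
        by_cases hwx : w = x
        · subst hwx; linarith [h01 w y, h01 w z]
        · rw [hnbr_ind hyle hy hz hw (Ne.symm hzx) hxy.symm hyz hwx hwz,
            hnbr_ind hzle hz hy hw hxy.ne hxz.symm hyz.symm hwx hwy]
          linarith [h.one_le hw]
      have hy2 : ({x, z} : Finset W) ⊆ B.filter (G.Adj y) := by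
        intro v hv
        simp only [Finset.mem_insert, Finset.mem_singleton] at hv
        rw [Finset.mem_filter]
        rcases hv with rfl | rfl
        · exact ⟨hx, hxy.symm⟩
        · exact ⟨hz, hyz⟩
      have h2 := Finset.card_le_card hy2
      rw [Finset.card_pair (Ne.symm hzx)] at h2
      have h3 := h.one_le hz
      rw [degIn_eq_card (x := y)] at this
      have := h01 y z
      omega
    obtain ⟨y, hy, z, hz, hyz⟩ := Finset.one_lt_card.1 (show 1 < (B.filter (G.Adj x)).card by
      rw [degIn_eq_card] at hx3; omega)
    rw [Finset.mem_filter] at hy hz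
    have hyd := hall y hy.1 hy.2
    have hzd := hall z hz.1 hz.2
    have := hpair y hy.1 z hz.1 hyz fun w hw hwy hwz => by
      rw [adjInd_leaf hyd hx hy.2.symm hw, adjInd_leaf hzd hx hz.2.symm hw]
      have := h.one_le hw
      split_ifs with hwx
      · subst hwx; linarith
      · linarith
    rw [hyd, hzd] at this
    have hzy : z = x := eq_of_degIn_le_one hyd.le hz.1 hx
      (adjInd_eq_one.1 (show adjInd G y z = 1 by linarith)) hy.2.symm
    exact hz.2.ne hzy.symm
  obtain ⟨b, b', hbb, hNx⟩ := Finset.card_eq_two.1 (show (B.filter (G.Adj x)).card = 2 by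
    rw [degIn_eq_card] at hxeq; exact_mod_cast hxeq)
  have hNx' : ∀ {y}, y ∈ B → (G.Adj x y ↔ y = b ∨ y = b') := fun {y} hy => by
    have : y ∈ B.filter (G.Adj x) ↔ y ∈ ({b, b'} : Finset W) := by rw [hNx]
    simpa [hy] using this
  have hb : b ∈ B ∧ G.Adj x b := Finset.mem_filter.1 (show b ∈ B.filter (G.Adj x) by simp [hNx])
  have hb' : b' ∈ B ∧ G.Adj x b' :=
    Finset.mem_filter.1 (show b' ∈ B.filter (G.Adj x) by simp [hNx])
  set C := B \ {x, b, b'} with hC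
  have hCmem : ∀ {s}, s ∈ C ↔ s ∈ B ∧ s ≠ x ∧ s ≠ b ∧ s ≠ b' := fun {s} => by simp [hC]
  have hxC : ∀ {s}, s ∈ C → ¬ G.Adj x s := fun {s} hs e => by
    rw [hCmem] at hs
    have := (hNx' hs.1).1 e
    tauto
  have hCd : ∀ {s}, s ∈ C → degIn G B s = 1 := fun {s} hs => by
    have h1 := hCmem.1 hs
    have h2 := hle s h1.1 h1.2.1
    rw [adjInd_eq_zero.2 (hxC hs)] at h2
    linarith [h.one_le h1.1]
  have hCnbr : ∀ {s}, s ∈ C → ∃ s' ∈ C, G.Adj s s' := fun {s} hs => by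
    have h1 := hCmem.1 hs
    obtain ⟨q, hq, hsq⟩ := h.exists_nbr h1.1
    refine ⟨q, hCmem.2 ⟨hq, ?_, ?_, ?_⟩, hsq⟩
    · rintro rfl; exact hxC hs hsq.symm
    · rintro rfl; exact hxC hs (htri q hq s h1.1 hb.2 hsq.symm h1.2.1)
    · rintro rfl; exact hxC hs (htri q hq s h1.1 hb'.2 hsq.symm h1.2.1)
  have hbdeg : degIn G B b = 1 + adjInd G b b' ∧ degIn G B b' = 1 + adjInd G b b' := by
    have key : ∀ {b b' : W}, b ∈ B → b' ∈ B → G.Adj x b → G.Adj x b' →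
        (∀ {y}, y ∈ B → (G.Adj x y ↔ y = b ∨ y = b')) → degIn G B b = 1 + adjInd G b b' := by
      intro b b' hb hb' hxb hxb' hNx'
      by_cases hadj : G.Adj b b'
      · have h1 := hd2 b hb hxb.ne'
        have hb2 : ({x, b'} : Finset W) ⊆ B.filter (G.Adj b) := by
          intro v hv
          simp only [Finset.mem_insert, Finset.mem_singleton] at hv
          rw [Finset.mem_filter]
          rcases hv with rfl | rfl
          · exact ⟨hx, hxb.symm⟩
          · exact ⟨hb', hadj⟩
        have h2 := Finset.card_le_card hb2
        rw [Finset.card_pair hxb'.ne] at h2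
        rw [adjInd_eq_one.2 hadj]
        rw [degIn_eq_card] at h1 ⊢
        omega
      · rw [adjInd_eq_zero.2 hadj]
        refine hleafs b hb hxb fun z hz hbz => ?_
        by_contra hzx
        rcases (hNx' hz).1 (htri b hb z hz hxb hbz hzx) with rfl | rfl
        · exact hbz.ne rfl
        · exact hadj hbz
    refine ⟨key hb.1 hb'.1 hb.2 hb'.2 hNx', ?_⟩
    rw [adjInd_comm]
    exact key hb'.1 hb.1 hb'.2 hb.2 fun {y} hy => (hNx' hy).trans or_comm
  have hsub : ({x, b, b'} : Finset W) ⊆ B := by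
    intro w hw
    simp only [Finset.mem_insert, Finset.mem_singleton] at hw
    rcases hw with rfl | rfl | rfl
    exacts [hx, hb.1, hb'.1]
  have hcard3 : ({x, b, b'} : Finset W).card = 3 :=
    Finset.card_eq_three.2 ⟨x, b, b', hb.2.ne, hb'.2.ne, hbb, rfl⟩
  have hCc : C.card + 3 = B.card := by
    rw [hC, Finset.card_sdiff_of_subset hsub, hcard3]
    have := Finset.card_le_card hsub
    omega
  have hkeven : Even k := by
    have h1 := even_degSum (G := G) B
    have h2 : degSum G B = (C.card : ℤ) + (2 + (1 + adjInd G b b') + (1 + adjInd G b b')) := by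
      unfold degSum
      rw [← Finset.sum_sdiff hsub, ← hC, Finset.sum_congr rfl fun s hs => hCd hs, Finset.sum_const,
        nsmul_eq_mul, mul_one, Finset.sum_insert (by simp [hb.2.ne, hb'.2.ne]),
        Finset.sum_pair hbb, hxeq, hbdeg.1, hbdeg.2]
      ring
    rw [h2] at h1
    obtain ⟨r, hr⟩ := h1
    refine (Nat.even_iff).2 ?_
    omega
  refine ⟨?_, hkeven⟩
  by_contra hm2
  have hk6 : 6 ≤ k := by obtain ⟨r, hr⟩ := hkeven; omega
  have hG := hGle 2 hxeq.le (by omega)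
  have three : ∀ {x y₁ y₂ y₃}, G.Adj x y₁ → G.Adj x y₂ → y₁ ≠ y₂ → y₃ ≠ y₁ → y₃ ≠ y₂ →
      ¬ G.Adj x y₃ := fun {x y₁ y₂ y₃} h1 h2 =>
    TailVertex.not_adj_of_degIn_univ_le_two (by exact_mod_cast hG x) h1 h2
  -- `u` has at most two neighbours, so with three outer vertices one of them is not adjacent to
  -- `u`.
  obtain ⟨o, ho⟩ := Finset.card_pos.1 (show 0 < ((insert u B)ᶜ \
      Finset.univ.filter (G.Adj u)).card by
    have h1 := Finset.le_card_sdiff (Finset.univ.filter (G.Adj u)) (insert u B)ᶜ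
    have h2 := hG u
    rw [degIn_eq_card] at h2
    omega)
  simp only [Finset.mem_sdiff, Finset.mem_compl, Finset.mem_filter, Finset.mem_univ,
    true_and] at ho
  have noB : ∀ {o y}, o ∉ insert u B → y ∈ B → o ≠ y := fun ho hy e => ho (by simp [e, hy])
  have hox : ∀ {o}, o ∉ insert u B → ¬ G.Adj o x := fun {o} ho e =>
    three hb.2 hb'.2 hbb (noB ho hb.1) (noB ho hb'.1) e.symm
  have hFC : ∀ {o s}, o ∉ insert u B → ¬ G.Adj u o → s ∈ C → 1 + adjInd G o s ≤ degIn G B o := by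
    intro o s ho huo hs
    have h1 := hCmem.1 hs
    have h2 := hF ho huo h1.1 h1.2.1
    rw [hCd hs, adjInd_eq_zero.2 (hxC hs), adjInd_eq_zero.2 (hox ho)] at h2
    linarith
  have hX : ∀ {o s}, o ∉ insert u B → s ∈ B → degIn G B o - adjInd G o s ≤ degIn G B s :=
    fun ho hs => h.exchange (fun e => ho (by simp [e])) (fun e => ho (by simp [e])) hs
  -- an outer vertex joined to the matching part is joined to a whole edge of it
  have hmate : ∀ {o s s'}, o ∉ insert u B → ¬ G.Adj u o → s ∈ C → s' ∈ C → G.Adj o s → G.Adj s s' →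
      G.Adj o s' := by
    intro o s s' ho huo hs hs' hos hss
    have h1 := hFC ho huo hs
    have h2 := hX ho (hCmem.1 hs').1
    rw [adjInd_eq_one.2 hos] at h1
    rw [hCd hs'] at h2
    exact adjInd_eq_one.1 (le_antisymm (h01 _ _) (by linarith))
  obtain ⟨s, hs⟩ := Finset.card_pos.1 (show 0 < C.card by omega)
  obtain ⟨s', hs', hss⟩ := hCnbr hs
  by_cases hadj : G.Adj b b'
  · rw [adjInd_eq_one.2 hadj] at hbdeg
    have hob : ∀ {o}, o ∉ insert u B → ¬ G.Adj o b := fun {o} ho e =>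
      three hb.2.symm hadj hb'.2.ne (noB ho hx) (noB ho hb'.1) e.symm
    have hob' : ∀ {o}, o ∉ insert u B → ¬ G.Adj o b' := fun {o} ho e =>
      three hb'.2.symm hadj.symm hb.2.ne (noB ho hx) (noB ho hb.1) e.symm
    -- The triangle is saturated, so the neighbours of `o` lie in `C`; having two more than `degIn G
    -- B t - 1` there forces adjacency to each `t`. As degrees are at most two, `C` is one edge, and
    -- `o` is the only outer vertex not adjacent to `u`.
    have hall : ∀ {o}, o ∉ insert u B → ¬ G.Adj u o → ∀ t ∈ C, G.Adj o t := by
      intro o ho huo t ht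
      obtain ⟨z, hz, hoz⟩ := degIn_pos.1 (show 0 < degIn G B o by
        linarith [hFC ho huo hs, h00 o s])
      have hzC : z ∈ C := hCmem.2 ⟨hz, fun e => hox ho (e ▸ hoz), fun e => hob ho (e ▸ hoz),
        fun e => hob' ho (e ▸ hoz)⟩
      have h1 := hFC ho huo hzC
      have h2 := hX ho (hCmem.1 ht).1
      rw [adjInd_eq_one.2 hoz] at h1
      rw [hCd ht] at h2
      exact adjInd_eq_one.1 (le_antisymm (h01 _ _) (by linarith))
    have hCeq : ∀ t ∈ C, t = s ∨ t = s' := by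
      intro t ht
      by_contra! hcon
      exact three (hall ho.1 ho.2 s hs) (hall ho.1 ho.2 s' hs') hss.ne hcon.1 hcon.2
        (hall ho.1 ho.2 t ht)
    have hCle : C.card ≤ 2 := by
      have h1 : C ⊆ {s, s'} := fun t ht => by simpa using hCeq t ht
      exact (Finset.card_le_card h1).trans Finset.card_le_two
    have houniq : ∀ {w}, w ∉ insert u B → w ≠ o → G.Adj u w := by
      intro w hw hwo
      by_contra hn
      exact three hss (hall ho.1 ho.2 s hs).symm (noB ho.1 (hCmem.1 hs').1).symm
        (noB hw (hCmem.1 hs').1) hwo (hall hw hn s hs).symm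
    have hou : o ≠ u := fun e => ho.1 (by simp [e])
    have hb'u : b' ≠ u := fun e => h.notMem (e ▸ hb'.1)
    have hs1 := hCmem.1 hs
    have hs1' := hCmem.1 hs'
    -- The private vertices `b'`, `o`, `u` are each joined to a whole class: `b'` to `{x, b}`, `o`
    -- to `{s, s'}`, and `u` to the rest. A rainbow member therefore has no isolated vertex.
    let col : W → Fin 3 := fun w => if w = x ∨ w = b then 0 else if w = s ∨ w = s' then 1 else 2
    obtain ⟨T, hT, hST, hinj⟩ := h.exists_superset (r := 3) {b', o, u} (by
      rw [Finset.card_eq_three.2 ⟨b', o, u, (noB ho.1 hb'.1).symm, hb'u, hou, rfl⟩]; omega) col (by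
        intro i
        fin_cases i
        · exact ⟨x, by simp [hb'.2.ne, (noB ho.1 hx).symm, hux.symm], by simp [col]⟩
        · refine ⟨s, ?_, ?_⟩
          · simp only [Finset.mem_insert, Finset.mem_singleton, not_or]
            exact ⟨hs1.2.2.2, (noB ho.1 hs1.1).symm, fun e => h.notMem (e ▸ hs1.1)⟩
          · simp [col, hs1]
        · refine ⟨a, ?_, ?_⟩
          · simp only [Finset.mem_insert, Finset.mem_singleton, not_or]
            exact ⟨noB haT hb'.1, fun e => ho.2 (e ▸ hua), hua.ne'⟩
          · simp [col, noB haT hx, noB haT hb.1, noB haT hs1.1, noB haT hs1'.1])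
    have himg : (T \ {b', o, u}).image col = Finset.univ := by
      apply Finset.eq_univ_of_card
      rw [Finset.card_image_of_injOn hinj, Finset.card_sdiff_of_subset hST, h.card T hT,
        Finset.card_eq_three.2 ⟨b', o, u, (noB ho.1 hb'.1).symm, hb'u, hou, rfl⟩]
      simp; omega
    have hget : ∀ i, ∃ w ∈ T, w ∉ ({b', o, u} : Finset W) ∧ col w = i := fun i => by
      have : i ∈ (T \ {b', o, u}).image col := by simp [himg]
      obtain ⟨w, hw, e⟩ := Finset.mem_image.1 this
      rw [Finset.mem_sdiff] at hw
      exact ⟨w, hw.1, hw.2, e⟩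
    have hcls : ∀ w, w ∉ ({b', o, u} : Finset W) →
        (w = x ∨ w = b) ∨ (w = s ∨ w = s') ∨ G.Adj u w := by
      intro w hw
      simp only [Finset.mem_insert, Finset.mem_singleton, not_or] at hw
      by_contra! hcon
      refine hcon.2.2 (houniq ?_ hw.2.1)
      intro hwT
      have hwB := (Finset.mem_insert.1 hwT).resolve_left hw.2.2
      have := hCeq w (hCmem.2 ⟨hwB, hcon.1.1, hcon.1.2, hw.1⟩)
      tauto
    have hadj1 : ∀ {w}, w = x ∨ w = b → G.Adj b' w := by
      rintro w (rfl | rfl)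
      exacts [hb'.2.symm, hadj.symm]
    have hadj2 : ∀ {w}, w = s ∨ w = s' → G.Adj o w := by
      rintro w (rfl | rfl)
      exacts [hall ho.1 ho.2 _ hs, hall ho.1 ho.2 _ hs']
    obtain ⟨z, hz, hzd⟩ := h.exists_deg h.mem hT (x := u) (by simp)
    rw [h.degIn_member_self, degIn_eq_zero] at hzd
    by_cases hzS : z ∈ ({b', o, u} : Finset W)
    · simp only [Finset.mem_insert, Finset.mem_singleton] at hzS
      rcases hzS with rfl | rfl | rfl
      · obtain ⟨w, hw, hwS, hcw⟩ := hget 0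
        refine hzd w hw (hadj1 ?_)
        by_contra hn
        by_cases h2 : w = s ∨ w = s' <;> simp [col, hn, h2] at hcw
      · obtain ⟨w, hw, hwS, hcw⟩ := hget 1
        refine hzd w hw (hadj2 ?_)
        by_contra hn
        by_cases h2 : w = x ∨ w = b <;> simp [col, hn, h2] at hcw
      · obtain ⟨w, hw, hwS, hcw⟩ := hget 2
        rcases hcls w hwS with h1 | h1 | h1
        · simp [col, h1] at hcw
        · by_cases h2 : w = x ∨ w = b <;> simp [col, h1, h2] at hcw
        · exact hzd w hw h1
    · rcases hcls z hzS with h1 | h1 | h1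
      · exact hzd b' (hST (by simp)) (hadj1 h1).symm
      · exact hzd o (hST (by simp)) (hadj2 h1).symm
      · exact hzd u (hST (by simp)) h1.symm
  · rw [adjInd_eq_zero.2 hadj] at hbdeg
    have hnC : ∀ {o}, o ∉ insert u B → ¬ G.Adj u o → ∀ t ∈ C, ¬ G.Adj o t := by
      intro o ho huo t ht hot
      obtain ⟨t', ht', htt⟩ := hCnbr ht
      have hot' := hmate ho huo ht ht' hot htt
      have h1 := hFC ho huo ht
      rw [adjInd_eq_one.2 hot] at h1
      have h2 := hX ho hb.1
      rw [hbdeg.1] at h2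
      have hob : G.Adj o b := adjInd_eq_one.1 (le_antisymm (h01 _ _) (by linarith))
      exact three hot hot' htt.ne (fun e => (hCmem.1 ht).2.2.1 e.symm)
        (fun e => (hCmem.1 ht').2.2.1 e.symm) hob
    have hdo : degIn G B o ≤ 1 := by
      have := hX ho.1 (hCmem.1 hs).1
      rw [hCd hs, adjInd_eq_zero.2 (hnC ho.1 ho.2 s hs)] at this
      linarith
    -- An end of the path `b x b'` not adjacent to `o`. In `B - x - s' + u + o` the vertices `u`,
    -- `s`, `q` are isolated, so the extending vertex must be joined to two of them; each choice is
    -- excluded by `hNB` or `hnC`.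
    obtain ⟨q, hq, hxq, hqd, hoq, hqs, hqs'⟩ : ∃ q ∈ B, G.Adj x q ∧ degIn G B q = 1 ∧ ¬ G.Adj o q ∧
        q ≠ s ∧ q ≠ s' := by
      have hs1 := hCmem.1 hs
      have hs1' := hCmem.1 hs'
      by_cases hob : G.Adj o b
      · exact ⟨b', hb'.1, hb'.2, by linarith [hbdeg.2],
          fun e => hbb (eq_of_degIn_le_one hdo hb.1 hb'.1 hob e), hs1.2.2.2.symm, hs1'.2.2.2.symm⟩
      · exact ⟨b, hb.1, hb.2, by linarith [hbdeg.1], hob, hs1.2.2.1.symm, hs1'.2.2.1.symm⟩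
    have hs1 := hCmem.1 hs
    have hs1' := hCmem.1 hs'
    have hou : o ≠ u := fun e => ho.1 (by simp [e])
    have hoB : o ∉ B := fun e => ho.1 (by simp [e])
    have hus : u ≠ s := fun e => h.notMem (e ▸ hs1.1)
    have huq : u ≠ q := fun e => h.notMem (e ▸ hq)
    have m1 : s' ∈ B.erase x := by simp [hs1'.2.1, hs1'.1]
    have m2 : u ∉ (B.erase x).erase s' := by simp [h.notMem]
    have m3 : o ∉ insert u ((B.erase x).erase s') := by simp [hou, hoB]
    set S := insert o (insert u ((B.erase x).erase s')) with hS
    have hSd : ∀ w, degIn G S w =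
        adjInd G w o + (adjInd G w u + (degIn G B w - adjInd G w x - adjInd G w s')) := fun w => by
      rw [hS, degIn_insert m3, degIn_insert m2, degIn_erase m1, degIn_erase hx]
    obtain ⟨v, hv, hFv⟩ := h.exists_insert S (by
      rw [hS, Finset.card_insert_of_notMem m3, Finset.card_insert_of_notMem m2,
        Finset.card_erase_add_one m1, Finset.card_erase_add_one hx, hBc]) h.le_card
    have zu : degIn G S u = 0 := by
      rw [hSd, adjInd_eq_zero.2 ho.2, adjInd_self, h.degIn_base,
        adjInd_eq_zero.2 (h.not_adj x hx), adjInd_eq_zero.2 (h.not_adj s' hs1'.1)]; rfl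
    have zs : degIn G S s = 0 := by
      rw [hSd, adjInd_eq_zero.2 fun e => hnC ho.1 ho.2 s hs e.symm,
        adjInd_eq_zero.2 fun e => h.not_adj s hs1.1 e.symm, hCd hs,
        adjInd_eq_zero.2 fun e => hxC hs e.symm, adjInd_eq_one.2 hss]; rfl
    have zq : degIn G S q = 0 := by
      rw [hSd, adjInd_eq_zero.2 fun e => hoq e.symm,
        adjInd_eq_zero.2 fun e => h.not_adj q hq e.symm, hqd, adjInd_eq_one.2 hxq.symm,
        adjInd_leaf (hCd hs') hs1.1 hss.symm hq, if_neg hqs]; rfl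
    have hSu : u ∈ S := by simp [hS]
    have hSs : s ∈ S := by simp [hS, hs1.2.1, hss.ne, hs1.1]
    have hSq : q ∈ S := by simp [hS, hxq.ne', hqs', hq]
    have hiso : ∀ {w w'}, w ∈ S → w' ∈ S → degIn G S w = 0 → degIn G S w' = 0 → w ≠ w' →
        ¬ G.Adj w v → G.Adj w' v := by
      intro w w' hw hw' hd hd' hne hn
      by_contra hn'
      refine hne (h.unique _ hFv w (by simp [hw]) w' (by simp [hw']) ?_ ?_)
      · rw [degIn_insert hv, hd, adjInd_eq_zero.2 hn]; rfl
      · rw [degIn_insert hv, hd', adjInd_eq_zero.2 hn']; rfl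
    by_cases huv : G.Adj u v
    · exact hNB huv hs1.1 (hiso hSq hSs zq zs hqs fun e => hNB huv hq e.symm).symm
    · have hsv := hiso hSu hSs zu zs hus huv
      have hqv := hiso hSu hSq zu zq huq huv
      have hvB : v ∉ B := by
        intro hvB
        have hv' : v = x ∨ v = s' := by
          by_contra! hcon
          exact hv (by simp [hS, hcon, hvB])
        rcases hv' with rfl | rfl
        · exact hxC hs hsv.symm
        · exact hqs (eq_of_degIn_le_one (hCd hs').le hq hs1.1 hqv.symm hsv.symm)
      have hvT : v ∉ insert u B := by
        simp only [Finset.mem_insert, not_or]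
        exact ⟨fun e => hv (e ▸ hSu), hvB⟩
      exact hnC hvT huv s hs hsv.symm

/-- A neighbour of `u` has at most one neighbour in the base; if some neighbour has one, it is a
tail. -/
theorem eq_two_and_even (h : IsolatedVertex G k m F B u) (hua : G.Adj u a) : m = 2 ∧ Even k := by
  by_cases hN : ∀ a, G.Adj u a → degIn G B a = 0
  · exact h.eq_two_and_even_of_no_tail hua hN
  · push Not at hN
    obtain ⟨w, hw, hwd⟩ := hN
    have hwB : w ∉ B := fun e => h.not_adj w e hw
    have h1 := h.degIn_base_le_two hwB hw
    have h2 := h.degIn_base_ne_two hwB hw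
    have h3 := degIn_nonneg (G := G) B w
    have h4 : degIn G B w = 1 := by omega
    obtain ⟨c, hc, hwc⟩ := degIn_pos.1 (show 0 < degIn G B w by omega)
    exact TailVertex.eq_two_and_even (a := w) (c := c)
      { toIsolatedVertex := h
        notMem_tail := hwB
        adj_tail := hw
        mem_base := hc
        adj_base := hwc
        deg_tail := h4 }

end IsolatedVertex

/-! ### Combining the cases -/

namespace ProperFamily

theorem eq_two_and_even_of_isolated (h : ProperFamily G k m F) {T : Finset W} (hT : T ∈ F) {p : W}
    (hp : p ∈ T) (hpd : degIn G T p = 0) : m = 2 ∧ Even k := by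
  by_cases huniq : ∀ T ∈ F, ∀ x ∈ T, ∀ y ∈ T, degIn G T x = 0 → degIn G T y = 0 → x = y
  · obtain ⟨T', hT', u, hu, hud, hpos⟩ := h.exists_isolated_not_isolated fun T' hT' => by
      obtain ⟨q, hq, hqd⟩ := h.exists_deg hT hT' hp
      exact ⟨q, hq, by rw [hqd, hpd], fun r hr hrd => huniq T' hT' r hr q hq hrd (by rw [hqd, hpd])⟩
    obtain ⟨a, -, hua⟩ := degIn_pos.1 hpos
    exact IsolatedVertex.eq_two_and_even (B := T'.erase u) (u := u) (a := a)
      { toProperFamily := h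
        unique := huniq
        card_base := by rw [Finset.card_erase_add_one hu, h.card T' hT']
        notMem := Finset.notMem_erase u T'
        not_adj := fun s hs => degIn_eq_zero.1 hud s (Finset.mem_of_mem_erase hs)
        mem := by rwa [Finset.insert_erase hu] } hua
  · push Not at huniq
    obtain ⟨T', hT', x, hx, y, hy, hxd, hyd, hne⟩ := huniq
    exact h.eq_two_and_even_of_two_isolated hT' hx hy hne hxd hyd

/-- In a non-exceptional family with at least two extra vertices there are exactly two, and the
members have even order. -/
theorem eq_two_and_even (h : ProperFamily G k m F) : m = 2 ∧ Even k := by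
  by_cases h0 : ∃ T ∈ F, ∃ x ∈ T, degIn G T x = 0
  · obtain ⟨T, hT, x, hx, hd⟩ := h0
    exact h.eq_two_and_even_of_isolated hT hx hd
  by_cases h1 : ∃ T ∈ F, ∃ x ∈ T, degIn G T x = k - 1
  · obtain ⟨T, hT, x, hx, hd⟩ := h1
    exact h.compl.eq_two_and_even_of_isolated hT hx
      (by rw [degIn_compl_of_mem T hx, hd, h.card T hT]; ring)
  push Not at h0 h1
  refine h.eq_two_and_even_of_bounds fun T hT x hx => ⟨?_, ?_⟩
  · have := h0 T hT x hx
    have := degIn_nonneg (G := G) T x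
    omega
  · have := h1 T hT x hx
    have h2 := degIn_le_card_sub_one (G := G) hx
    rw [h.card T hT] at h2
    omega

end ProperFamily

end

/-! ### From arrowing to rainbow families -/

section

open scoped Classical

variable {V W : Type*} [Fintype V]

theorem isExceptional_or_compl_of_three {V : Type*} {H : SimpleGraph V} {a b c : V} (hab : a ≠ b) (hac : a ≠ c)
    (hbc : b ≠ c) (hV : ∀ x, x = a ∨ x = b ∨ x = c) : IsExceptional H ∨ IsExceptional Hᶜ := by
  have key : H = ⊤ ∨ IsStar H ∨ Hᶜ = ⊤ ∨ IsStar Hᶜ := by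
    have top : ∀ K : SimpleGraph V, K.Adj a b → K.Adj a c → K.Adj b c → K = ⊤ := by
      intro K h1 h2 h3
      ext x y
      refine ⟨fun h => h.ne, fun h => ?_⟩
      rcases hV x with rfl | rfl | rfl <;> rcases hV y with rfl | rfl | rfl <;>
        first | exact absurd rfl h | assumption | (rw [K.adj_comm]; assumption)
    have star : ∀ (K : SimpleGraph V) {r s t : V}, r ≠ s → r ≠ t → s ≠ t →
        (∀ x, x = r ∨ x = s ∨ x = t) → K.Adj r s → K.Adj r t → ¬ K.Adj s t → IsStar K := by
      intro K r s t hrs hrt hst hK h1 h2 h3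
      refine ⟨r, ?_⟩
      ext x y
      rcases hK x with rfl | rfl | rfl <;> rcases hK y with rfl | rfl | rfl <;>
        simp_all [K.adj_comm, eq_comm]
    have hc : ∀ {x y : V}, x ≠ y → (Hᶜ.Adj x y ↔ ¬ H.Adj x y) := fun h => by simp [h]
    by_cases h1 : H.Adj a b <;> by_cases h2 : H.Adj a c <;> by_cases h3 : H.Adj b c
    · exact .inl (top H h1 h2 h3)
    · exact .inr (.inl (star H hab hac hbc hV h1 h2 h3))
    · exact .inr (.inl (star H hab.symm hbc hac (fun x => by have := hV x; tauto) h1.symm h3 h2))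
    · refine .inr (.inr (.inr (star Hᶜ hac.symm hbc.symm hab (fun x => by have := hV x; tauto) ?_ ?_ ?_)))
      · rwa [hc hac.symm, H.adj_comm]
      · rwa [hc hbc.symm, H.adj_comm]
      · simp [h1]
    · exact .inr (.inl (star H hac.symm hbc.symm hab (fun x => by have := hV x; tauto) h2.symm h3.symm h1))
    · refine .inr (.inr (.inr (star Hᶜ hab.symm hbc hac (fun x => by have := hV x; tauto) ?_ ?_ ?_)))
      · rwa [hc hab.symm, H.adj_comm]
      · rwa [hc hbc]
      · simp [h2]
    · refine .inr (.inr (.inr (star Hᶜ hab hac hbc hV ?_ ?_ ?_)))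
      · rwa [hc hab]
      · rwa [hc hac]
      · simp [h3]
    · refine .inr (.inr (.inl (top Hᶜ ?_ ?_ ?_)))
      · rwa [hc hab]
      · rwa [hc hac]
      · rwa [hc hbc]
  unfold IsExceptional
  tauto

theorem isExceptional_or_compl_of_card_le {H : SimpleGraph V} (h : Fintype.card V ≤ 3) :
    IsExceptional H ∨ IsExceptional Hᶜ := by
  by_cases h3 : Fintype.card V = 3
  · rw [← Finset.card_univ, Finset.card_eq_three] at h3
    obtain ⟨a, b, c, hab, hac, hbc, hu⟩ := h3
    refine isExceptional_or_compl_of_three hab hac hbc fun x => ?_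
    have := Finset.mem_univ x
    rw [hu] at this
    simpa using this
  by_cases h2 : Fintype.card V = 2
  · rw [← Finset.card_univ, Finset.card_eq_two] at h2
    obtain ⟨a, b, hab, hu⟩ := h2
    have hV : ∀ x : V, x = a ∨ x = b := fun x => by
      have := Finset.mem_univ x
      rw [hu] at this
      simpa using this
    have top : ∀ K : SimpleGraph V, K.Adj a b → K = ⊤ := by
      intro K h1
      ext x y
      refine ⟨fun h => h.ne, fun h => ?_⟩
      rcases hV x with rfl | rfl <;> rcases hV y with rfl | rfl <;>
        first | exact absurd rfl h | assumption | (rw [K.adj_comm]; assumption)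
    by_cases hH : H.Adj a b
    · exact .inl (.inl (top H hH))
    · exact .inr (.inl (top Hᶜ (by simp [hab, hH])))
  · have : Subsingleton V := Fintype.card_le_one_iff_subsingleton.mp (by omega)
    exact .inl (.inl (Subsingleton.elim _ _))

/-- The vertex sets of the induced copies of `H` in `G`. -/
def copies (G : SimpleGraph W) (H : SimpleGraph V) : Set (Finset W) :=
  {T | ∃ φ : H ↪g G, T = Finset.univ.map φ.toEmbedding}

theorem Arrows.rainbowFamily {G : SimpleGraph W} {H : SimpleGraph V} (h : Arrows G H) :
    RainbowFamily G (Fintype.card V) (copies G H) where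
  card := by
    rintro _ ⟨φ, rfl⟩
    simp
  iso := by
    rintro _ ⟨φ, rfl⟩ _ ⟨ψ, rfl⟩
    by_cases hV : Nonempty V
    · have hinv : ∀ v, Function.invFun φ (φ v) = v := Function.leftInverse_invFun φ.injective
      refine ⟨fun x => ψ (Function.invFun φ x), ⟨?_, ?_, ?_⟩, ?_⟩
      · intro x hx
        simp
      · intro x hx y hy hxy
        obtain ⟨v, rfl⟩ : ∃ v, φ v = x := by simpa using hx
        obtain ⟨w, rfl⟩ : ∃ v, φ v = y := by simpa using hy
        simp only [hinv] at hxy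
        rw [ψ.injective hxy]
      · intro y hy
        obtain ⟨w, rfl⟩ : ∃ v, ψ v = y := by simpa using hy
        exact ⟨φ w, by simp, by simp [hinv]⟩
      · intro x hx y hy
        obtain ⟨v, rfl⟩ : ∃ v, φ v = x := by simpa using hx
        obtain ⟨w, rfl⟩ : ∃ v, φ v = y := by simpa using hy
        simp only [hinv, SimpleGraph.Embedding.map_adj_iff]
    · rw [not_nonempty_iff] at hV
      exact ⟨id, by simp [Set.bijOn_empty_iff_left], by simp⟩
  rainbow := by
    intro c hc
    obtain ⟨φ, hφ⟩ := h c hc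
    refine ⟨_, ⟨φ, rfl⟩, ?_⟩
    intro x hx y hy hxy
    obtain ⟨v, rfl⟩ : ∃ v, φ v = x := by simpa using hx
    obtain ⟨w, rfl⟩ : ∃ v, φ v = y := by simpa using hy
    exact congrArg φ (hφ hxy)

theorem ExceptionalOn.isExceptional {G : SimpleGraph W} {H : SimpleGraph V} (φ : H ↪g G)
    (h : ExceptionalOn G (Finset.univ.map φ.toEmbedding)) : IsExceptional H := by
  rcases h with h | ⟨r, hr, h⟩ | ⟨a, b, c, d, hT, hab, hac, had, hbc, hbd, hcd, h⟩
  · left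
    ext x y
    have := h (φ x) (by simp) (φ y) (by simp)
    simp only [ne_eq, φ.injective.eq_iff, SimpleGraph.Embedding.map_adj_iff] at this
    exact ⟨fun h => h.ne, fun h => this h⟩
  · obtain ⟨r, rfl⟩ : ∃ v, φ v = r := by simpa using hr
    refine .inr (.inl ⟨r, ?_⟩)
    ext x y
    have := h (φ x) (by simp) (φ y) (by simp)
    simpa only [ne_eq, φ.injective.eq_iff, SimpleGraph.Embedding.map_adj_iff,
      SimpleGraph.starGraph_adj] using this
  · have hmem : ∀ x, x ∈ Finset.univ.map φ.toEmbedding ↔ x = a ∨ x = b ∨ x = c ∨ x = d := by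
      rw [hT]; simp
    obtain ⟨a, rfl⟩ : ∃ v, φ v = a := by simpa using (hmem a).2 (by simp)
    obtain ⟨b, rfl⟩ : ∃ v, φ v = b := by simpa using (hmem b).2 (by simp)
    obtain ⟨c, rfl⟩ : ∃ v, φ v = c := by simpa using (hmem c).2 (by simp)
    obtain ⟨d, rfl⟩ : ∃ v, φ v = d := by simpa using (hmem d).2 (by simp)
    have hV : ∀ x, x = a ∨ x = b ∨ x = c ∨ x = d := by
      intro x
      have := (hmem (φ x)).1 (by simp)
      simpa only [φ.injective.eq_iff] using this
    simp only [SimpleGraph.Embedding.map_adj_iff, ne_eq, φ.injective.eq_iff] at *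
    obtain ⟨h1, h2, h3, h4, h5, h6⟩ := h
    refine .inr (.inr ⟨SimpleGraph.Iso.symm ⟨Equiv.ofBijective
      (Sum.elim ![a, b, c] fun _ => d) ⟨?_, ?_⟩, ?_⟩⟩)
    · rintro (x | x) (y | y) hxy <;> fin_cases x <;> fin_cases y <;> simp_all [eq_comm]
    · intro x
      rcases hV x with rfl | rfl | rfl | rfl
      · exact ⟨.inl 0, rfl⟩
      · exact ⟨.inl 1, rfl⟩
      · exact ⟨.inl 2, rfl⟩
      · exact ⟨.inr 0, rfl⟩
    · intro x y
      change H.Adj (Sum.elim ![a, b, c] (fun _ => d) x) (Sum.elim ![a, b, c] (fun _ => d) y) ↔ _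
      revert x y
      rintro (x | x) (y | y) <;> fin_cases x <;> fin_cases y <;>
        simp_all [SimpleGraph.pathGraph_adj, H.adj_comm]

/-- The copies of a non-exceptional `H` form a proper family with `m = |W| - k`. Non-exceptional
graphs have at least four vertices because every smaller graph, or its complement, is complete or a
star. -/
theorem Arrows.card_le {G : SimpleGraph W} {H : SimpleGraph V} [Fintype W] (h : Arrows G H)
    (hH : ¬ (IsExceptional H ∨ IsExceptional Hᶜ))
    (hlt : Fintype.card V + 2 ≤ Fintype.card W) :
    Fintype.card W = Fintype.card V + 2 ∧ Even (Fintype.card V) := by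
  have hF : ProperFamily G (Fintype.card V) (Fintype.card W - Fintype.card V) (copies G H) :=
    { h.rainbowFamily with
      card_univ := by omega
      two_le := by omega
      four_le := by
        by_contra hc
        exact hH (isExceptional_or_compl_of_card_le (by omega))
      not_exceptional := by
        rintro _ ⟨φ, rfl⟩ he
        exact hH (.inl (he.isExceptional φ))
      not_exceptional_compl := by
        rintro _ ⟨φ, rfl⟩ he
        exact hH (.inr (ExceptionalOn.isExceptional (G := Gᶜ) (H := Hᶜ)
          ⟨φ.toEmbedding, by intro x y; simp [φ.injective.eq_iff]⟩ he)) }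
  obtain ⟨h1, h2⟩ := hF.eq_two_and_even
  exact ⟨by omega, h2⟩

theorem antiRamsey_le {H : SimpleGraph V} {b : ℕ} (h : ∀ n ∈ arrowOrders H, n ≤ b) :
    antiRamsey H ≤ (b : ℕ∞) := by
  rw [antiRamsey, if_pos ⟨b, h⟩]
  exact_mod_cast csSup_le ⟨_, card_mem_arrowOrders H⟩ h

theorem antiRamsey_le_of_not_isExceptional {H : SimpleGraph V}
    (hH : ¬ (IsExceptional H ∨ IsExceptional Hᶜ)) :
    (Even (Fintype.card V) → antiRamsey H ≤ ((Fintype.card V + 2 : ℕ) : ℕ∞)) ∧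
      (Odd (Fintype.card V) → antiRamsey H ≤ ((Fintype.card V + 1 : ℕ) : ℕ∞)) := by
  constructor <;> intro hp <;> refine antiRamsey_le ?_ <;> rintro n ⟨G, hG⟩ <;> by_contra! hn <;>
    have := hG.card_le hH (by rw [Fintype.card_fin]; omega) <;> rw [Fintype.card_fin] at this
  · omega
  · exact Nat.not_even_iff_odd.2 hp this.2

end

/-! ### A verified exhaustive search on 28 vertices -/

namespace RainbowSearch

/-! A search for surjective `4`-colourings without a rainbow induced `P₃ + K₁` of the graph on
`28` vertices in which `7 * j + i` and `7 * j' + i'` are adjacent if `j ≠ j'` and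
`i - i' = ±1` modulo `7`, or `j = j'` and `i - i' = ±3` modulo `7`. Sets of vertices are
represented by the binary digits of a number. For each colour the search keeps the list of the
vertices that have this colour and the set of those that cannot have it. -/

/-- The adjacency matrix of the graph, as the binary digits of a number. -/
def table : ℕ :=
  9745217109274745161648551139954048407487238807892119840877530104575962164105600515419612599377165377367970269428330475871314852403854854017874666920411440936740580056546470328514998701704408118514601252796412642194790253525492642652440

/-- The neighbours of the vertex `x`. -/
def nbrs (x : ℕ) : ℕ := (table >>> (28 * x)) % 268435456

/-- The complement of a set of vertices. -/
def co (a : ℕ) : ℕ := a ^^^ 268435455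

/-- The vertices that form an induced `P₃ + K₁` together with three given ones, which have the
neighbours `a`, `b`, `c` and the given adjacencies. -/
def completions (a b c : ℕ) (xy xz yz : Bool) : ℕ :=
  match xy, xz, yz with
  | true, true, true => 0
  | true, true, false => co (a ||| (b ||| c))
  | true, false, true => co (a ||| (b ||| c))
  | false, true, true => co (a ||| (b ||| c))
  | true, false, false => (a ^^^ b) &&& co c
  | false, true, false => (a ^^^ c) &&& co b
  | false, false, true => (b ^^^ c) &&& co a
  | false, false, false => (a &&& (b &&& co c)) ||| ((a &&& (c &&& co b)) ||| (b &&& (c &&& co a)))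

/-- The vertices that form an induced `P₃ + K₁` together with `x`, `y`, `z`. -/
def completionsOf (x y z : ℕ) : ℕ :=
  completions (nbrs x) (nbrs y) (nbrs z) ((nbrs x).testBit y) ((nbrs x).testBit z)
    ((nbrs y).testBit z)

/-- The vertices that form an induced `P₃ + K₁` together with `v` and a member of each list. -/
def completionsAll (v : ℕ) : List ℕ → List ℕ → ℕ
  | [], _ => 0
  | x :: l, m => m.foldr (fun y r => completionsOf v x y ||| r) (completionsAll v l m)

/-- `f n`, with `n` evaluated first. -/
def force (n : ℕ) (f : ℕ → Bool) : Bool :=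
  match n with
  | 0 => f 0
  | m + 1 => f (m + 1)

/-- A vertex for which few colours are left; `u` is the set of uncoloured vertices. -/
def pick (u f₀ f₁ f₂ f₃ : ℕ) : ℕ :=
  match f₀ &&& (f₁ &&& (f₂ &&& f₃)) with
  | m + 1 => Nat.log2 (m + 1)
  | 0 => match u &&& ((f₀ &&& (f₁ &&& (f₂ ||| f₃))) ||| (f₂ &&& (f₃ &&& (f₀ ||| f₁)))) with
    | m + 1 => Nat.log2 (m + 1)
    | 0 => match u &&& ((f₀ &&& (f₁ ||| (f₂ ||| f₃))) |||
        ((f₁ &&& (f₂ ||| f₃)) ||| (f₂ &&& f₃))) with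
      | m + 1 => Nat.log2 (m + 1)
      | 0 => Nat.log2 u

/-- Give the first colour to the vertex `v`, unless this is impossible, and go on with `next`. -/
def assign (next : ℕ → List ℕ → ℕ → List ℕ → ℕ → List ℕ → ℕ → List ℕ → ℕ → Bool)
    (v u : ℕ) (l₀ : List ℕ) (f₀ : ℕ) (l₁ : List ℕ) (f₁ : ℕ) (l₂ : List ℕ) (f₂ : ℕ)
    (l₃ : List ℕ) (f₃ : ℕ) : Bool :=
  f₀.testBit v ||
  force (u ^^^ (1 <<< v)) fun u =>
  force (f₁ ||| (1 <<< v ||| completionsAll v l₂ l₃)) fun f₁ =>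
  force (f₂ ||| (1 <<< v ||| completionsAll v l₁ l₃)) fun f₂ =>
  force (f₃ ||| (1 <<< v ||| completionsAll v l₁ l₂)) fun f₃ =>
  next u (v :: l₀) f₀ l₁ f₁ l₂ f₂ l₃ f₃

/-- Search to the given depth for a contradiction from a partial colouring. -/
def refute : ℕ → ℕ → List ℕ → ℕ → List ℕ → ℕ → List ℕ → ℕ → List ℕ → ℕ → Bool
  | 0 => fun _ _ _ _ _ _ _ _ _ => false
  | n + 1 => fun u l₀ f₀ l₁ f₁ l₂ f₂ l₃ f₃ =>
    -- Soundness only needs some vertex below `28`, which the remainder guarantees; the quality of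
    -- `pick` matters for speed alone.
    force (pick u f₀ f₁ f₂ f₃ % 28) fun v =>
    assign (refute n) v u l₀ f₀ l₁ f₁ l₂ f₂ l₃ f₃ &&
    (assign (refute n) v u l₁ f₁ l₀ f₀ l₂ f₂ l₃ f₃ &&
    (assign (refute n) v u l₂ f₂ l₀ f₀ l₁ f₁ l₃ f₃ &&
    assign (refute n) v u l₃ f₃ l₀ f₀ l₁ f₁ l₂ f₂))

/-- Refute the colourings that give four different colours to `0`, `v₁`, `v₂`, `v₃`. -/
def refuteStart (v₁ v₂ v₃ : ℕ) : Bool :=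
  assign (fun u l₀ f₀ l₁ f₁ l₂ f₂ l₃ f₃ =>
    assign (fun u l₁ f₁ l₀ f₀ l₂ f₂ l₃ f₃ =>
      assign (fun u l₂ f₂ l₀ f₀ l₁ f₁ l₃ f₃ =>
        assign (refute 28) v₃ u l₃ f₃ l₀ f₀ l₁ f₁ l₂ f₂)
      v₂ u l₂ f₂ l₀ f₀ l₁ f₁ l₃ f₃)
    v₁ u l₁ f₁ l₀ f₀ l₂ f₂ l₃ f₃) 0 268435455 [] 0 [] 0 [] 0 [] 0

/-- `f m` holds for all `m < n`. -/
def upto (n : ℕ) (f : ℕ → Bool) : Bool :=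
  match n with
  | 0 => true
  | n + 1 => f n && upto n f

theorem upto_spec {n : ℕ} {f : ℕ → Bool} (h : upto n f = true) {m : ℕ} (hm : m < n) :
    f m = true := by
  induction n with
  | zero => omega
  | succ n ih =>
    simp only [upto, Bool.and_eq_true] at h
    rcases Nat.lt_succ_iff_lt_or_eq.1 hm with h' | rfl
    · exact ih h.2 h'
    · exact h.1

/-- The search succeeds for all starting vertices in the same row or in consecutive ones. -/
def refuteAll : Bool :=
  upto 2 fun e₁ => upto 2 fun e₂ => upto 2 fun e₃ => upto 7 fun i₁ => upto 7 fun i₂ => upto 7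
    fun i₃ => refuteStart (7 * e₁ + i₁) (7 * (e₁ + e₂) + i₂) (7 * (e₁ + e₂ + e₃) + i₃)

set_option maxRecDepth 100000 in
-- The kernel evaluates the search for all `2³ · 7³` choices of three starting vertices.
theorem refuteAll_eq_true : refuteAll = true := by decide +kernel

theorem force_eq (n : ℕ) (f : ℕ → Bool) : force n f = f n := by cases n <;> rfl

theorem testBit_co {u : ℕ} (hu : u < 28) (a : ℕ) : (co a).testBit u = !a.testBit u := by
  rw [co, Nat.testBit_xor, show 268435455 = 2 ^ 28 - 1 by norm_num, Nat.testBit_two_pow_sub_one]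
  simp [hu]

/-- Adjacency of the vertices `u` and `v`. -/
def adj (u v : ℕ) : Bool :=
  bif u / 7 == v / 7 then (u % 7 + 7 - v % 7) % 7 == 3 || (u % 7 + 7 - v % 7) % 7 == 4
  else (u % 7 + 7 - v % 7) % 7 == 1 || (u % 7 + 7 - v % 7) % 7 == 6

set_option maxRecDepth 10000 in
-- Certifies the number `table` against the arithmetic description of adjacency.
theorem testBit_nbrs : ∀ u < 28, ∀ v < 28, (nbrs u).testBit v = adj u v := by decide +kernel

set_option maxRecDepth 10000 in
theorem adj_symm : ∀ u < 28, ∀ v < 28, adj u v = adj v u := by decide +kernel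

/-- No induced `P₃ + K₁` is rainbow. -/
def NoRainbow {κ : Type*} (col : ℕ → κ) : Prop :=
  ∀ p < 28, ∀ q < 28, ∀ r < 28, ∀ s < 28, col p ≠ col q → col p ≠ col r → col p ≠ col s →
    col q ≠ col r → col q ≠ col s → col r ≠ col s → adj p q = true → adj q r = true →
    adj p r = false → adj p s = false → adj q s = false → adj r s = false → False

/-- This is what justifies forbidding colours: a vertex completing three differently coloured ones
to an induced `P₃ + K₁` cannot take a fourth colour. -/
theorem NoRainbow.completionsOf {κ : Type*} {col : ℕ → κ} (h : NoRainbow col) {u x y z : ℕ}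
    (hu : u < 28) (hx : x < 28) (hy : y < 28) (hz : z < 28) (hxy : col x ≠ col y)
    (hxz : col x ≠ col z) (hyz : col y ≠ col z)
    (ht : (RainbowSearch.completionsOf x y z).testBit u = true) :
    col u = col x ∨ col u = col y ∨ col u = col z := by
  by_contra! hc
  obtain ⟨h1, h2, h3⟩ := hc
  have hux := adj_symm u hu x hx
  have huy := adj_symm u hu y hy
  have huz := adj_symm u hu z hz
  have hyx := adj_symm y hy x hx
  have hzx := adj_symm z hz x hx
  have hzy := adj_symm z hz y hy
  simp only [RainbowSearch.completionsOf, testBit_nbrs x hx y hy, testBit_nbrs x hx z hz,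
    testBit_nbrs y hy z hz] at ht
  cases a1 : adj x y <;> cases a2 : adj x z <;> cases a3 : adj y z <;>
    simp only [a1, a2, a3, completions, Nat.testBit_and, Nat.testBit_or, Nat.testBit_xor,
      testBit_co hu, testBit_nbrs x hx u hu, testBit_nbrs y hy u hu, testBit_nbrs z hz u hu,
      Nat.zero_testBit, Bool.false_eq_true] at ht <;>
    cases b1 : adj x u <;> cases b2 : adj y u <;> cases b3 : adj z u <;>
    simp only [b1, b2, b3] at ht hux huy huz <;> simp at ht <;>
    simp only [a1, a2, a3] at hyx hzx hzy <;>
    -- The twelve alternatives are the ways of labelling `P₃ + K₁` by `x`, `y`, `z`, `u` up to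
    -- reversing the path.
    first
    | exact h x hx y hy z hz u hu hxy hxz h1.symm hyz h2.symm h3.symm ‹_› ‹_› ‹_› ‹_› ‹_› ‹_›
    | exact h y hy x hx z hz u hu hxy.symm hyz h2.symm hxz h1.symm h3.symm ‹_› ‹_› ‹_› ‹_› ‹_› ‹_›
    | exact h x hx z hz y hy u hu hxz hxy h1.symm hyz.symm h3.symm h2.symm ‹_› ‹_› ‹_› ‹_› ‹_› ‹_›
    | exact h x hx y hy u hu z hz hxy h1.symm hxz h2.symm hyz h3 ‹_› ‹_› ‹_› ‹_› ‹_› ‹_›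
    | exact h y hy x hx u hu z hz hxy.symm h2.symm hyz h1.symm hxz h3 ‹_› ‹_› ‹_› ‹_› ‹_› ‹_›
    | exact h x hx z hz u hu y hy hxz h1.symm hxy h3.symm hyz.symm h2 ‹_› ‹_› ‹_› ‹_› ‹_› ‹_›
    | exact h z hz x hx u hu y hy hxz.symm h3.symm hyz.symm h1.symm hxy h2 ‹_› ‹_› ‹_› ‹_› ‹_› ‹_›
    | exact h y hy z hz u hu x hx hyz h2.symm hxy.symm h3.symm hxz.symm h1 ‹_› ‹_› ‹_› ‹_› ‹_› ‹_›
    | exact h z hz y hy u hu x hx hyz.symm h3.symm hxz.symm h2.symm hxy.symm h1 ‹_› ‹_› ‹_› ‹_› ‹_› ‹_›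
    | exact h x hx u hu y hy z hz h1.symm hxy hxz h2 h3 hyz ‹_› ‹_› ‹_› ‹_› ‹_› ‹_›
    | exact h x hx u hu z hz y hy h1.symm hxz hxy h3 h2 hyz.symm ‹_› ‹_› ‹_› ‹_› ‹_› ‹_›
    | exact h y hy u hu z hz x hx h2.symm hyz hxy.symm h3 h1 hxz.symm ‹_› ‹_› ‹_› ‹_› ‹_› ‹_›

end RainbowSearch

/-! ### Soundness of the search -/

namespace RainbowSearch

/-- The vertices in `l` have the colour `a`, those in `f` do not. -/
structure IsPartial {κ : Type*} (col : ℕ → κ) (a : κ) (l : List ℕ) (f : ℕ) : Prop where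
  lt : ∀ x ∈ l, x < 28
  eq : ∀ x ∈ l, col x = a
  ne : ∀ x < 28, f.testBit x = true → col x ≠ a

variable {κ : Type*} {col : ℕ → κ} {a b c d : κ}

theorem isPartial_nil : IsPartial col a [] 0 := ⟨by simp, by simp, by simp⟩

theorem IsPartial.cons {l : List ℕ} {f v : ℕ} (h : IsPartial col a l f) (hv : v < 28)
    (hcol : col v = a) : IsPartial col a (v :: l) f where
  lt := by simpa using ⟨hv, h.lt⟩
  eq := by simpa using ⟨hcol, h.eq⟩
  ne := h.ne

theorem testBit_foldr_or {F : ℕ → ℕ} {m : List ℕ} {s x : ℕ}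
    (h : (m.foldr (fun y r => F y ||| r) s).testBit x = true) :
    (∃ y ∈ m, (F y).testBit x = true) ∨ s.testBit x = true := by
  induction m with
  | nil => exact .inr h
  | cons y m ih =>
    rw [List.foldr_cons, Nat.testBit_or, Bool.or_eq_true] at h
    rcases h with h | h
    · exact .inl ⟨y, by simp, h⟩
    · rcases ih h with ⟨z, hz, h⟩ | h
      · exact .inl ⟨z, by simp [hz], h⟩
      · exact .inr h

theorem testBit_completionsAll {l m : List ℕ} {v x : ℕ}
    (h : (completionsAll v l m).testBit x = true) :
    ∃ y ∈ l, ∃ z ∈ m, (completionsOf v y z).testBit x = true := by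
  induction l with
  | nil => simp [completionsAll] at h
  | cons y l ih =>
    rw [completionsAll] at h
    rcases testBit_foldr_or h with ⟨z, hz, h⟩ | h
    · exact ⟨y, by simp, z, hz, h⟩
    · obtain ⟨y, hy, h⟩ := ih h
      exact ⟨y, by simp [hy], h⟩

theorem NoRainbow.isPartial (h : NoRainbow col) {l l' m : List ℕ} {f f' g v : ℕ}
    (hl : IsPartial col b l f) (hm : IsPartial col c m g) (hl' : IsPartial col d l' f')
    (hv : v < 28) (hcol : col v = a) (hab : a ≠ b) (hac : a ≠ c) (had : a ≠ d) (hbc : b ≠ c)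
    (hbd : b ≠ d) (hcd : c ≠ d) :
    IsPartial col d l' (f' ||| (1 <<< v ||| RainbowSearch.completionsAll v l m)) where
  lt := hl'.lt
  eq := hl'.eq
  ne := by
    intro x hx ht
    rw [Nat.testBit_or, Nat.testBit_or, Bool.or_eq_true, Bool.or_eq_true] at ht
    rcases ht with ht | ht | ht
    · exact hl'.ne x hx ht
    · rw [Nat.shiftLeft_eq, one_mul, Nat.testBit_two_pow] at ht
      obtain rfl : v = x := by simpa using ht
      rwa [hcol]
    · obtain ⟨y, hy, z, hz, ht⟩ := testBit_completionsAll ht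
      have hyb := hl.eq y hy
      have hzc := hm.eq z hz
      have := h.completionsOf hx hv (hl.lt y hy) (hm.lt z hz) (by rwa [hcol, hyb])
        (by rwa [hcol, hzc]) (by rwa [hyb, hzc]) ht
      rw [hcol, hyb, hzc] at this
      rcases this with this | this | this <;> rw [this] <;> assumption

/-- If a colouring without rainbow copies agrees with the partial colouring and with the attempted
assignment, no refutation can be reported. The continuation is assumed sound in the same sense. -/
theorem NoRainbow.assign (h : NoRainbow col) (hab : a ≠ b) (hac : a ≠ c) (had : a ≠ d)
    (hbc : b ≠ c) (hbd : b ≠ d) (hcd : c ≠ d) {v : ℕ} (hv : v < 28) (hcol : col v = a)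
    {next : ℕ → List ℕ → ℕ → List ℕ → ℕ → List ℕ → ℕ → List ℕ → ℕ → Bool}
    (hnext : ∀ u l₀ f₀ l₁ f₁ l₂ f₂ l₃ f₃, IsPartial col a l₀ f₀ → IsPartial col b l₁ f₁ →
      IsPartial col c l₂ f₂ → IsPartial col d l₃ f₃ →
      next u l₀ f₀ l₁ f₁ l₂ f₂ l₃ f₃ = false)
    {u : ℕ} {l₀ l₁ l₂ l₃ : List ℕ} {f₀ f₁ f₂ f₃ : ℕ} (h₀ : IsPartial col a l₀ f₀)
    (h₁ : IsPartial col b l₁ f₁) (h₂ : IsPartial col c l₂ f₂) (h₃ : IsPartial col d l₃ f₃) :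
    RainbowSearch.assign next v u l₀ f₀ l₁ f₁ l₂ f₂ l₃ f₃ = false := by
  simp only [RainbowSearch.assign, force_eq, Bool.or_eq_false_iff]
  refine ⟨?_, hnext _ _ _ _ _ _ _ _ _ (h₀.cons hv hcol)
    (h.isPartial h₂ h₃ h₁ hv hcol hac had hab hcd hbc.symm hbd.symm)
    (h.isPartial h₁ h₃ h₂ hv hcol hab had hac hbd hbc hcd.symm)
    (h.isPartial h₁ h₂ h₃ hv hcol hab hac had hbc hbd hcd)⟩
  by_contra hf
  exact h₀.ne v hv (by simpa using hf) hcol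

/-- The branch following the actual colour of the chosen vertex fails to be refuted, at every depth;
hence a result `true` rules out such colourings. -/
theorem NoRainbow.refute (h : NoRainbow col) (hab : a ≠ b) (hac : a ≠ c) (had : a ≠ d)
    (hbc : b ≠ c) (hbd : b ≠ d) (hcd : c ≠ d)
    (hall : ∀ x < 28, col x = a ∨ col x = b ∨ col x = c ∨ col x = d) (n : ℕ)
    (u : ℕ) (l₀ : List ℕ) (f₀ : ℕ) (l₁ : List ℕ) (f₁ : ℕ) (l₂ : List ℕ) (f₂ : ℕ)
    (l₃ : List ℕ) (f₃ : ℕ) (h₀ : IsPartial col a l₀ f₀)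
    (h₁ : IsPartial col b l₁ f₁) (h₂ : IsPartial col c l₂ f₂) (h₃ : IsPartial col d l₃ f₃) :
    RainbowSearch.refute n u l₀ f₀ l₁ f₁ l₂ f₂ l₃ f₃ = false := by
  induction n generalizing a b c d u l₀ f₀ l₁ f₁ l₂ f₂ l₃ f₃ with
  | zero => rfl
  | succ n ih =>
    simp only [RainbowSearch.refute, force_eq, Bool.and_eq_false_iff]
    have hv : pick u f₀ f₁ f₂ f₃ % 28 < 28 := Nat.mod_lt _ (by norm_num)
    rcases hall _ hv with hc | hc | hc | hc
    · exact .inl (h.assign hab hac had hbc hbd hcd hv hc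
        (ih hab hac had hbc hbd hcd hall) h₀ h₁ h₂ h₃)
    · exact .inr (.inl (h.assign hab.symm hbc hbd hac had hcd hv hc
        (ih hab.symm hbc hbd hac had hcd (fun x hx => by have := hall x hx; tauto)) h₁ h₀ h₂ h₃))
    · exact .inr (.inr (.inl (h.assign hac.symm hbc.symm hcd hab had hbd hv hc
        (ih hac.symm hbc.symm hcd hab had hbd (fun x hx => by have := hall x hx; tauto))
        h₂ h₀ h₁ h₃)))
    · exact .inr (.inr (.inr (h.assign had.symm hbd.symm hcd.symm hab hac hbc hv hc
        (ih had.symm hbd.symm hcd.symm hab hac hbc (fun x hx => by have := hall x hx; tauto))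
        h₃ h₀ h₁ h₂)))

theorem NoRainbow.refuteStart (h : NoRainbow col) (hab : a ≠ b) (hac : a ≠ c) (had : a ≠ d)
    (hbc : b ≠ c) (hbd : b ≠ d) (hcd : c ≠ d)
    (hall : ∀ x < 28, col x = a ∨ col x = b ∨ col x = c ∨ col x = d)
    {v₁ v₂ v₃ : ℕ} (h₁ : v₁ < 28) (h₂ : v₂ < 28) (h₃ : v₃ < 28) (ha : col 0 = a)
    (hb : col v₁ = b) (hc : col v₂ = c) (hd : col v₃ = d) :
    RainbowSearch.refuteStart v₁ v₂ v₃ = false := by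
  refine h.assign hab hac had hbc hbd hcd (by norm_num) ha ?_ isPartial_nil isPartial_nil
    isPartial_nil isPartial_nil
  intro u l₀ f₀ l₁ f₁ l₂ f₂ l₃ f₃ p₀ p₁ p₂ p₃
  refine h.assign hab.symm hbc hbd hac had hcd h₁ hb ?_ p₁ p₀ p₂ p₃
  intro u l₁ f₁ l₀ f₀ l₂ f₂ l₃ f₃ p₁ p₀ p₂ p₃
  refine h.assign hac.symm hbc.symm hcd hab had hbd h₂ hc ?_ p₂ p₀ p₁ p₃
  intro u l₂ f₂ l₀ f₀ l₁ f₁ l₃ f₃ p₂ p₀ p₁ p₃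
  refine h.assign had.symm hbd.symm hcd.symm hab hac hbc h₃ hd ?_ p₃ p₀ p₁ p₂
  exact h.refute had.symm hbd.symm hcd.symm hab hac hbc
    (fun x hx => by have := hall x hx; tauto) 28

/-- A colouring with four colours in which `0` and three further vertices, each in the same row as
the preceding one or in the next, have different colours has a rainbow `P₃ + K₁`. -/
theorem not_noRainbow (hab : a ≠ b) (hac : a ≠ c) (had : a ≠ d) (hbc : b ≠ c) (hbd : b ≠ d)
    (hcd : c ≠ d) (hall : ∀ x < 28, col x = a ∨ col x = b ∨ col x = c ∨ col x = d)
    {e₁ e₂ e₃ i₁ i₂ i₃ : ℕ} (he₁ : e₁ < 2) (he₂ : e₂ < 2) (he₃ : e₃ < 2) (hi₁ : i₁ < 7)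
    (hi₂ : i₂ < 7) (hi₃ : i₃ < 7) (ha : col 0 = a) (hb : col (7 * e₁ + i₁) = b)
    (hc : col (7 * (e₁ + e₂) + i₂) = c) (hd : col (7 * (e₁ + e₂ + e₃) + i₃) = d) :
    ¬ NoRainbow col := by
  intro h
  have h1 := upto_spec (upto_spec (upto_spec (upto_spec (upto_spec (upto_spec refuteAll_eq_true
    he₁) he₂) he₃) hi₁) hi₂) hi₃
  rw [h.refuteStart hab hac had hbc hbd hcd hall (by omega) (by omega) (by omega) ha hb hc hd] at h1
  exact Bool.false_ne_true h1

end RainbowSearch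

/-! ### Complements, complete graphs and stars -/

section

variable {V W W' : Type*} [Fintype V] {H : SimpleGraph V}

theorem Arrows.of_iso {G : SimpleGraph W} {G' : SimpleGraph W'} (h : Arrows G H) (e : G ≃g G') :
    Arrows G' H := by
  intro c hc
  obtain ⟨φ, hφ⟩ := h (c ∘ e) (hc.comp e.surjective)
  exact ⟨φ.trans e.toEmbedding, hφ⟩

theorem Arrows.compl {G : SimpleGraph W} (h : Arrows G H) : Arrows Gᶜ Hᶜ := by
  intro c hc
  obtain ⟨φ, hφ⟩ := h c hc
  exact ⟨⟨φ.toEmbedding, by intro x y; simp [φ.injective.eq_iff]⟩, hφ⟩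

theorem Arrows.card_mem [Fintype W] {G : SimpleGraph W} (h : Arrows G H) :
    Fintype.card W ∈ arrowOrders H :=
  ⟨_, h.of_iso (SimpleGraph.Iso.map (Fintype.equivFin W) G)⟩

theorem arrowOrders_compl_subset : arrowOrders H ⊆ arrowOrders Hᶜ :=
  fun _ ⟨_, hG⟩ => ⟨_, hG.compl⟩

theorem antiRamsey_compl : antiRamsey Hᶜ = antiRamsey H := by
  have : arrowOrders Hᶜ = arrowOrders H :=
    (arrowOrders_compl_subset.trans (by rw [compl_compl])).antisymm arrowOrders_compl_subset
  rw [antiRamsey, antiRamsey, this]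

theorem antiRamsey_eq_top (h : ∀ b, ∃ n ∈ arrowOrders H, b < n) : antiRamsey H = ⊤ := by
  refine if_neg ?_
  rintro ⟨b, hb⟩
  obtain ⟨n, hn, hbn⟩ := h b
  exact absurd (hb hn) (by omega)

theorem antiRamsey_top : antiRamsey (⊤ : SimpleGraph V) = ⊤ := by
  refine antiRamsey_eq_top fun b => ⟨b + 1, ⟨⊤, fun c hc => ?_⟩, b.lt_succ_self⟩
  let e := Fintype.equivFin V
  have hs : ∀ v, c (Function.surjInv hc (e v)) = e v := fun v => Function.surjInv_eq hc _
  have hinj : Function.Injective fun v => Function.surjInv hc (e v) :=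
    (Function.injective_surjInv hc).comp e.injective
  exact ⟨⟨⟨_, hinj⟩, by simp [hinj.eq_iff]⟩, fun v w h => e.injective (by simpa [hs] using h)⟩

open scoped Classical in
-- In a larger star, the centre together with one vertex of each colour other than the centre's is a
-- rainbow star.
theorem antiRamsey_starGraph (r : V) : antiRamsey (SimpleGraph.starGraph r) = ⊤ := by
  refine antiRamsey_eq_top fun b => ⟨b + 1, ⟨SimpleGraph.starGraph 0, fun c hc => ?_⟩,
    b.lt_succ_self⟩
  -- The swap assigns to `r` the colour of the centre of the large star.
  let e := (Fintype.equivFin V).trans (Equiv.swap (Fintype.equivFin V r) (c 0))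
  have hr : e r = c 0 := by simp [e]
  let f : V → Fin (b + 1) := fun v => if v = r then 0 else Function.surjInv hc (e v)
  have hf : ∀ v, c (f v) = e v := by
    intro v
    by_cases hv : v = r
    · simp [f, hv, hr]
    · simp [f, hv, Function.surjInv_eq hc]
  have hinj : Function.Injective f := fun v w h => e.injective (by rw [← hf, ← hf, h])
  have h0 : ∀ v, f v = 0 ↔ v = r := by
    intro v
    rw [show (0 : Fin (b + 1)) = f r by simp [f], hinj.eq_iff]
  refine ⟨⟨⟨f, hinj⟩, by simp [hinj.eq_iff, h0]⟩, fun v w h => e.injective ?_⟩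
  simpa [hf] using h

end

/-! ### Arbitrarily large graphs arrowing `P₃ + K₁` -/

/-- The graph on `N` rows of seven vertices in which `(i, j)` and `(i', j')` are adjacent if
`i - i' = ±1` and `j ≠ j'`, or `i - i' = ±3` and `j = j'`. -/
def sevenRows (N : ℕ) : SimpleGraph (ZMod 7 × Fin N) where
  Adj x y := (x.2 = y.2 ∧ (x.1 - y.1 = 3 ∨ x.1 - y.1 = 4)) ∨
    (x.2 ≠ y.2 ∧ (x.1 - y.1 = 1 ∨ x.1 - y.1 = 6))
  symm := ⟨by
    rintro ⟨i, j⟩ ⟨i', j'⟩ h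
    have : ∀ i i' : ZMod 7, (i - i' = 3 ∨ i - i' = 4 → i' - i = 3 ∨ i' - i = 4) ∧
      (i - i' = 1 ∨ i - i' = 6 → i' - i = 1 ∨ i' - i = 6) := by decide
    exact h.imp (fun h => ⟨h.1.symm, (this i i').1 h.2⟩) fun h => ⟨h.1.symm, (this i i').2 h.2⟩⟩
  loopless := ⟨by
    rintro ⟨i, j⟩ h
    simp only [ne_eq, not_true_eq_false, false_and, or_false, true_and, sub_self] at h
    revert h
    decide⟩

namespace RainbowSearch

/-- Along a monotone sequence each row is either the preceding one or new. Numbering the rows in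
order of appearance, and padding with unused rows up to four, gives the normal form treated by
`refuteAll`. -/
theorem exists_rows {N : ℕ} (hN : 4 ≤ N) {f : Fin 4 → Fin N} (hf : Monotone f) :
    ∃ ρ : ℕ → Fin N, (∀ i < 4, ∀ j < 4, ρ i = ρ j → i = j) ∧ ∃ e₁ < 2, ∃ e₂ < 2, ∃ e₃ < 2,
      f 0 = ρ 0 ∧ f 1 = ρ e₁ ∧ f 2 = ρ (e₁ + e₂) ∧ f 3 = ρ (e₁ + e₂ + e₃) := by
  have fresh : ∀ x y z : Fin N, ∃ w, w ≠ x ∧ w ≠ y ∧ w ≠ z := by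
    intro x y z
    obtain ⟨w, -, hw⟩ := Finset.exists_mem_notMem_of_card_lt_card
      (s := {x, y, z}) (t := Finset.univ) (by
        rw [Finset.card_univ, Fintype.card_fin]
        exact (Finset.card_le_three).trans_lt hN)
    exact ⟨w, by simpa using hw⟩
  have key : ∀ x y z w : Fin N, x ≠ y → x ≠ z → x ≠ w → y ≠ z → y ≠ w → z ≠ w →
      ∃ ρ : ℕ → Fin N, (∀ i < 4, ∀ j < 4, ρ i = ρ j → i = j) ∧ ρ 0 = x ∧ ρ 1 = y ∧ ρ 2 = z ∧
        ρ 3 = w := by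
    intro x y z w hxy hxz hxw hyz hyw hzw
    refine ⟨fun n => if n = 0 then x else if n = 1 then y else if n = 2 then z else w,
      ?_, rfl, rfl, rfl, rfl⟩
    intro i hi j hj
    interval_cases i <;> interval_cases j <;> simp [*, Ne.symm, eq_comm]
  have h1 : f 0 ≤ f 1 := hf (by decide)
  have h2 : f 1 ≤ f 2 := hf (by decide)
  have h3 : f 2 ≤ f 3 := hf (by decide)
  rcases h1.eq_or_lt with h1 | h1 <;> rcases h2.eq_or_lt with h2 | h2 <;>
    rcases h3.eq_or_lt with h3 | h3
  · obtain ⟨x, hx, -⟩ := fresh (f 0) (f 0) (f 0)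
    obtain ⟨y, hy, hy', -⟩ := fresh (f 0) x x
    obtain ⟨z, hz, hz', hz''⟩ := fresh (f 0) x y
    obtain ⟨ρ, hρ, r0, r1, r2, r3⟩ := key (f 0) x y z hx.symm hy.symm hz.symm hy'.symm hz'.symm
      hz''.symm
    exact ⟨ρ, hρ, 0, by simp, 0, by simp, 0, by simp, by simp [*]⟩
  · obtain ⟨x, hx, hx', -⟩ := fresh (f 0) (f 3) (f 3)
    obtain ⟨y, hy, hy', hy''⟩ := fresh (f 0) (f 3) x
    obtain ⟨ρ, hρ, r0, r1, r2, r3⟩ := key (f 0) (f 3) x y (by rw [h1, h2]; exact h3.ne) hx.symm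
      hy.symm hx'.symm hy'.symm hy''.symm
    exact ⟨ρ, hρ, 0, by simp, 0, by simp, 1, by simp, by simp [*]⟩
  · obtain ⟨x, hx, hx', -⟩ := fresh (f 0) (f 2) (f 2)
    obtain ⟨y, hy, hy', hy''⟩ := fresh (f 0) (f 2) x
    obtain ⟨ρ, hρ, r0, r1, r2, r3⟩ := key (f 0) (f 2) x y (by rw [h1]; exact h2.ne) hx.symm
      hy.symm hx'.symm hy'.symm hy''.symm
    exact ⟨ρ, hρ, 0, by simp, 1, by simp, 0, by simp, by simp [*]⟩
  · obtain ⟨x, hx, hx', hx''⟩ := fresh (f 0) (f 2) (f 3)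
    obtain ⟨ρ, hρ, r0, r1, r2, r3⟩ := key (f 0) (f 2) (f 3) x (by rw [h1]; exact h2.ne)
      (by rw [h1]; exact (h2.trans h3).ne) hx.symm h3.ne hx'.symm hx''.symm
    exact ⟨ρ, hρ, 0, by simp, 1, by simp, 1, by simp, by simp [*]⟩
  · obtain ⟨x, hx, hx', -⟩ := fresh (f 0) (f 1) (f 1)
    obtain ⟨y, hy, hy', hy''⟩ := fresh (f 0) (f 1) x
    obtain ⟨ρ, hρ, r0, r1, r2, r3⟩ := key (f 0) (f 1) x y h1.ne hx.symm hy.symm hx'.symm hy'.symm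
      hy''.symm
    exact ⟨ρ, hρ, 1, by simp, 0, by simp, 0, by simp, by simp [*]⟩
  · obtain ⟨x, hx, hx', hx''⟩ := fresh (f 0) (f 1) (f 3)
    obtain ⟨ρ, hρ, r0, r1, r2, r3⟩ := key (f 0) (f 1) (f 3) x h1.ne
      (by rw [← h2] at h3; exact (h1.trans h3).ne) hx.symm (by rw [h2]; exact h3.ne) hx'.symm
      hx''.symm
    exact ⟨ρ, hρ, 1, by simp, 0, by simp, 1, by simp, by simp [*]⟩
  · obtain ⟨x, hx, hx', hx''⟩ := fresh (f 0) (f 1) (f 2)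
    obtain ⟨ρ, hρ, r0, r1, r2, r3⟩ := key (f 0) (f 1) (f 2) x h1.ne (h1.trans h2).ne hx.symm h2.ne
      hx'.symm hx''.symm
    exact ⟨ρ, hρ, 1, by simp, 1, by simp, 0, by simp, by simp [*]⟩
  · obtain ⟨ρ, hρ, r0, r1, r2, r3⟩ := key (f 0) (f 1) (f 2) (f 3) h1.ne (h1.trans h2).ne
      ((h1.trans h2).trans h3).ne h2.ne (h2.trans h3).ne h3.ne
    exact ⟨ρ, hρ, 1, by simp, 1, by simp, 1, by simp, by simp [*]⟩

/-- The vertex of `sevenRows N` numbered `n`, after a translation by `t` and with the rows given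
by `ρ`. -/
def vertex {N : ℕ} (ρ : ℕ → Fin N) (t : ZMod 7) (n : ℕ) : ZMod 7 × Fin N := (n + t, ρ (n / 7))

theorem vertex_add {N : ℕ} (ρ : ℕ → Fin N) (t : ZMod 7) (x : ZMod 7 × Fin N) {e : ℕ}
    (he : x.2 = ρ e) : vertex ρ t (7 * e + (x.1 - t).val) = x := by
  have hlt : (x.1 - t).val < 7 := ZMod.val_lt _
  have h7 : (7 : ZMod 7) = 0 := by decide
  refine Prod.ext ?_ ?_
  · simp [vertex, h7]
  · rw [vertex, he, show (7 * e + (x.1 - t).val) / 7 = e by omega]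

set_option maxRecDepth 10000 in
theorem adj_eq : ∀ u < 28, ∀ v < 28, adj u v =
    bif u / 7 == v / 7 then decide ((u : ZMod 7) - v = 3 ∨ (u : ZMod 7) - v = 4)
    else decide ((u : ZMod 7) - v = 1 ∨ (u : ZMod 7) - v = 6) := by decide +kernel

theorem sevenRows_adj_vertex {N : ℕ} {ρ : ℕ → Fin N}
    (hρ : ∀ i < 4, ∀ j < 4, ρ i = ρ j → i = j) (t : ZMod 7) {u v : ℕ} (hu : u < 28) (hv : v < 28) :
    (sevenRows N).Adj (vertex ρ t u) (vertex ρ t v) ↔ adj u v = true := by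
  have hiff : ρ (u / 7) = ρ (v / 7) ↔ u / 7 = v / 7 :=
    ⟨hρ _ (by omega) _ (by omega), fun h => by rw [h]⟩
  rw [adj_eq u hu v hv]
  by_cases h : u / 7 = v / 7
  · simp [sevenRows, vertex, h]
  · simp [sevenRows, vertex, hiff, h]

end RainbowSearch

theorem injective_comp_sumElim {W κ : Type*} {c : W → κ} {p q r s : W} (hpq : c p ≠ c q)
    (hpr : c p ≠ c r) (hps : c p ≠ c s) (hqr : c q ≠ c r) (hqs : c q ≠ c s) (hrs : c r ≠ c s) :
    Function.Injective fun x : Fin 3 ⊕ Fin 1 => c (Sum.elim ![p, q, r] (fun _ => s) x) := by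
  rintro (x | x) (y | y) hxy <;> fin_cases x <;> fin_cases y <;> simp at hxy ⊢ <;> simp_all

open RainbowSearch in
-- Choose one vertex of each colour and sort them by row. Since `sevenRows` is invariant under
-- translating columns and permuting rows, the first may be placed at vertex `0`, and the four
-- representatives lie in a copy of the 28-vertex graph in one of the searched positions. All four
-- colours occur there, so the search yields a rainbow copy.
theorem arrows_sevenRows {V : Type*} [Fintype V] {H : SimpleGraph V} (hH : IsPathThreeAddPoint H)
    {N : ℕ} (hN : 4 ≤ N) : Arrows (sevenRows N) H := by
  obtain ⟨e⟩ := hH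
  have h4 : Fintype.card V = 4 := by simpa using Fintype.card_congr e.toEquiv
  intro c hc
  let r₀ : Fin 4 → ZMod 7 × Fin N := fun i => Function.surjInv hc (Fin.cast h4.symm i)
  let r : Fin 4 → ZMod 7 × Fin N := r₀ ∘ Tuple.sort fun i => (r₀ i).2
  have hcr₀ : ∀ i, c (r₀ i) = Fin.cast h4.symm i := fun i => Function.surjInv_eq hc _
  have hr : Function.Bijective fun i => c (r i) := by
    have : (fun i => c (r i)) = Fin.cast h4.symm ∘ Tuple.sort fun i => (r₀ i).2 := by
      funext i
      exact hcr₀ _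
    rw [this]
    exact (finCongr h4.symm).bijective.comp (Equiv.bijective _)
  obtain ⟨ρ, hρ, e₁, he₁, e₂, he₂, e₃, he₃, f0, f1, f2, f3⟩ := exists_rows hN
    (f := fun i => (r i).2) (Tuple.monotone_sort fun i => (r₀ i).2)
  have hv := fun i => ZMod.val_lt ((r i).1 - (r 0).1)
  have hrne : ∀ i j, i ≠ j → c (r i) ≠ c (r j) := fun i j => hr.1.ne
  have hno := not_noRainbow (col := fun n => c (vertex ρ (r 0).1 n))
    (hrne 0 1 (by decide)) (hrne 0 2 (by decide)) (hrne 0 3 (by decide))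
    (hrne 1 2 (by decide)) (hrne 1 3 (by decide)) (hrne 2 3 (by decide))
    (fun x _ => by
      obtain ⟨i, hi⟩ := hr.2 (c (vertex ρ (r 0).1 x))
      rw [← hi]
      fin_cases i <;> simp)
    he₁ he₂ he₃ (hv 1) (hv 2) (hv 3)
    (by simpa using congrArg c (vertex_add ρ (r 0).1 (r 0) f0))
    (congrArg c (vertex_add ρ _ _ f1)) (congrArg c (vertex_add ρ _ _ f2))
    (congrArg c (vertex_add ρ _ _ f3))
  simp only [NoRainbow, not_forall, exists_prop, not_false_eq_true, and_true] at hno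
  obtain ⟨p, hp, q, hq, s, hs, t, ht, npq, nps, npt, nqs, nqt, nst, apq, aqs, aps, apt, aqt, ast⟩ :=
    hno
  have ha := fun {u v : ℕ} => sevenRows_adj_vertex hρ (r 0).1 (u := u) (v := v)
  rw [← ha hp hq] at apq
  rw [← ha hq hs] at aqs
  rw [← Bool.not_eq_true, ← ha hp hs] at aps
  rw [← Bool.not_eq_true, ← ha hp ht] at apt
  rw [← Bool.not_eq_true, ← ha hq ht] at aqt
  rw [← Bool.not_eq_true, ← ha hs ht] at ast
  generalize vertex ρ (r 0).1 p = p' at *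
  generalize vertex ρ (r 0).1 q = q' at *
  generalize vertex ρ (r 0).1 s = s' at *
  generalize vertex ρ (r 0).1 t = t' at *
  have hinj := injective_comp_sumElim npq nps npt nqs nqt nst
  have hinj' : Function.Injective (Sum.elim ![p', q', s'] (fun _ : Fin 1 => t')) :=
    Function.Injective.of_comp (f := c) hinj
  refine ⟨e.toEmbedding.trans ⟨⟨_, hinj'⟩, ?_⟩, hinj.comp e.injective⟩
  intro x y
  change (sevenRows N).Adj (Sum.elim ![p', q', s'] (fun _ => t') x)
    (Sum.elim ![p', q', s'] (fun _ => t') y) ↔ _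
  revert x y
  rintro (x | x) (y | y) <;> fin_cases x <;> fin_cases y <;>
    simp_all [SimpleGraph.pathGraph_adj, (sevenRows N).adj_comm]

theorem antiRamsey_of_isPathThreeAddPoint {V : Type*} [Fintype V] {H : SimpleGraph V}
    (hH : IsPathThreeAddPoint H) : antiRamsey H = ⊤ := by
  refine antiRamsey_eq_top fun b =>
    ⟨_, (arrows_sevenRows hH (N := b + 4) (by omega)).card_mem, ?_⟩
  simp only [Fintype.card_prod, ZMod.card, Fintype.card_fin]
  omega

theorem IsExceptional.antiRamsey_eq_top {V : Type*} [Fintype V] {H : SimpleGraph V}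
    (hH : IsExceptional H) : antiRamsey H = ⊤ := by
  rcases hH with rfl | ⟨r, rfl⟩ | hH
  · exact antiRamsey_top
  · exact antiRamsey_starGraph r
  · exact antiRamsey_of_isPathThreeAddPoint hH

theorem theorem4 {V : Type*} [Fintype V] (H : SimpleGraph V) (k : ℕ)
    (hk : Fintype.card V = k) :
    ((IsExceptional H ∨ IsExceptional Hᶜ) → antiRamsey H = ⊤) ∧
    (¬ (IsExceptional H ∨ IsExceptional Hᶜ) →
      (Even k → antiRamsey H ≤ ((k + 2 : ℕ) : ℕ∞)) ∧
      (Odd k → antiRamsey H ≤ ((k + 1 : ℕ) : ℕ∞))) := by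
  subst hk
  refine ⟨?_, antiRamsey_le_of_not_isExceptional⟩
  rintro (h | h)
  · exact h.antiRamsey_eq_top
  · rw [← antiRamsey_compl]
    exact h.antiRamsey_eq_top
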